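/- Let $(t_\alpha)_{\alpha\in\mathbb Z}$ be real numbers, finitely many and at least one of them non-zero, and put $f(z)=\sum_\alpha t_\alpha z^\alpha$. Let $N_p\ge 0$ be the order of the pole of $f$ at $0$ (with $N_p=0$ if there is none). Assume that $f$ has no zero on the unit circle ($c=0$), let $z_1,\dots,z_{N_z}$ and $Z_1,\dots,Z_{N_Z}$ be the zeros of $f$ in $\mathbb C$ with $|z_i|<1$ and $|Z_j|>1$, listed with multiplicity (a zero at the origin counts among the $z_i$), and let $\omega=N_z-N_p$ be the winding number. For $L\ge 1$ consider the periodic chain with $L$ sites (labels taken modulo $L$) and spinless fermions $c_n,c_n^\dagger$ acting on the $2^L$-dimensional Fock space. Put $\gamma_n=c_n^\dagger+c_n$, $\tilde\gamma_n=\mathrm i(c_n^\dagger-c_n)$ and $$H=\frac{\mathrm i}{2}\sum_{\alpha}\sum_{n=1}^{L} t_\alpha\,\tilde\gamma_n\gamma_{n+\alpha}.$$ For $\alpha\in\mathbb Z$ let $x=\lfloor|\alpha|/2\rfloor$ and $$\mathcal O_\alpha(n)=\begin{cases}\mathrm i^{x}\Big(\prod_{m=1}^{n-1}\mathrm i\tilde\gamma_m\gamma_m\Big)\gamma_n\gamma_{n+1}\cdots\gamma_{n+\alpha-1}&\alpha>0,\\[2pt]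 (-\mathrm i)^{x}\Big(\prod_{m=1}^{n-1}\mathrm i\tilde\gamma_m\gamma_m\Big)(-\mathrm i\tilde\gamma_n)\cdots(-\mathrm i\tilde\gamma_{n+|\alpha|-1})&\alpha<0,\\[2pt] \prod_{m=1}^{n-1}\mathrm i\tilde\gamma_m\gamma_m&\alpha=0.\end{cases}$$ Let $\langle\,\cdot\,\rangle_L$ be the expectation value in a normalised ground state of $H$ on $L$ sites (an eigenvector for the lowest eigenvalue; any choice for each $L$), and let $$R=\frac{\prod_{i,i'=1}^{N_z}(1-z_iz_{i'})\ \prod_{j,j'=1}^{N_Z}\Big(1-\frac{1}{Z_jZ_{j'}}\Big)}{\prod_{i=1}^{N_z}\prod_{j=1}^{N_Z}\Big(1-\frac{z_i}{Z_j}\Big)^{2}}.$$ Then $R$ is a positive real number; for every $N\ge 0$ the thermodynamic limit $\langle\mathcal O_\omega(1)\mathcal O_\omega(N+1)\rangle=\lim_{L\to\infty}\langle\mathcal O_\omega(1)\mathcal O_\omega(N+1)\rangle_L$ exists; and $$\lim_{N\to\infty}\big|\langle\mathcal O_\omega(1)\mathcal O_\omega(N+1)\rangle\big|=R^{1/4},$$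 where $R^{1/4}$ is the positive fourth root. Likewise $\big|\langle\mathcal O_\omega(1)\mathcal O_\omega(N+1)\rangle_L\big|\to R^{1/4}$ along all sequences of pairs $(N,L)$ with $N\to\infty$, $L\to\infty$ and $N/L\to 0$. -/

import Mathlib

open Filter Topology
open scoped Matrix

namespace BDI

noncomputable section

/-! ### Fermions on a periodic chain of `L` sites

Sites are the residues modulo `L`. A basis vector of the Fock space is given by the set `S` of
occupied sites, so that states are functions `Finset (ZMod L) → ℂ` (with the standard Hermitian
inner product) and operators are complex matrices indexed by `Finset (ZMod L)`. -/

section Fock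

variable (L : ℕ) [NeZero L]

/-- Operators on the Fock space of the chain with `L` sites. -/
abbrev Op : Type := Matrix (Finset (ZMod L)) (Finset (ZMod L)) ℂ

/-- The annihilation operator `c_n`. It sends the basis vector of `T = insert n S`, with `n ∉ S`, to
`(-1) ^ #{m ∈ S | m < n}` times the basis vector of `S`, and basis vectors in which `n` is empty
to `0`; the order of the sites used for the sign is that of their representatives
`0, …, L - 1`. -/
def annih (n : ZMod L) : Op L :=
  Matrix.of fun S T =>
    if n ∉ S ∧ T = insert n S then (-1) ^ (S.filter fun m => m.val < n.val).card else 0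

/-- The creation operator `c_n†`, the adjoint of `c_n`. -/
def creat (n : ZMod L) : Op L := (annih L n)ᴴ

/-- The real Majorana operator `γ_n = c_n† + c_n`. -/
def gam (n : ZMod L) : Op L := creat L n + annih L n

/-- The imaginary Majorana operator `γ̃_n = i (c_n† - c_n)`. -/
def gamT (n : ZMod L) : Op L := Complex.I • (creat L n - annih L n)

/-- The Hamiltonian `(i/2) ∑_n ∑_α t_α γ̃_n γ_{n+α}` with periodic boundary conditions. -/
def hamiltonian (t : ℤ →₀ ℝ) : Op L :=
  ∑ n : ZMod L, ∑ α ∈ t.support,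
    (Complex.I / 2 * (t α : ℂ)) • (gamT L n * gam L (n + (α : ZMod L)))

/-- The parity string `∏_{m=1}^{n-1} (i γ̃_m γ_m)`. -/
def parityString (n : ℕ) : Op L :=
  ((List.range (n - 1)).map fun m : ℕ =>
    Complex.I • (gamT L ((m + 1 : ℕ) : ZMod L) * gam L ((m + 1 : ℕ) : ZMod L))).prod

/-- The string operator `𝒪_α(n)`, for a site label `n ≥ 1`. The exponent of the phase is
`x = |α|/2` for even `α` and `x = (|α| - 1)/2` for odd `α`, that is `α.natAbs / 2` rounded down.
For `α = 0` the operator is the parity string alone. -/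
def stringOp (α : ℤ) (n : ℕ) : Op L :=
  if 0 ≤ α then
    Complex.I ^ (α.natAbs / 2) • (parityString L n *
      ((List.range α.natAbs).map fun j : ℕ => gam L ((n + j : ℕ) : ZMod L)).prod)
  else
    (-Complex.I) ^ (α.natAbs / 2) • (parityString L n *
      ((List.range α.natAbs).map fun j : ℕ =>
        (-Complex.I) • gamT L ((n + j : ℕ) : ZMod L)).prod)

variable {L}

/-- `ψ` is a normalised eigenvector of `H` for the lowest eigenvalue of `H`. -/
def IsGroundState (H : Op L) (ψ : Finset (ZMod L) → ℂ) : Prop :=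
  star ψ ⬝ᵥ ψ = 1 ∧
    ∃ E : ℝ, H *ᵥ ψ = (E : ℂ) • ψ ∧
      ∀ (E' : ℝ) (φ : Finset (ZMod L) → ℂ), φ ≠ 0 → H *ᵥ φ = (E' : ℂ) • φ → E ≤ E'

/-- The expectation value `⟨ψ, A ψ⟩`. -/
def expval (ψ : Finset (ZMod L) → ℂ) (A : Op L) : ℂ := star ψ ⬝ᵥ (A *ᵥ ψ)

/-- The correlator `⟨𝒪_α(1) 𝒪_α(N+1)⟩` in the state `ψ` of the chain with `L` sites. -/
def stringCorr (ψ : Finset (ZMod L) → ℂ) (α : ℤ) (N : ℕ) : ℂ :=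
  expval ψ (stringOp L α 1 * stringOp L α (N + 1))

end Fock

/-! ### The function `f` and its zeros -/

section Symbol

variable (t : ℤ →₀ ℝ)

/-- `f(z) = ∑_α t_α z^α`. -/
def symbol (z : ℂ) : ℂ := ∑ α ∈ t.support, (t α : ℂ) * z ^ α

/-- `N_p`, the order of the pole of `f` at the origin (`0` if there is no pole): the largest `p ≥ 0`
for which `p = 0` or `t_{-p} ≠ 0`. -/
def poleOrder : ℕ := t.support.sup fun α => (-α).toNat

/-- The polynomial `z^{N_p} f(z)`. -/
def numerator : Polynomial ℂ :=
  ∑ α ∈ t.support,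
    Polynomial.C (t α : ℂ) * Polynomial.X ^ (α + (poleOrder t : ℤ)).toNat

theorem eval_numerator {z : ℂ} (hz : z ≠ 0) :
    (numerator t).eval z = z ^ poleOrder t * symbol t z := by
  unfold numerator symbol
  rw [Polynomial.eval_finsetSum, Finset.mul_sum]
  refine Finset.sum_congr rfl fun α hα => ?_
  have h1 : (-α).toNat ≤ poleOrder t := Finset.le_sup (f := fun α : ℤ => (-α).toNat) hα
  have h2 : (((α + (poleOrder t : ℤ)).toNat : ℕ) : ℤ) = α + poleOrder t :=
    Int.toNat_of_nonneg (by omega)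
  have h3 : z ^ (α + (poleOrder t : ℤ)).toNat = z ^ α * z ^ poleOrder t := by
    rw [← zpow_natCast, h2, zpow_add₀ hz, zpow_natCast]
  simp only [Polynomial.eval_mul, Polynomial.eval_C, Polynomial.eval_pow, Polynomial.eval_X, h3]
  ring

/-- The multiset of zeros of `f` in `ℂ`. If `f` has a pole at the origin then `numerator t` does not
vanish there, and otherwise `f` is the polynomial `numerator t`, so these are the roots of
`numerator t`. -/
def zeros : Multiset ℂ := (numerator t).roots

/-- The zeros `z_i` of `f` inside the unit circle, with multiplicity. -/
def zerosIn : Multiset ℂ := (zeros t).filter fun z => ‖z‖ < 1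

/-- The zeros of `f` on the unit circle, with multiplicity. -/
def zerosOn : Multiset ℂ := (zeros t).filter fun z => ‖z‖ = 1

/-- The zeros `Z_j` of `f` outside the unit circle, with multiplicity. -/
def zerosOut : Multiset ℂ := (zeros t).filter fun z => 1 < ‖z‖

/-- `c`, half the number of zeros on the unit circle. -/
def centralCharge : ℚ := ((zerosOn t).card : ℚ) / 2

/-- `ω = N_z - N_p`. -/
def windingNumber : ℤ := ((zerosIn t).card : ℤ) - (poleOrder t : ℤ)

end Symbol

end

end BDI

/-!
The Hamiltonian is quadratic in the Majorana operators, and its commutators with the Fourier modes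
of `γ` and `γ̃` are given by the symbol `f`. As `f` has no zero on the unit circle, each mode that
lowers the energy lowers it strictly, so that it annihilates any ground state. In position space
this says that `γ_m - i ∑_n β(m - n) γ̃_n` annihilates the ground state, where `β` is the discrete
Fourier transform of the phase `f/|f|` (`IsGroundState.lowerOp_mulVec`). Wick's theorem follows by
induction (`IsGroundState.wick`), and the string correlator becomes, up to a factor of modulus one,
the determinant of the `N × N` matrix with entries `β(b - a + ω)` (`stringCorr_eq_det`).

On the unit circle `(f/|f|)² = f(z)/f(1/z)`. Hence, up to a sign, `f/|f|` is `z^ω g(z)/g(1/z)`, where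
`g² = ∏ (1 - z/Z_j) / ∏ (1 - z_i z)` (`exists_phase_factorization`): the winding `z^ω` is removed by
the shift `ω` of the matrix above, and for `L → ∞` that matrix becomes the Toeplitz matrix of a
symbol of the form `a(z) c(1/z)`. The series `g` and `1/g` converge in a disc of radius `s > 1`, so
that the entries differ from their limits by at most a multiple of `s^{-(L-N)}`. When `N/L → 0`
this decay outweighs the growth `C^N` allowed for the determinant (`tendsto_det_chainMat_sub`).

What remains is the limit of the Toeplitz determinants `D(a, c)` of `a(z) c(1/z)`. Stripped of its
triangular factors, whose determinants are `1`, the Toeplitz matrix is `1 + Y` with `Y`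
exponentially localized in one corner, and conjugating by one more triangular factor shows that
`D(b a, c) - D(b, c) D(a, c)` tends to `0` (`tendsto_det_toepMat_mul_sub`). This
multiplicativity in each argument replaces the strong Szegő theorem. It gives
`D(g, 1/g)^4 - D(g², 1/g²) → 0` and reduces `D(g², 1/g²)` to the symbols
`(1 - u z)^{-1} (1 - v/z)`, whose determinants of every size `n ≥ 1` are equal to `1 - u v`
(`hasDetLimit_inv_lin_lin`). The product of the resulting factors is `R`
(`hasDetLimit_quotient`). It is positive, being nonzero and the limit of the fourth powers of
numbers that are real up to sign.
-/

set_option linter.unusedSectionVars false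

namespace BDI

/-! ### Majorana operators as signed toggles -/

section Fock

variable {L : ℕ} [NeZero L]

/-- The operator sending the basis vector of `T` to `φ T` times the basis vector of `T ∆ {n}`. -/
def toggleOp (n : ZMod L) (φ : Finset (ZMod L) → ℂ) : Op L :=
  Matrix.of fun S T => if S = symmDiff T {n} then φ T else 0

/-- The Jordan–Wigner sign of the site `n` in the configuration `T`. -/
def jwSign (n : ZMod L) (T : Finset (ZMod L)) : ℂ :=
  (-1) ^ (T.filter fun m => m.val < n.val).card

theorem symmDiff_singleton_of_mem {α : Type*} [DecidableEq α] {T : Finset α} {n : α} (h : n ∈ T) :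
    symmDiff T {n} = T.erase n := by
  ext x; simp only [Finset.mem_symmDiff, Finset.mem_singleton, Finset.mem_erase]; grind

theorem symmDiff_singleton_of_notMem {α : Type*} [DecidableEq α] {T : Finset α} {n : α}
    (h : n ∉ T) : symmDiff T {n} = insert n T := by
  ext x; simp only [Finset.mem_symmDiff, Finset.mem_singleton, Finset.mem_insert]; grind

theorem jwSign_eq_prod (n : ZMod L) (T : Finset (ZMod L)) :
    jwSign n T = ∏ m ∈ T, if m.val < n.val then (-1 : ℂ) else 1 := by
  rw [jwSign, ← Finset.prod_filter, Finset.prod_const]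

theorem jwSign_symmDiff (n m : ZMod L) (T : Finset (ZMod L)) :
    jwSign n (symmDiff T {m}) = (if m.val < n.val then (-1 : ℂ) else 1) * jwSign n T := by
  simp only [jwSign_eq_prod]
  by_cases h : m ∈ T
  · rw [symmDiff_singleton_of_mem h, ← Finset.mul_prod_erase T _ h, ← mul_assoc]
    split_ifs <;> simp
  · rw [symmDiff_singleton_of_notMem h, Finset.prod_insert h]

theorem jwSign_mul_self (n : ZMod L) (T : Finset (ZMod L)) : jwSign n T * jwSign n T = 1 := by
  rw [jwSign, ← mul_pow]; simp

/-- `-1` if the site `n` is occupied in `T`, and `1` otherwise. -/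
def occSign (n : ZMod L) (T : Finset (ZMod L)) : ℂ := if n ∈ T then -1 else 1

theorem occSign_symmDiff_self (n : ZMod L) (T : Finset (ZMod L)) :
    occSign n (symmDiff T {n}) = -occSign n T := by
  by_cases h : n ∈ T <;> simp [occSign, Finset.mem_symmDiff, h]

theorem occSign_symmDiff_of_ne {n m : ZMod L} (h : n ≠ m) (T : Finset (ZMod L)) :
    occSign n (symmDiff T {m}) = occSign n T := by
  simp [occSign, Finset.mem_symmDiff, h]

theorem toggleOp_mul (n m : ZMod L) (φ χ : Finset (ZMod L) → ℂ) (S T : Finset (ZMod L)) :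
    (toggleOp n φ * toggleOp m χ) S T =
      if S = symmDiff (symmDiff T {m}) {n} then φ (symmDiff T {m}) * χ T else 0 := by
  rw [Matrix.mul_apply, Finset.sum_eq_single (symmDiff T {m})]
  · simp only [toggleOp, Matrix.of_apply, if_true]; split_ifs <;> simp
  · intro b _ hb; simp [toggleOp, hb]
  · simp

theorem toggleOp_anticomm (n m : ZMod L) (φ χ : Finset (ZMod L) → ℂ) (c : ℂ)
    (h : ∀ T, φ (symmDiff T {m}) * χ T + χ (symmDiff T {n}) * φ T = if n = m then c else 0) :
    toggleOp n φ * toggleOp m χ + toggleOp m χ * toggleOp n φ = (if n = m then c else 0) • 1 := by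
  ext S T
  rw [Matrix.add_apply, toggleOp_mul, toggleOp_mul, symmDiff_right_comm T {n} {m},
    Matrix.smul_apply, Matrix.one_apply]
  have := h T
  by_cases hnm : n = m
  · subst hnm
    simp only [symmDiff_symmDiff_cancel_right, if_true] at this ⊢
    split_ifs
    · rw [this, smul_eq_mul, mul_one]
    · simp
  · simp only [hnm, if_false] at this ⊢
    rw [zero_smul]
    by_cases h' : S = symmDiff (symmDiff T {m}) {n}
    · rw [if_pos h', if_pos h', this]
    · rw [if_neg h', if_neg h', add_zero]

theorem creat_apply (n : ZMod L) (S T : Finset (ZMod L)) :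
    creat L n S T = if n ∉ T ∧ S = insert n T then jwSign n T else 0 := by
  rw [creat, Matrix.conjTranspose_apply, annih, Matrix.of_apply]
  split_ifs <;> simp [jwSign]

theorem jwSign_insert_self {n : ZMod L} {S : Finset (ZMod L)} (h : n ∉ S) :
    jwSign n (insert n S) = jwSign n S := by
  rw [← symmDiff_singleton_of_notMem h, jwSign_symmDiff]; simp

theorem annih_apply (n : ZMod L) (S T : Finset (ZMod L)) :
    annih L n S T = if n ∈ T ∧ S = T.erase n then jwSign n T else 0 := by
  rw [annih, Matrix.of_apply]
  have : (n ∉ S ∧ T = insert n S) ↔ (n ∈ T ∧ S = T.erase n) := by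
    constructor
    · rintro ⟨h, rfl⟩; simp [h]
    · rintro ⟨h, rfl⟩; simp [h]
  by_cases h : n ∉ S ∧ T = insert n S
  · rw [if_pos h, if_pos (this.1 h), h.2, jwSign_insert_self h.1, jwSign]
  · rw [if_neg h, if_neg (fun h' => h (this.2 h'))]

theorem gam_eq_toggleOp (n : ZMod L) : gam L n = toggleOp n (jwSign n) := by
  ext S T
  rw [gam, Matrix.add_apply, creat_apply, annih_apply, toggleOp, Matrix.of_apply]
  by_cases h : n ∈ T
  · simp [h, symmDiff_singleton_of_mem]
  · simp [h, symmDiff_singleton_of_notMem]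

theorem gamT_eq_toggleOp (n : ZMod L) :
    gamT L n = toggleOp n fun T => Complex.I * (occSign n T * jwSign n T) := by
  ext S T
  rw [gamT, Matrix.smul_apply, Matrix.sub_apply, creat_apply, annih_apply, toggleOp,
    Matrix.of_apply]
  by_cases h : n ∈ T
  · simp only [h, symmDiff_singleton_of_mem, occSign, not_true_eq_false, false_and, true_and,
      if_false, if_true]
    split_ifs <;> simp
  · simp [h, symmDiff_singleton_of_notMem, occSign]

theorem sign_add_sign {n m : ZMod L} (h : n ≠ m) :
    (if m.val < n.val then (-1 : ℂ) else 1) + (if n.val < m.val then (-1 : ℂ) else 1) = 0 := by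
  have : m.val ≠ n.val := fun h' => h (ZMod.val_injective L h').symm
  rcases lt_or_gt_of_ne this with h | h <;> simp [h, not_lt.2 h.le]

theorem gam_anticomm (n m : ZMod L) :
    gam L n * gam L m + gam L m * gam L n = (if n = m then (2 : ℂ) else 0) • 1 := by
  rw [gam_eq_toggleOp, gam_eq_toggleOp]
  refine toggleOp_anticomm _ _ _ _ _ fun T => ?_
  rw [jwSign_symmDiff, jwSign_symmDiff]
  by_cases h : n = m
  · subst h
    simp only [lt_irrefl, if_false, if_true]
    linear_combination 2 * jwSign_mul_self n T
  · simp only [h, if_false]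
    linear_combination (jwSign n T * jwSign m T) * sign_add_sign h

theorem gamT_anticomm (n m : ZMod L) :
    gamT L n * gamT L m + gamT L m * gamT L n = (if n = m then (2 : ℂ) else 0) • 1 := by
  rw [gamT_eq_toggleOp, gamT_eq_toggleOp]
  refine toggleOp_anticomm _ _ _ _ _ fun T => ?_
  simp only [jwSign_symmDiff]
  by_cases h : n = m
  · subst h
    have h1 : occSign n T * occSign n T = 1 := by unfold occSign; split_ifs <;> simp
    simp only [occSign_symmDiff_self, lt_irrefl, if_false, if_true]
    linear_combination (-2 * occSign n T * occSign n T * jwSign n T * jwSign n T) * Complex.I_sq +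
      2 * occSign n T * occSign n T * jwSign_mul_self n T + 2 * h1
  · rw [occSign_symmDiff_of_ne h, occSign_symmDiff_of_ne (Ne.symm h)]
    simp only [h, if_false]
    linear_combination (Complex.I ^ 2 * occSign n T * occSign m T * jwSign n T * jwSign m T) *
      sign_add_sign h

theorem gamT_gam_anticomm (n m : ZMod L) : gamT L n * gam L m + gam L m * gamT L n = 0 := by
  rw [gam_eq_toggleOp, gamT_eq_toggleOp, toggleOp_anticomm (c := 0)]
  · simp
  intro T
  simp only [jwSign_symmDiff]
  by_cases h : n = m
  · subst h
    simp only [occSign_symmDiff_self, lt_irrefl, if_false, if_true]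
    ring
  · rw [occSign_symmDiff_of_ne h]
    simp only [h, if_false]
    linear_combination (Complex.I * occSign n T * jwSign n T * jwSign m T) *
      sign_add_sign h

theorem gam_conjTranspose (n : ZMod L) : (gam L n)ᴴ = gam L n := by
  simp [gam, creat, add_comm]

theorem gamT_conjTranspose (n : ZMod L) : (gamT L n)ᴴ = gamT L n := by
  simp only [gamT, creat, Matrix.conjTranspose_smul, Matrix.conjTranspose_sub,
    Matrix.conjTranspose_conjTranspose, Complex.star_def, Complex.conj_I]
  rw [neg_smul, ← smul_neg, neg_sub]

/-! ### Annihilation of the ground state by the lowering modes -/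

/-- The Fourier mode `∑_n χ(n) γ_n`. -/
def gamMode (χ : AddChar (ZMod L) ℂ) : Op L := ∑ n, χ n • gam L n

/-- The Fourier mode `∑_n χ(n) γ̃_n`. -/
def gamTMode (χ : AddChar (ZMod L) ℂ) : Op L := ∑ n, χ n • gamT L n

theorem pair_comm_gam (n k m : ZMod L) :
    gamT L n * gam L k * gam L m - gam L m * (gamT L n * gam L k) =
      (if k = m then (2 : ℂ) else 0) • gamT L n := by
  have h1 := gam_anticomm k m
  have h2 := gamT_gam_anticomm n m
  have : gamT L n * gam L k * gam L m - gam L m * (gamT L n * gam L k) =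
      gamT L n * (gam L k * gam L m + gam L m * gam L k) -
        (gamT L n * gam L m + gam L m * gamT L n) * gam L k := by noncomm_ring
  rw [this, h1, h2]; simp

theorem pair_comm_gamT (n k m : ZMod L) :
    gamT L n * gam L k * gamT L m - gamT L m * (gamT L n * gam L k) =
      -((if n = m then (2 : ℂ) else 0) • gam L k) := by
  have h1 := gamT_anticomm n m
  have h2 := gamT_gam_anticomm m k
  have : gamT L n * gam L k * gamT L m - gamT L m * (gamT L n * gam L k) =
      gamT L n * (gamT L m * gam L k + gam L k * gamT L m) -
        (gamT L n * gamT L m + gamT L m * gamT L n) * gam L k := by noncomm_ring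
  rw [this, h1, h2]; simp

theorem addChar_intCast (χ : AddChar (ZMod L) ℂ) (α : ℤ) : χ (α : ZMod L) = χ 1 ^ α := by
  rw [← zsmul_one, AddChar.map_zsmul_eq_zpow]

theorem hamiltonian_comm_gamMode (t : ℤ →₀ ℝ) (χ : AddChar (ZMod L) ℂ) :
    hamiltonian L t * gamMode χ - gamMode χ * hamiltonian L t =
      (Complex.I * symbol t (χ 1)) • gamTMode χ := by
  have key : ∀ n m : ZMod L, ∀ α : ℤ,
      ((Complex.I / 2 * (t α : ℂ)) • (gamT L n * gam L (n + (α : ZMod L)))) * (χ m • gam L m) -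
        (χ m • gam L m) * ((Complex.I / 2 * (t α : ℂ)) • (gamT L n * gam L (n + (α : ZMod L)))) =
      if n + (α : ZMod L) = m then (Complex.I * (t α : ℂ) * χ m) • gamT L n else 0 := by
    intro n m α
    rw [smul_mul_smul_comm, smul_mul_smul_comm, mul_comm (χ m), ← smul_sub, pair_comm_gam, smul_smul]
    split_ifs
    · congr 1; ring
    · simp
  have h : hamiltonian L t * gamMode χ - gamMode χ * hamiltonian L t =
      ∑ n, ∑ α ∈ t.support, ∑ m, if n + (α : ZMod L) = m then
        (Complex.I * (t α : ℂ) * χ m) • gamT L n else 0 := by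
    simp only [← key, hamiltonian, gamMode, Finset.sum_mul, Finset.mul_sum,
      Finset.sum_sub_distrib]
    congr 1
    rw [Finset.sum_comm]
    refine Finset.sum_congr rfl fun _ _ => Finset.sum_comm
  rw [h, gamTMode, Finset.smul_sum]
  refine Finset.sum_congr rfl fun n _ => ?_
  simp only [Finset.sum_ite_eq, Finset.mem_univ, if_true]
  rw [← Finset.sum_smul, smul_smul, symbol, Finset.mul_sum, Finset.sum_mul]
  congr 1
  refine Finset.sum_congr rfl fun α _ => ?_
  rw [AddChar.map_add_eq_mul, addChar_intCast]; ring

theorem hamiltonian_comm_gamTMode (t : ℤ →₀ ℝ) (χ : AddChar (ZMod L) ℂ) :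
    hamiltonian L t * gamTMode χ - gamTMode χ * hamiltonian L t =
      -((Complex.I * symbol t (χ 1)⁻¹) • gamMode χ) := by
  have key : ∀ n m : ZMod L, ∀ α : ℤ,
      ((Complex.I / 2 * (t α : ℂ)) • (gamT L n * gam L (n + (α : ZMod L)))) * (χ m • gamT L m) -
        (χ m • gamT L m) * ((Complex.I / 2 * (t α : ℂ)) • (gamT L n * gam L (n + (α : ZMod L)))) =
      if n = m then -((Complex.I * (t α : ℂ) * χ n) • gam L (n + (α : ZMod L))) else 0 := by
    intro n m α
    rw [smul_mul_smul_comm, smul_mul_smul_comm, mul_comm (χ m), ← smul_sub, pair_comm_gamT,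
      smul_neg, smul_smul]
    split_ifs with h
    · subst h; congr 2; ring
    · simp
  have h : hamiltonian L t * gamTMode χ - gamTMode χ * hamiltonian L t =
      ∑ n, ∑ α ∈ t.support, ∑ m, if n = m then
        -((Complex.I * (t α : ℂ) * χ n) • gam L (n + (α : ZMod L))) else 0 := by
    simp only [← key, hamiltonian, gamTMode, Finset.sum_mul, Finset.mul_sum,
      Finset.sum_sub_distrib]
    congr 1
    rw [Finset.sum_comm]
    refine Finset.sum_congr rfl fun _ _ => Finset.sum_comm
  rw [h, gamMode, Finset.smul_sum, Finset.sum_comm, ← Finset.sum_neg_distrib]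
  simp only [Finset.sum_ite_eq, Finset.mem_univ, if_true, Finset.sum_neg_distrib]
  congr 1
  have h2 : ∀ α : ℤ, ∑ n, (Complex.I * (t α : ℂ) * χ n) • gam L (n + (α : ZMod L)) =
      ∑ n, (Complex.I * (t α : ℂ) * χ (n - (α : ZMod L))) • gam L n := fun α => by
    rw [← Equiv.sum_comp (Equiv.addRight (α : ZMod L))
      (fun n => (Complex.I * (t α : ℂ) * χ (n - (α : ZMod L))) • gam L n)]
    simp
  simp only [h2]
  rw [Finset.sum_comm]
  refine Finset.sum_congr rfl fun n _ => ?_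
  rw [← Finset.sum_smul, smul_smul, symbol, Finset.mul_sum, Finset.sum_mul]
  congr 1
  refine Finset.sum_congr rfl fun α _ => ?_
  rw [sub_eq_add_neg, AddChar.map_add_eq_mul, ← Int.cast_neg, addChar_intCast, zpow_neg, inv_zpow]
  ring

theorem symbol_inv_of_norm_eq_one (t : ℤ →₀ ℝ) {z : ℂ} (hz : ‖z‖ = 1) :
    symbol t z⁻¹ = (starRingEnd ℂ) (symbol t z) := by
  rw [Complex.inv_eq_conj hz, symbol, symbol, map_sum]
  simp

theorem norm_addChar_eq_one (χ : AddChar (ZMod L) ℂ) (a : ZMod L) : ‖χ a‖ = 1 :=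
  AddChar.norm_apply χ a

/-- The lowest state is annihilated by every mode that lowers the energy. -/
theorem IsGroundState.mode_eq {t : ℤ →₀ ℝ} {ψ : Finset (ZMod L) → ℂ}
    (hψ : IsGroundState (hamiltonian L t) ψ) (χ : AddChar (ZMod L) ℂ)
    (hf : symbol t (χ 1) ≠ 0) :
    gamMode χ *ᵥ ψ = (Complex.I * (symbol t (χ 1) / ‖symbol t (χ 1)‖)) • (gamTMode χ *ᵥ ψ) := by
  obtain ⟨-, E, hE, hmin⟩ := hψ
  -- `d` lowers the energy by `‖F‖ > 0`, so `d ψ` would have energy below the minimum unless it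
  -- vanishes.
  set F := symbol t (χ 1) with hF
  have hr : 0 < ‖F‖ := norm_pos_iff.2 hf
  have hFF : F * symbol t (χ 1)⁻¹ = (‖F‖ : ℂ) ^ 2 := by
    rw [symbol_inv_of_norm_eq_one t (norm_addChar_eq_one χ 1), ← hF, Complex.mul_conj,
      Complex.normSq_eq_norm_sq]; push_cast; ring
  set d : Op L := (‖F‖ : ℂ) • gamMode χ - (Complex.I * F) • gamTMode χ with hd
  have hcomm : hamiltonian L t * d = d * hamiltonian L t - (‖F‖ : ℂ) • d := by
    have h1 := hamiltonian_comm_gamMode t χ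
    have h2 := hamiltonian_comm_gamTMode t χ
    rw [sub_eq_iff_eq_add] at h1 h2
    rw [hd, mul_sub, Matrix.mul_smul, Matrix.mul_smul, h1, h2, sub_mul, Matrix.smul_mul,
      Matrix.smul_mul, ← hF, smul_sub, smul_add, smul_add, smul_neg, smul_smul, smul_smul, smul_smul,
      show Complex.I * F * (Complex.I * symbol t (χ 1)⁻¹) = -((‖F‖ : ℂ) * ‖F‖) by
        linear_combination (F * symbol t (χ 1)⁻¹) * Complex.I_sq - hFF]
    rw [neg_smul]
    abel
  have hzero : d *ᵥ ψ = 0 := by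
    by_contra hne
    have := hmin (E - ‖F‖) (d *ᵥ ψ) hne (by
      rw [Matrix.mulVec_mulVec, hcomm, Matrix.sub_mulVec, ← Matrix.mulVec_mulVec, hE,
        Matrix.mulVec_smul, Matrix.smul_mulVec, ← sub_smul]
      push_cast; rfl)
    linarith
  rw [hd, Matrix.sub_mulVec, Matrix.smul_mulVec, Matrix.smul_mulVec, sub_eq_zero] at hzero
  have hrc : (‖F‖ : ℂ) ≠ 0 := by exact_mod_cast hr.ne'
  calc gamMode χ *ᵥ ψ = (‖F‖ : ℂ)⁻¹ • ((‖F‖ : ℂ) • (gamMode χ *ᵥ ψ)) := by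
        rw [smul_smul, inv_mul_cancel₀ hrc, one_smul]
    _ = _ := by rw [hzero, smul_smul]; congr 1; field_simp

end Fock

section Wick

variable {L : ℕ} [NeZero L]

/-! ### Position-space form of the annihilation conditions -/

/-- The phase `f(z) / |f(z)|`. -/
noncomputable def phase (t : ℤ →₀ ℝ) (z : ℂ) : ℂ := symbol t z / ‖symbol t z‖

/-- The coefficient `β(d) = L⁻¹ ∑_k e^{-2πikd/L} f/|f|(e^{2πik/L})` of the discrete Fourier transform
of the phase of `f`. -/
noncomputable def phaseCoeff (t : ℤ →₀ ℝ) (d : ZMod L) : ℂ :=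
  (L : ℂ)⁻¹ * ∑ k : ZMod L, ZMod.stdAddChar (-(k * d)) * phase t (ZMod.stdAddChar k)

theorem sum_stdAddChar_mul (b : ZMod L) :
    ∑ k : ZMod L, (ZMod.stdAddChar (k * b) : ℂ) = if b = 0 then (L : ℂ) else 0 := by
  rw [AddChar.sum_mulShift b (ZMod.isPrimitive_stdAddChar L)]
  simp

theorem conj_stdAddChar (a : ZMod L) :
    (starRingEnd ℂ) (ZMod.stdAddChar a : ℂ) = ZMod.stdAddChar (-a) := by
  rw [AddChar.map_neg_eq_inv, Complex.inv_eq_conj (norm_addChar_eq_one _ _)]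

theorem conj_phaseCoeff (t : ℤ →₀ ℝ) (d : ZMod L) :
    (starRingEnd ℂ) (phaseCoeff t d) = phaseCoeff t d := by
  rw [phaseCoeff, map_mul, map_sum, map_inv₀, Complex.conj_natCast]
  congr 1
  rw [← Equiv.sum_comp (Equiv.neg (ZMod L))]
  refine Finset.sum_congr rfl fun k _ => ?_
  have h : symbol t (ZMod.stdAddChar (-k) : ℂ) =
      (starRingEnd ℂ) (symbol t (ZMod.stdAddChar k : ℂ)) := by
    rw [← symbol_inv_of_norm_eq_one t (norm_addChar_eq_one _ _), AddChar.map_neg_eq_inv]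
  rw [map_mul, conj_stdAddChar, Equiv.neg_apply, phase, phase, h, map_div₀, Complex.conj_conj,
    Complex.conj_ofReal, RCLike.norm_conj, neg_mul, neg_neg]

theorem sum_smul_gamMode (m : ZMod L) :
    ∑ k : ZMod L, (ZMod.stdAddChar (-(k * m)) : ℂ) • gamMode (AddChar.mulShift ZMod.stdAddChar k) =
      (L : ℂ) • gam L m := by
  simp only [gamMode, Finset.smul_sum, smul_smul, AddChar.mulShift_apply]
  rw [Finset.sum_comm]
  simp only [← Finset.sum_smul]
  rw [Finset.sum_eq_single m]
  · congr 1
    simp [← AddChar.map_add_eq_mul]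
  · intro n _ hn
    have : ∀ k : ZMod L, (ZMod.stdAddChar (-(k * m)) : ℂ) * ZMod.stdAddChar (k * n) =
        ZMod.stdAddChar (k * (n - m)) := fun k => by
      rw [← AddChar.map_add_eq_mul]; congr 1; ring
    simp only [this, sum_stdAddChar_mul, sub_eq_zero, hn, if_false, zero_smul]
  · simp

/-- The operator `γ_m - i ∑_n β(m - n) γ̃_n`, which annihilates the ground state. -/
noncomputable def lowerOp (t : ℤ →₀ ℝ) (m : ZMod L) : Op L :=
  gam L m - ∑ n, (Complex.I * phaseCoeff t (m - n)) • gamT L n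

/-- The adjoint `γ_m + i ∑_n β(m - n) γ̃_n` of `lowerOp t m`. -/
noncomputable def raiseOp (t : ℤ →₀ ℝ) (m : ZMod L) : Op L :=
  gam L m + ∑ n, (Complex.I * phaseCoeff t (m - n)) • gamT L n

theorem lowerOp_conjTranspose (t : ℤ →₀ ℝ) (m : ZMod L) :
    (lowerOp t m)ᴴ = raiseOp t m := by
  rw [lowerOp, raiseOp, Matrix.conjTranspose_sub, gam_conjTranspose, Matrix.conjTranspose_sum,
    sub_eq_add_neg, ← Finset.sum_neg_distrib]
  congr 1
  refine Finset.sum_congr rfl fun n _ => ?_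
  rw [Matrix.conjTranspose_smul, gamT_conjTranspose, star_mul', Complex.star_def, Complex.conj_I,
    conj_phaseCoeff, ← neg_smul, neg_mul, neg_neg]

theorem IsGroundState.lowerOp_mulVec {t : ℤ →₀ ℝ} {ψ : Finset (ZMod L) → ℂ}
    (hψ : IsGroundState (hamiltonian L t) ψ) (hf : ∀ z : ℂ, ‖z‖ = 1 → symbol t z ≠ 0) (m : ZMod L) :
    lowerOp t m *ᵥ ψ = 0 := by
  have hL : (L : ℂ) ≠ 0 := by exact_mod_cast NeZero.ne L
  have h1 : (L : ℂ) • (gam L m *ᵥ ψ) = ∑ k : ZMod L, ∑ n : ZMod L,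
      (ZMod.stdAddChar (-(k * m)) * (Complex.I * phase t (ZMod.stdAddChar k)) *
        ZMod.stdAddChar (k * n)) • (gamT L n *ᵥ ψ) := by
    rw [← Matrix.smul_mulVec, ← sum_smul_gamMode, Matrix.sum_mulVec]
    refine Finset.sum_congr rfl fun k _ => ?_
    have hk : (AddChar.mulShift ZMod.stdAddChar k (1 : ZMod L) : ℂ) = ZMod.stdAddChar k := by
      rw [AddChar.mulShift_apply, mul_one]
    rw [Matrix.smul_mulVec, hψ.mode_eq _ (hf _ (norm_addChar_eq_one _ _)), hk, gamTMode,
      Matrix.sum_mulVec, smul_smul, Finset.smul_sum]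
    refine Finset.sum_congr rfl fun n _ => ?_
    rw [Matrix.smul_mulVec, smul_smul, AddChar.mulShift_apply]; rfl
  have h2 : gam L m *ᵥ ψ = (L : ℂ)⁻¹ • ((L : ℂ) • (gam L m *ᵥ ψ)) := by
    rw [smul_smul, inv_mul_cancel₀ hL, one_smul]
  rw [lowerOp, Matrix.sub_mulVec, sub_eq_zero, h2, h1, Matrix.sum_mulVec, Finset.sum_comm,
    Finset.smul_sum]
  refine Finset.sum_congr rfl fun n _ => ?_
  rw [← Finset.sum_smul, smul_smul, Matrix.smul_mulVec, phaseCoeff]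
  congr 1
  rw [mul_left_comm, Finset.mul_sum (a := Complex.I)]
  congr 1
  refine Finset.sum_congr rfl fun k _ => ?_
  have : (ZMod.stdAddChar (-(k * (m - n))) : ℂ) =
      ZMod.stdAddChar (-(k * m)) * ZMod.stdAddChar (k * n) := by
    rw [← AddChar.map_add_eq_mul]; congr 1; ring
  rw [this]; ring

/-! ### Wick's theorem -/

theorem expval_add (ψ : Finset (ZMod L) → ℂ) (A B : Op L) :
    expval ψ (A + B) = expval ψ A + expval ψ B := by
  simp [expval, Matrix.add_mulVec, dotProduct_add]

theorem expval_smul (ψ : Finset (ZMod L) → ℂ) (c : ℂ) (A : Op L) :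
    expval ψ (c • A) = c * expval ψ A := by
  simp [expval, Matrix.smul_mulVec, dotProduct_smul]

theorem expval_sum {ι : Type*} (s : Finset ι) (ψ : Finset (ZMod L) → ℂ) (A : ι → Op L) :
    expval ψ (∑ i ∈ s, A i) = ∑ i ∈ s, expval ψ (A i) := by
  simp [expval, Matrix.sum_mulVec, dotProduct_sum]

theorem expval_mul_of_mulVec_eq_zero {ψ : Finset (ZMod L) → ℂ} {D : Op L} (h : D *ᵥ ψ = 0)
    (A : Op L) : expval ψ (A * D) = 0 := by
  rw [expval, ← Matrix.mulVec_mulVec, h]; simp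

theorem expval_conjTranspose_mul {ψ : Finset (ZMod L) → ℂ} {D : Op L} (h : D *ᵥ ψ = 0)
    (A : Op L) : expval ψ (Dᴴ * A) = 0 := by
  rw [expval, ← Matrix.mulVec_mulVec, Matrix.dotProduct_mulVec, ← Matrix.star_mulVec, h]; simp

section Anticommute

variable {R : Type*} [Ring R] [Algebra ℂ R]

theorem list_prod_mul_of_anticomm (D : R) (l : List R) (h : ∀ x ∈ l, x * D = -(D * x)) :
    l.prod * D = (-1 : ℂ) ^ l.length • (D * l.prod) := by
  induction l with
  | nil => simp
  | cons x l ih =>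
    rw [List.prod_cons, mul_assoc, ih fun y hy => h y (List.mem_cons_of_mem _ hy), mul_smul_comm,
      ← mul_assoc, h x List.mem_cons_self, List.length_cons, pow_succ, mul_neg_one, neg_smul,
      neg_mul, smul_neg, mul_assoc]

/-- Moving `D` to the left through a product produces one contraction for each factor. -/
theorem prod_ofFn_mul_eq {n : ℕ} (x : Fin (n + 1) → R) (D : R) (c : Fin (n + 1) → ℂ)
    (h : ∀ a, x a * D + D * x a = c a • (1 : R)) :
    (List.ofFn x).prod * D = (-1 : ℂ) ^ (n + 1) • (D * (List.ofFn x).prod) +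
      ∑ a : Fin (n + 1), ((-1 : ℂ) ^ (n + (a : ℕ)) * c a) •
        (List.ofFn fun i => x (a.succAbove i)).prod := by
  induction n with
  | zero =>
    have := h 0
    simp [← this]
  | succ n ih =>
    have h0 : x 0 * D = -(D * x 0) + c 0 • (1 : R) := by rw [← h 0]; abel
    rw [List.ofFn_succ, List.prod_cons, mul_assoc, ih (fun i => x i.succ) (fun i => c i.succ)
      (fun a => h a.succ), mul_add, mul_smul_comm, ← mul_assoc, h0, Finset.mul_sum]
    conv_rhs => rw [Fin.sum_univ_succ]
    simp only [Fin.succAbove_zero, Fin.val_zero, add_zero, List.ofFn_succ (n := n),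
      Fin.succ_succAbove_zero, Fin.succ_succAbove_succ, List.prod_cons, mul_smul_comm, Fin.val_succ]
    rw [← add_assoc]
    congr 1
    · rw [add_mul, smul_add, smul_mul_assoc, one_mul, smul_smul, neg_mul, smul_neg, ← neg_smul,
        pow_succ (-1 : ℂ) (n + 1), mul_neg_one, mul_assoc]
    · refine Finset.sum_congr rfl fun a _ => ?_
      congr 2
      rw [show n + 1 + ((a : ℕ) + 1) = n + a + 2 by ring, pow_add]; ring

end Anticommute

theorem gamT_raiseOp_anticomm (t : ℤ →₀ ℝ) (i m : ZMod L) :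
    gamT L i * raiseOp t m + raiseOp t m * gamT L i =
      (2 * (Complex.I * phaseCoeff t (m - i))) • 1 := by
  have h : gamT L i * raiseOp t m + raiseOp t m * gamT L i =
      (gamT L i * gam L m + gam L m * gamT L i) +
        ∑ n, (Complex.I * phaseCoeff t (m - n)) • (gamT L i * gamT L n + gamT L n * gamT L i) := by
    simp only [raiseOp, mul_add, add_mul, Finset.mul_sum, Finset.sum_mul, smul_add,
      Finset.sum_add_distrib, mul_smul_comm, smul_mul_assoc]
    abel
  rw [h, gamT_gam_anticomm, zero_add, Finset.sum_eq_single i]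
  · rw [gamT_anticomm, if_pos rfl, smul_smul, mul_comm]
  · intro n _ hn
    rw [gamT_anticomm, if_neg (Ne.symm hn), zero_smul, smul_zero]
  · simp

theorem gam_mul_raiseOp (t : ℤ →₀ ℝ) {j m : ZMod L} (h : j ≠ m) :
    gam L j * raiseOp t m = -(raiseOp t m * gam L j) := by
  have h' : gam L j * raiseOp t m + raiseOp t m * gam L j =
      (gam L j * gam L m + gam L m * gam L j) +
        ∑ n, (Complex.I * phaseCoeff t (m - n)) • (gamT L n * gam L j + gam L j * gamT L n) := by
    simp only [raiseOp, mul_add, add_mul, Finset.mul_sum, Finset.sum_mul, smul_add,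
      Finset.sum_add_distrib, mul_smul_comm, smul_mul_assoc]
    abel
  rw [gam_anticomm, if_neg h, zero_smul, zero_add] at h'
  simp only [gamT_gam_anticomm, smul_zero, Finset.sum_const_zero] at h'
  exact eq_neg_of_add_eq_zero_left h'

/-- Wick's theorem for the ground state: the contraction of `γ̃_i` with `γ_j` is `β(j - i)` up to a
phase, and those within each family vanish. The last `γ_j` is half the sum of its lowering part, which
annihilates the state on the right, and its raising part, which is moved to the left; the contractions
picked up on the way give the Laplace expansion along the last column. -/
theorem IsGroundState.wick {t : ℤ →₀ ℝ} {ψ : Finset (ZMod L) → ℂ}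
    (hψ : IsGroundState (hamiltonian L t) ψ) (hf : ∀ z : ℂ, ‖z‖ = 1 → symbol t z ≠ 0) (N : ℕ)
    (i j : Fin N → ZMod L) (hj : Function.Injective j) :
    expval ψ ((List.ofFn fun a => gamT L (i a)).prod * (List.ofFn fun b => gam L (j b)).prod) =
      (∏ a ∈ Finset.range N, (Complex.I * (-1) ^ a)) *
        (Matrix.of fun a b => phaseCoeff t (j b - i a)).det := by
  induction N with
  | zero => simp [expval, hψ.1]
  | succ N ih =>
    have hlow := hψ.lowerOp_mulVec hf (j (Fin.last N))
    set m := j (Fin.last N) with hm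
    set X := (List.ofFn fun a => gamT L (i a)).prod with hX
    set Y := (List.ofFn fun b : Fin N => gam L (j b.castSucc)).prod with hY
    have hprod : (List.ofFn fun b => gam L (j b)).prod = Y * gam L m := by
      rw [List.ofFn_succ', List.concat_eq_append, List.prod_append, List.prod_singleton]
    have hgam : gam L m = (1 / 2 : ℂ) • (lowerOp t m + raiseOp t m) := by
      rw [lowerOp, raiseOp, sub_add_add_cancel, ← two_smul ℂ, smul_smul]; norm_num
    have hYr : Y * raiseOp t m = (-1 : ℂ) ^ N • (raiseOp t m * Y) := by
      rw [hY, list_prod_mul_of_anticomm, List.length_ofFn]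
      intro x hx
      rw [List.mem_ofFn] at hx
      obtain ⟨b, rfl⟩ := hx
      refine gam_mul_raiseOp t fun h => ?_
      exact (Fin.castSucc_lt_last b).ne (hj h)
    have hXr := prod_ofFn_mul_eq (fun a => gamT L (i a)) (raiseOp t m) _
      (fun a => gamT_raiseOp_anticomm t (i a) m)
    rw [← hX] at hXr
    have hE : X * (Y * gam L m) = (1 / 2 : ℂ) • ((X * Y) * lowerOp t m) +
        (1 / 2 : ℂ) • ((-1 : ℂ) ^ N • ((-1 : ℂ) ^ (N + 1) • (raiseOp t m * (X * Y)) +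
          ∑ a : Fin (N + 1), ((-1 : ℂ) ^ (N + (a : ℕ)) *
            (2 * (Complex.I * phaseCoeff t (m - i a)))) •
              ((List.ofFn fun b => gamT L (i (a.succAbove b))).prod * Y))) := by
      rw [hgam, mul_smul_comm, mul_smul_comm, mul_add, mul_add, smul_add, hYr, mul_smul_comm,
        ← mul_assoc X (raiseOp t m), hXr, add_mul, smul_mul_assoc, Finset.sum_mul]
      simp only [smul_mul_assoc, mul_assoc]
    rw [hprod, hE, expval_add, expval_smul, expval_mul_of_mulVec_eq_zero hlow, expval_smul,
      expval_smul, expval_add, expval_smul, ← lowerOp_conjTranspose,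
      expval_conjTranspose_mul hlow, expval_sum, Matrix.det_succ_column _ (Fin.last N),
      Finset.prod_range_succ, Finset.mul_sum, mul_zero, mul_zero, zero_add, zero_add,
      Finset.mul_sum, Finset.mul_sum]
    refine Finset.sum_congr rfl fun a _ => ?_
    rw [expval_smul, ih (fun b => i (a.succAbove b)) (fun b => j b.castSucc)
      (hj.comp (Fin.castSucc_injective N))]
    have hs : (Matrix.of fun a b => phaseCoeff t (j b - i a)).submatrix a.succAbove
        (Fin.last N).succAbove = Matrix.of fun b c : Fin N =>
          phaseCoeff t (j c.castSucc - i (a.succAbove b)) := by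
      ext b c; simp
    rw [hs, Matrix.of_apply, ← hm, Fin.val_last]
    have hsq : ((-1 : ℂ) ^ N) * (-1) ^ N = 1 := by rw [← mul_pow]; simp
    rw [pow_add, pow_add]
    ring

end Wick

section Strings

/-! ### Reduction of the string correlator to a determinant -/

section Words

variable {R : Type*} [Ring R] [Algebra ℂ R]

/-- The product `v_n v_{n+1} ⋯ v_{n+a-1}`. -/
def word (v : ℕ → R) (n a : ℕ) : R := ((List.range a).map fun j => v (n + j)).prod

theorem word_succ (v : ℕ → R) (n a : ℕ) : word v n (a + 1) = word v n a * v (n + a) := by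
  simp [word, List.range_succ]

theorem word_succ' (v : ℕ → R) (n a : ℕ) : word v n (a + 1) = v n * word v (n + 1) a := by
  simp [word, List.range_succ_eq_map, Function.comp_def, add_assoc, add_comm 1]

theorem mul_word_of_anticomm {v : ℕ → R} {n a : ℕ} {x : R}
    (h : ∀ j < a, v (n + j) * x = -(x * v (n + j))) :
    x * word v n a = (-1 : ℂ) ^ a • (word v n a * x) := by
  rw [word, list_prod_mul_of_anticomm x, smul_smul, List.length_map, List.length_range, ← mul_pow]
  · simp
  · intro y hy
    simp only [List.mem_map, List.mem_range] at hy
    obtain ⟨j, hj, rfl⟩ := hy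
    exact h j hj

theorem word_mul_word {v : ℕ → R} {n a : ℕ} {q : ℂ}
    (hne : ∀ i < a, ∀ j < a, i ≠ j → v (n + i) * v (n + j) = -(v (n + j) * v (n + i)))
    (hsq : ∀ i < a, v (n + i) * v (n + i) = q • 1) :
    word v n a * word v n a = (∏ i ∈ Finset.range a, ((-1) ^ i * q)) • 1 := by
  induction a with
  | zero => simp [word]
  | succ a ih =>
    have h1 := ih (fun i hi j hj => hne i (hi.trans a.lt_succ_self) j (hj.trans a.lt_succ_self))
      (fun i hi => hsq i (hi.trans a.lt_succ_self))
    have h2 : v (n + a) * word v n a = (-1 : ℂ) ^ a • (word v n a * v (n + a)) :=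
      mul_word_of_anticomm fun j hj => hne j (hj.trans a.lt_succ_self) a a.lt_succ_self hj.ne
    calc word v n (a + 1) * word v n (a + 1)
        = word v n a * (v (n + a) * word v n a) * v (n + a) := by
          rw [word_succ]; simp only [mul_assoc]
      _ = (-1 : ℂ) ^ a • ((word v n a * word v n a) * (v (n + a) * v (n + a))) := by
          rw [h2]; simp only [mul_assoc, mul_smul_comm, smul_mul_assoc]
      _ = _ := by
          rw [h1, hsq a a.lt_succ_self, Finset.prod_range_succ, smul_mul_smul_comm, one_mul,
            smul_smul]
          congr 1; ring

/-- The boundary words absorb the string one site at a time: each step shifts the right word by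
one site. -/
theorem word_mul_string_mul_word {u v : ℕ → R} (huv : ∀ i j, v j * u i = -(u i * v j)) (ε : ℂ)
    (a N : ℕ) :
    word v 1 a * (((List.range N).map fun m => ε • (u (m + 1) * v (m + 1))).prod *
        word v (N + 1) a) =
      (ε * (-1) ^ a) ^ N • (word v 1 a * word v 1 a *
        ((List.range N).map fun m => u (m + 1) * v (m + 1 + a)).prod) := by
  induction N with
  | zero => simp
  | succ N ih =>
    set S := ((List.range N).map fun m => ε • (u (m + 1) * v (m + 1))).prod with hS
    have h1 : u (N + 1) * v (N + 1) * word v (N + 1 + 1) a =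
        (-1 : ℂ) ^ a • (word v (N + 1) a * (u (N + 1) * v (N + 1 + a))) := by
      rw [mul_assoc, ← word_succ', word_succ, ← mul_assoc,
        mul_word_of_anticomm (fun j _ => huv _ _), smul_mul_assoc, mul_assoc]
    simp only [List.range_succ, List.map_append, List.map_cons, List.map_nil, List.prod_append,
      List.prod_singleton, ← hS]
    calc word v 1 a * (S * (ε • (u (N + 1) * v (N + 1))) * word v (N + 1 + 1) a)
        = ε • (word v 1 a * (S * (u (N + 1) * v (N + 1) * word v (N + 1 + 1) a))) := by
          simp only [mul_smul_comm, smul_mul_assoc, mul_assoc]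
      _ = (ε * (-1) ^ a) • ((word v 1 a * (S * word v (N + 1) a)) *
            (u (N + 1) * v (N + 1 + a))) := by
          rw [h1]; simp only [mul_smul_comm, mul_assoc, smul_smul]
      _ = _ := by
          rw [ih, smul_mul_assoc, smul_smul, pow_succ', mul_assoc (word v 1 a * word v 1 a)]

theorem prod_range_mul_eq {x y : ℕ → R} (hxy : ∀ i j, y j * x i = -(x i * y j)) (ε : ℂ) (N : ℕ) :
    ((List.range N).map fun m => ε • (x m * y m)).prod =
      (∏ a ∈ Finset.range N, (ε * (-1) ^ a)) •
        (((List.range N).map x).prod * ((List.range N).map y).prod) := by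
  induction N with
  | zero => simp
  | succ N ih =>
    set Y := ((List.range N).map y).prod with hY
    have h : Y * x N = (-1 : ℂ) ^ N • (x N * Y) := by
      rw [hY, list_prod_mul_of_anticomm, List.length_map, List.length_range]
      intro z hz
      simp only [List.mem_map, List.mem_range] at hz
      obtain ⟨j, _, rfl⟩ := hz
      exact hxy _ _
    simp only [List.range_succ, List.map_append, List.map_cons, List.map_nil, List.prod_append,
      List.prod_singleton, ih, ← hY, Finset.prod_range_succ]
    rw [smul_mul_smul_comm, mul_assoc, ← mul_assoc Y, h, smul_mul_assoc, mul_smul_comm, smul_smul]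
    congr 1
    · ring
    · simp only [mul_assoc]

end Words

theorem list_prod_range_eq_ofFn {M : Type*} [Monoid M] (N : ℕ) (f : ℕ → M) :
    ((List.range N).map f).prod = (List.ofFn fun i : Fin N => f i).prod := by
  rw [List.ofFn_eq_map, ← List.map_coe_finRange_eq_range, List.map_map]; rfl

theorem natCast_ne_of_lt {L a : ℕ} (h : a ≤ L) (n : ℕ) {i j : ℕ} (hi : i < a) (hj : j < a)
    (hij : i ≠ j) : ((n + i : ℕ) : ZMod L) ≠ ((n + j : ℕ) : ZMod L) := by
  intro h'
  push_cast at h'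
  rw [add_right_inj, ZMod.natCast_eq_natCast_iff'] at h'
  exact hij (by rwa [Nat.mod_eq_of_lt (by omega), Nat.mod_eq_of_lt (by omega)] at h')

/-- Anticommuting the boundary words of the two string operators through the parity string pairs each
`γ̃_m` with `γ_{m+α}`, so that Wick's theorem applies. The factor `κ` does not depend on `L`. -/
theorem stringCorr_eq_det (α : ℤ) (N : ℕ) : ∃ κ : ℂ, ‖κ‖ = 1 ∧ ∀ (L : ℕ) [NeZero L] (t : ℤ →₀ ℝ)
    (ψ : Finset (ZMod L) → ℂ), IsGroundState (hamiltonian L t) ψ →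
      (∀ z : ℂ, ‖z‖ = 1 → symbol t z ≠ 0) → α.natAbs ≤ L → N ≤ L →
      stringCorr ψ α N = κ *
        (Matrix.of fun a b : Fin N => phaseCoeff t ((((b : ℕ) : ℤ) - ((a : ℕ) : ℤ) + α : ℤ) :
          ZMod L)).det := by
  set a := α.natAbs with ha
  have hnorm : ∀ (c : ℂ) (n : ℕ), ‖c‖ = 1 → ‖∏ i ∈ Finset.range n, (c * (-1) ^ i)‖ = 1 := by
    intro c n hc
    rw [norm_prod]
    exact Finset.prod_eq_one fun i _ => by simp [hc]
  by_cases hα : 0 ≤ α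
  · refine ⟨Complex.I ^ (a / 2) * Complex.I ^ (a / 2) * (Complex.I * (-1) ^ a) ^ N *
      (∏ i ∈ Finset.range a, (1 * (-1) ^ i)) * (∏ i ∈ Finset.range N, (1 * (-1) ^ i)) *
      (∏ i ∈ Finset.range N, (Complex.I * (-1) ^ i)), ?_, ?_⟩
    · rw [norm_mul, norm_mul, norm_mul, norm_mul, hnorm _ _ (by simp), hnorm _ _ (by simp),
        hnorm _ _ (by simp)]
      simp
    intro L _ t ψ hψ hf haL hNL
    set u : ℕ → Op L := fun n => gamT L (n : ZMod L) with hu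
    set v : ℕ → Op L := fun n => gam L (n : ZMod L) with hv
    have huv : ∀ i j, v j * u i = -(u i * v j) := fun i j =>
      eq_neg_of_add_eq_zero_right (gamT_gam_anticomm _ _)
    have hO : stringOp L α 1 * stringOp L α (N + 1) =
        (Complex.I ^ (a / 2) * Complex.I ^ (a / 2)) •
          (word v 1 a * (((List.range N).map fun m => Complex.I • (u (m + 1) * v (m + 1))).prod *
            word v (N + 1) a)) := by
      simp only [stringOp, hα, if_true, parityString, ← ha]
      rw [smul_mul_smul_comm]
      simp [word, hu, hv]
    have hw := word_mul_word (v := v) (n := 1) (a := a) (q := 1)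
      (fun i hi j hj hij => by
        have := gam_anticomm ((1 + i : ℕ) : ZMod L) ((1 + j : ℕ) : ZMod L)
        rw [if_neg (natCast_ne_of_lt haL 1 hi hj hij), zero_smul] at this
        exact eq_neg_of_add_eq_zero_left this)
      (fun i hi => by
        have := gam_anticomm ((1 + i : ℕ) : ZMod L) ((1 + i : ℕ) : ZMod L)
        rw [if_pos rfl, ← two_smul ℂ] at this
        exact smul_right_injective _ (two_ne_zero (α := ℂ)) (by simpa [hv] using this))
    have hI := prod_range_mul_eq (x := fun m => u (m + 1)) (y := fun m => v (m + 1 + a))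
      (fun i j => huv _ _) 1 N
    simp only [one_smul] at hI
    rw [stringCorr, hO, word_mul_string_mul_word huv, hw, hI, list_prod_range_eq_ofFn,
      list_prod_range_eq_ofFn, smul_one_mul, smul_smul, smul_smul, smul_smul, expval_smul,
      hψ.wick hf N (fun m => ((m + 1 : ℕ) : ZMod L)) (fun m => ((m + 1 + a : ℕ) : ZMod L))]
    · have hM : (Matrix.of fun a_1 b : Fin N => phaseCoeff t
          (((b + 1 + a : ℕ) : ZMod L) - ((a_1 + 1 : ℕ) : ZMod L))) =
          Matrix.of fun a b : Fin N =>
            phaseCoeff t ((((b : ℕ) : ℤ) - ((a : ℕ) : ℤ) + α : ℤ) : ZMod L) := by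
        ext i j
        rw [Matrix.of_apply, Matrix.of_apply]
        congr 1
        have : (α : ZMod L) = ((a : ℕ) : ZMod L) := by
          rw [← Int.cast_natCast, ha, Int.natAbs_of_nonneg hα]
        push_cast
        rw [this]; ring
      rw [hM]
      have hc : ∏ i ∈ Finset.range a, ((-1 : ℂ) ^ i * 1) = ∏ i ∈ Finset.range a, (1 * (-1) ^ i) :=
        Finset.prod_congr rfl fun _ _ => mul_comm _ _
      rw [hc]; ring
    · intro i j hij
      by_contra hne
      refine natCast_ne_of_lt hNL (1 + a) i.2 j.2 (fun h => hne (Fin.ext h)) ?_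
      convert hij using 2 <;> ring
  · refine ⟨(-Complex.I) ^ (a / 2) * (-Complex.I) ^ (a / 2) * (1 * (-1) ^ a) ^ N *
      (∏ i ∈ Finset.range a, (-1 * (-1) ^ i)) * (∏ i ∈ Finset.range N, (Complex.I * (-1) ^ i)) *
      (∏ i ∈ Finset.range N, (Complex.I * (-1) ^ i)), ?_, ?_⟩
    · rw [norm_mul, norm_mul, norm_mul, norm_mul, hnorm _ _ (by simp), hnorm _ _ (by simp)]
      simp
    intro L _ t ψ hψ hf haL hNL
    set u : ℕ → Op L := fun n => gam L (n : ZMod L) with hu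
    set v : ℕ → Op L := fun n => (-Complex.I) • gamT L (n : ZMod L) with hv
    have huv : ∀ i j, v j * u i = -(u i * v j) := fun i j => by
      rw [hv, hu, smul_mul_assoc, mul_smul_comm, ← smul_neg,
        eq_neg_of_add_eq_zero_left (gamT_gam_anticomm _ _)]
    have hpair : ∀ m n : ZMod L,
        gam L n * ((-Complex.I) • gamT L m) = Complex.I • (gamT L m * gam L n) := by
      intro m n
      rw [mul_smul_comm, eq_neg_of_add_eq_zero_right (gamT_gam_anticomm m n)]
      simp
    have hO : stringOp L α 1 * stringOp L α (N + 1) =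
        ((-Complex.I) ^ (a / 2) * (-Complex.I) ^ (a / 2)) •
          (word v 1 a * (((List.range N).map fun m => (1 : ℂ) • (u (m + 1) * v (m + 1))).prod *
            word v (N + 1) a)) := by
      simp only [stringOp, hα, if_false, parityString, ← ha, hu, hv, hpair, one_smul]
      rw [smul_mul_smul_comm]
      simp [word]
    have hw := word_mul_word (v := v) (n := 1) (a := a) (q := -1)
      (fun i hi j hj hij => by
        have := gamT_anticomm ((1 + i : ℕ) : ZMod L) ((1 + j : ℕ) : ZMod L)
        rw [if_neg (natCast_ne_of_lt haL 1 hi hj hij), zero_smul] at this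
        rw [hv, smul_mul_smul_comm, smul_mul_smul_comm, ← smul_neg,
          eq_neg_of_add_eq_zero_left this])
      (fun i hi => by
        have := gamT_anticomm ((1 + i : ℕ) : ZMod L) ((1 + i : ℕ) : ZMod L)
        rw [if_pos rfl, ← two_smul ℂ] at this
        have h1 := smul_right_injective _ (two_ne_zero (α := ℂ)) this
        rw [hv, smul_mul_smul_comm, h1]; simp)
    have hI := prod_range_mul_eq (x := fun m => gamT L ((m + 1 + a : ℕ) : ZMod L))
      (y := fun m => gam L ((m + 1 : ℕ) : ZMod L))
      (fun i j => eq_neg_of_add_eq_zero_right (gamT_gam_anticomm _ _)) Complex.I N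
    have hI' : ((List.range N).map fun m => u (m + 1) * v (m + 1 + a)).prod =
        ((List.range N).map fun m => Complex.I • (gamT L ((m + 1 + a : ℕ) : ZMod L) *
          gam L ((m + 1 : ℕ) : ZMod L))).prod := by
      simp only [hu, hv, hpair]
    rw [stringCorr, hO, word_mul_string_mul_word huv, hw, hI', hI, list_prod_range_eq_ofFn,
      list_prod_range_eq_ofFn, smul_one_mul, smul_smul, smul_smul, smul_smul, expval_smul,
      hψ.wick hf N (fun m => ((m + 1 + a : ℕ) : ZMod L)) (fun m => ((m + 1 : ℕ) : ZMod L))]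
    · have hM : (Matrix.of fun a_1 b : Fin N => phaseCoeff t
          (((b + 1 : ℕ) : ZMod L) - ((a_1 + 1 + a : ℕ) : ZMod L))) =
          Matrix.of fun a b : Fin N =>
            phaseCoeff t ((((b : ℕ) : ℤ) - ((a : ℕ) : ℤ) + α : ℤ) : ZMod L) := by
        ext i j
        rw [Matrix.of_apply, Matrix.of_apply]
        congr 1
        have : (α : ZMod L) = -((a : ℕ) : ZMod L) := by
          rw [← Int.cast_natCast, ha, Int.ofNat_natAbs_of_nonpos (by omega)]; simp
        push_cast
        rw [this]; ring
      rw [hM]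
      have hc : ∏ i ∈ Finset.range a, ((-1 : ℂ) ^ i * -1) = ∏ i ∈ Finset.range a, (-1 * (-1) ^ i) :=
        Finset.prod_congr rfl fun _ _ => mul_comm _ _
      rw [hc]; ring
    · intro i j hij
      by_contra hne
      refine natCast_ne_of_lt hNL 1 i.2 j.2 (fun h => hne (Fin.ext h)) ?_
      convert hij using 2 <;> ring

end Strings

section Determinant

/-! ### Determinants of matrices with controlled rows -/

theorem norm_det_le_prod_rows {n : ℕ} (M : Matrix (Fin n) (Fin n) ℂ) :
    ‖M.det‖ ≤ ∏ j, ∑ k, ‖M j k‖ := by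
  classical
  rw [← Matrix.det_transpose, Matrix.det_apply]
  calc ‖∑ σ : Equiv.Perm (Fin n), Equiv.Perm.sign σ • ∏ i, Mᵀ (σ i) i‖
      ≤ ∑ σ : Equiv.Perm (Fin n), ∏ i, ‖M i (σ i)‖ := by
        refine (norm_sum_le _ _).trans (Finset.sum_le_sum fun σ _ => ?_)
        rcases Int.units_eq_one_or (Equiv.Perm.sign σ) with h | h <;> simp [h, norm_prod]
    _ = ∑ f ∈ Finset.univ.image fun σ : Equiv.Perm (Fin n) => (σ : Fin n → Fin n),
          ∏ i, ‖M i (f i)‖ := by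
        rw [Finset.sum_image]
        intro σ _ τ _ h
        exact DFunLike.coe_injective h
    _ ≤ ∑ f : Fin n → Fin n, ∏ i, ‖M i (f i)‖ :=
        Finset.sum_le_sum_of_subset_of_nonneg (Finset.subset_univ _)
          fun _ _ _ => Finset.prod_nonneg fun _ _ => norm_nonneg _
    _ = ∏ j, ∑ k, ‖M j k‖ := by
        rw [Finset.prod_univ_sum, Fintype.piFinset_univ]

/-- The determinant is Lipschitz for the `ℓ¹`-norms of the rows; the rows are exchanged one by
one. -/
theorem norm_det_sub_det_le {n : ℕ} (M M' : Matrix (Fin n) (Fin n) ℂ) (β : Fin n → ℝ) (δ : ℝ)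
    (hβ : ∀ j, 1 ≤ β j) (hM : ∀ j, ∑ k, ‖M j k‖ ≤ β j) (hM' : ∀ j, ∑ k, ‖M' j k‖ ≤ β j)
    (hδ : ∀ j, ∑ k, ‖M j k - M' j k‖ ≤ δ) :
    ‖M.det - M'.det‖ ≤ n * δ * ∏ j, β j := by
  classical
  let Q : Finset (Fin n) → Matrix (Fin n) (Fin n) ℂ := fun s =>
    Matrix.of fun j => if j ∈ s then M j else M' j
  have hQ : ∀ s j, ∑ k, ‖Q s j k‖ ≤ β j := by
    intro s j
    by_cases h : j ∈ s
    · simpa [Q, h] using hM j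
    · simpa [Q, h] using hM' j
  have key : ∀ s : Finset (Fin n), ‖(Q s).det - M'.det‖ ≤ s.card * δ * ∏ j, β j := by
    intro s
    induction s using Finset.induction_on with
    | empty =>
      have : Q ∅ = M' := by ext j k; simp [Q]
      simp [this]
    | insert a s ha ih =>
      have h1 : Q (insert a s) = (Q s).updateRow a (M' a + (M a - M' a)) := by
        ext j k
        by_cases hj : j = a
        · subst hj; simp [Q]
        · simp [Q, hj]
      have h2 : (Q s).updateRow a (M' a) = Q s := by
        ext j k
        by_cases hj : j = a
        · subst hj; simp [Q, ha]
        · simp [hj]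
      have h3 : ‖((Q s).updateRow a (M a - M' a)).det‖ ≤ δ * ∏ j, β j := by
        refine (norm_det_le_prod_rows _).trans ?_
        rw [← Finset.mul_prod_erase Finset.univ _ (Finset.mem_univ a)]
        have hδ0 : 0 ≤ δ := (Finset.sum_nonneg fun _ _ => norm_nonneg _).trans (hδ a)
        refine mul_le_mul (by simpa using hδ a) ?_
          (Finset.prod_nonneg fun _ _ => Finset.sum_nonneg fun _ _ => norm_nonneg _) hδ0
        rw [← Finset.mul_prod_erase Finset.univ β (Finset.mem_univ a)]
        have h4 : ∏ j ∈ Finset.univ.erase a, ∑ k, ‖(Q s).updateRow a (M a - M' a) j k‖ ≤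
            ∏ j ∈ Finset.univ.erase a, β j := by
          refine Finset.prod_le_prod (fun _ _ => Finset.sum_nonneg fun _ _ => norm_nonneg _) ?_
          intro j hj
          simpa [Finset.ne_of_mem_erase hj] using hQ s j
        refine h4.trans (le_mul_of_one_le_left ?_ (hβ a))
        exact Finset.prod_nonneg fun j _ => zero_le_one.trans (hβ j)
      rw [h1, Matrix.det_updateRow_add, h2, Finset.card_insert_of_notMem ha]
      have h5 := norm_add_le ((Q s).det - M'.det) ((Q s).updateRow a (M a - M' a)).det
      rw [sub_add_eq_add_sub] at h5
      push_cast
      linarith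
  have h := key Finset.univ
  have hU : Q Finset.univ = M := by ext j k; simp [Q]
  rwa [hU, Finset.card_univ, Fintype.card_fin] at h

theorem prod_one_add_mul_pow_le {K r : ℝ} (hK : 0 ≤ K) (hr : 0 ≤ r) (hr1 : r < 1) (n : ℕ) :
    ∏ j : Fin n, (1 + K * r ^ (j : ℕ)) ≤ Real.exp (K * (1 - r)⁻¹) := by
  calc ∏ j : Fin n, (1 + K * r ^ (j : ℕ)) ≤ ∏ j : Fin n, Real.exp (K * r ^ (j : ℕ)) :=
        Finset.prod_le_prod (fun _ _ => by positivity)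
          fun _ _ => by rw [add_comm]; exact Real.add_one_le_exp _
    _ = Real.exp (K * ∑ j ∈ Finset.range n, r ^ j) := by
        rw [← Real.exp_sum, Finset.mul_sum, Finset.sum_range]
    _ ≤ _ := by
        refine Real.exp_le_exp.2 (mul_le_mul_of_nonneg_left ?_ hK)
        rw [← tsum_geometric_of_lt_one hr hr1]
        exact (summable_geometric_of_lt_one hr hr1).sum_le_tsum _ fun _ _ => by positivity

end Determinant

section Toeplitz

open PowerSeries

/-! ### Truncated Toeplitz matrices -/

/-- The entries `a_{k-j}` (zero for `k < j`) of the upper triangular Toeplitz matrix of a power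
series `a`. -/
noncomputable def up (a : ℂ⟦X⟧) (j k : ℕ) : ℂ := coeff k (X ^ j * a)

theorem up_of_lt (a : ℂ⟦X⟧) {j k : ℕ} (h : k < j) : up a j k = 0 := by
  rw [up, coeff_X_pow_mul', if_neg (not_le.2 h)]

theorem up_of_le (a : ℂ⟦X⟧) {j k : ℕ} (h : j ≤ k) : up a j k = coeff (k - j) a := by
  rw [up, coeff_X_pow_mul', if_pos h]

theorem up_add (a : ℂ⟦X⟧) (j i : ℕ) : up a j (j + i) = coeff i a := by
  rw [up_of_le a (Nat.le_add_right j i), Nat.add_sub_cancel_left]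

theorem up_succ_succ (a : ℂ⟦X⟧) (j k : ℕ) : up a (j + 1) (k + 1) = up a j k := by
  rw [up, up, pow_succ', mul_assoc, coeff_succ_X_mul]

theorem up_zero_left (a : ℂ⟦X⟧) (k : ℕ) : up a 0 k = coeff k a := by simp [up]

theorem up_mul_eq_sum (a b : ℂ⟦X⟧) (j k n : ℕ) (hk : k < n) :
    up (a * b) j k = ∑ l ∈ Finset.range n, up a j l * up b l k := by
  have h1 : up (a * b) j k = ∑ l ∈ Finset.range (k + 1), up a j l * up b l k := by
    rw [up, ← mul_assoc, coeff_mul, Finset.Nat.sum_antidiagonal_eq_sum_range_succ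
      (fun p q => coeff p (X ^ j * a) * coeff q b)]
    refine Finset.sum_congr rfl fun l hl => ?_
    rw [up_of_le b (Finset.mem_range_succ_iff.1 hl), up]
  rw [h1]
  refine Finset.sum_subset (Finset.range_subset_range.2 hk) fun l _ hl => ?_
  rw [up_of_lt b (by simpa using hl), mul_zero]

/-- The `n × n` upper triangular Toeplitz matrix of a power series. -/
noncomputable def upMat (n : ℕ) (a : ℂ⟦X⟧) : Matrix (Fin n) (Fin n) ℂ :=
  Matrix.of fun j k => up a j k

theorem upMat_mul (n : ℕ) (a b : ℂ⟦X⟧) : upMat n (a * b) = upMat n a * upMat n b := by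
  ext j k
  rw [Matrix.mul_apply, upMat, Matrix.of_apply, up_mul_eq_sum a b j k n k.2, Finset.sum_range]
  rfl

theorem upMat_one (n : ℕ) : upMat n 1 = 1 := by
  ext j k
  rw [upMat, Matrix.of_apply, up, mul_one, coeff_X_pow, Matrix.one_apply]
  simp only [Fin.ext_iff, eq_comm]

theorem det_upMat (n : ℕ) {a : ℂ⟦X⟧} (ha : constantCoeff a = 1) : (upMat n a).det = 1 := by
  rw [Matrix.det_of_isUpperTriangular]
  · refine Finset.prod_eq_one fun j _ => ?_
    rw [upMat, Matrix.of_apply, up_of_le a le_rfl, Nat.sub_self, coeff_zero_eq_constantCoeff_apply,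
      ha]
  · intro j k h
    exact up_of_lt a h

/-- The entries of the Toeplitz matrix of the symbol `a(z) c(1/z)`, written as the product of the
upper triangular matrix of `a` and the lower triangular matrix of `c`. -/
noncomputable def toep (a c : ℂ⟦X⟧) (j k : ℕ) : ℂ := ∑' l, up a j l * up c k l

/-- The commutator of the two triangular Toeplitz matrices, a product of Hankel matrices. -/
noncomputable def hank (a c : ℂ⟦X⟧) (j k : ℕ) : ℂ :=
  ∑' l, coeff (k + 1 + l) a * coeff (j + 1 + l) c

theorem toep_comm (a c : ℂ⟦X⟧) (j k : ℕ) : toep a c j k = toep c a k j := by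
  simp only [toep, mul_comm]

/-- The condition `∑ |a_k| s^k < ∞`. -/
def WSummable (s : ℝ) (a : ℂ⟦X⟧) : Prop := Summable fun k => ‖coeff k a‖ * s ^ k

/-- The weighted norm `∑ |a_k| s^k`. -/
noncomputable def wnorm (s : ℝ) (a : ℂ⟦X⟧) : ℝ := ∑' k, ‖coeff k a‖ * s ^ k

variable {s : ℝ} {a b c : ℂ⟦X⟧}

theorem wnorm_nonneg (hs : 1 ≤ s) (a : ℂ⟦X⟧) : 0 ≤ wnorm s a := tsum_nonneg fun _ => by positivity

theorem WSummable.norm_coeff (hs : 1 ≤ s) (ha : WSummable s a) : Summable fun k => ‖coeff k a‖ :=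
  Summable.of_nonneg_of_le (fun _ => norm_nonneg _)
    (fun _ => le_mul_of_one_le_right (norm_nonneg _) (one_le_pow₀ hs)) ha

theorem WSummable.norm_coeff_le (hs : 1 ≤ s) (ha : WSummable s a) (k : ℕ) :
    ‖coeff k a‖ ≤ wnorm s a :=
  (le_mul_of_one_le_right (norm_nonneg _) (one_le_pow₀ hs)).trans
    (ha.le_tsum k fun _ _ => by positivity)

theorem WSummable.norm_up_le (hs : 1 ≤ s) (ha : WSummable s a) (j k : ℕ) :
    ‖up a j k‖ ≤ wnorm s a := by
  rcases lt_or_ge k j with h | h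
  · rw [up_of_lt a h, norm_zero]; exact wnorm_nonneg hs a
  · rw [up_of_le a h]; exact ha.norm_coeff_le hs _

theorem WSummable.hasSum_up (ha : WSummable s a) (j : ℕ) :
    HasSum (fun l => ‖up a j l‖ * s ^ l) (wnorm s a * s ^ j) := by
  rw [← (add_right_injective j).hasSum_iff]
  · have h : (fun l => ‖up a j l‖ * s ^ l) ∘ (fun x => j + x) =
        fun i => ‖coeff i a‖ * s ^ i * s ^ j := by
      funext i
      simp only [Function.comp_apply, up_add, pow_add]
      ring
    rw [h]
    exact (Summable.hasSum ha).mul_right (s ^ j)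
  · intro l hl
    have : l < j := by
      by_contra h
      exact hl ⟨l - j, by simp; omega⟩
    rw [up_of_lt a this]; simp

theorem WSummable.norm_up (hs : 1 ≤ s) (ha : WSummable s a) (j : ℕ) :
    Summable fun l => ‖up a j l‖ :=
  Summable.of_nonneg_of_le (fun _ => norm_nonneg _)
    (fun _ => le_mul_of_one_le_right (norm_nonneg _) (one_le_pow₀ hs)) (ha.hasSum_up j).summable

theorem summable_up_mul (hs : 1 ≤ s) (ha : WSummable s a) {v : ℕ → ℂ} {K : ℝ}
    (hv : ∀ l, ‖v l‖ ≤ K) (j : ℕ) : Summable fun l => up a j l * v l :=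
  Summable.of_norm_bounded ((ha.norm_up hs j).mul_right K) fun l => by
    rw [norm_mul]; exact mul_le_mul_of_nonneg_left (hv l) (norm_nonneg _)

theorem summable_hank (hs : 1 ≤ s) (ha : WSummable s a) (hc : WSummable s c) (j k : ℕ) :
    Summable fun l => coeff (k + 1 + l) a * coeff (j + 1 + l) c :=
  Summable.of_norm_bounded
    (((ha.norm_coeff hs).comp_injective (add_right_injective (k + 1))).mul_right (wnorm s c))
    fun l => by
      rw [norm_mul]; exact mul_le_mul_of_nonneg_left (hc.norm_coeff_le hs _) (norm_nonneg _)

theorem toep_succ_succ (hs : 1 ≤ s) (ha : WSummable s a) (hc : WSummable s c) (j k : ℕ) :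
    toep a c (j + 1) (k + 1) = toep a c j k := by
  rw [toep, (summable_up_mul hs ha (hc.norm_up_le hs _) _).tsum_eq_zero_add]
  simp only [up_succ_succ, up_of_lt a (Nat.succ_pos j), zero_mul, zero_add]
  rfl

theorem hank_succ_succ (hs : 1 ≤ s) (ha : WSummable s a) (hc : WSummable s c) (j k : ℕ) :
    coeff (k + 1) a * coeff (j + 1) c + hank a c (j + 1) (k + 1) = hank a c j k := by
  rw [hank, hank, (summable_hank hs ha hc j k).tsum_eq_zero_add]
  simp only [add_zero]
  congr 2
  ext l
  rw [show k + 1 + 1 + l = k + 1 + (l + 1) by ring, show j + 1 + 1 + l = j + 1 + (l + 1) by ring]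

theorem toep_zero_left (hs : 1 ≤ s) (ha : WSummable s a) (hc : WSummable s c) (k : ℕ) :
    toep a c 0 k = coeff k a * coeff 0 c + hank a c 0 k := by
  have h1 : toep a c 0 k = ∑' i, coeff (k + i) a * coeff i c := by
    rw [toep, ← (add_right_injective k).tsum_eq (f := fun l => up a 0 l * up c k l)]
    · simp only [up_zero_left, up_add]
    · intro l hl
      by_contra h
      refine hl ?_
      have : l < k := by
        by_contra h'
        exact h ⟨l - k, by simp; omega⟩
      simp [up_of_lt c this]
  have h2 : Summable fun i => coeff (k + i) a * coeff i c :=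
    Summable.of_norm_bounded
      (((ha.norm_coeff hs).comp_injective (add_right_injective k)).mul_right (wnorm s c))
      fun l => by
        rw [norm_mul]; exact mul_le_mul_of_nonneg_left (hc.norm_coeff_le hs _) (norm_nonneg _)
  rw [h1, h2.tsum_eq_zero_add, hank, add_zero]
  congr 2
  ext l
  rw [zero_add, add_comm 1 l, add_assoc k, add_comm 1 l]

/-- Exchanging the two triangular factors costs the Hankel term. -/
theorem toep_eq_sum_add_hank (hs : 1 ≤ s) (ha : WSummable s a) (hc : WSummable s c) (j k n : ℕ)
    (hk : k < n) :
    toep a c j k = ∑ l ∈ Finset.range n, up c l j * up a l k + hank a c j k := by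
  induction j generalizing k n with
  | zero =>
    rw [toep_zero_left hs ha hc, Finset.sum_eq_single 0]
    · rw [up_zero_left, up_zero_left, mul_comm]
    · intro l _ hl
      rw [up_of_lt c (Nat.pos_of_ne_zero hl), zero_mul]
    · intro h; exact absurd (Finset.mem_range.2 (Nat.zero_lt_of_lt hk)) h
  | succ j ih =>
    cases k with
    | zero =>
      rw [toep_comm, toep_zero_left hs hc ha, Finset.sum_eq_single 0]
      · rw [up_zero_left, up_zero_left]
        simp only [hank, mul_comm]
      · intro l _ hl
        rw [up_of_lt a (Nat.pos_of_ne_zero hl), mul_zero]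
      · intro h; exact absurd (Finset.mem_range.2 hk) h
    | succ k =>
      obtain ⟨n, rfl⟩ : ∃ m, n = m + 1 := ⟨n - 1, by omega⟩
      rw [toep_succ_succ hs ha hc, ih k n (by omega), Finset.sum_range_succ', up_zero_left,
        up_zero_left, ← hank_succ_succ hs ha hc j k]
      simp only [up_succ_succ]
      ring

theorem norm_hank_le (hs : 1 ≤ s) (ha : WSummable s a) (hc : WSummable s c) (j k : ℕ) :
    ‖hank a c j k‖ ≤ wnorm s a * wnorm s c := by
  have hsum := ((ha.norm_coeff hs).comp_injective (add_right_injective (k + 1))).mul_right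
    (wnorm s c)
  refine (tsum_of_norm_bounded hsum.hasSum fun l => ?_).trans ?_
  · rw [norm_mul]; exact mul_le_mul_of_nonneg_left (hc.norm_coeff_le hs _) (norm_nonneg _)
  · rw [tsum_mul_right]
    refine mul_le_mul_of_nonneg_right ?_ (wnorm_nonneg hs c)
    refine (tsum_comp_le_tsum_of_inj (ha.norm_coeff hs) (fun _ => norm_nonneg _)
      (add_right_injective (k + 1))).trans ?_
    exact (ha.norm_coeff hs).tsum_le_tsum
      (fun k => le_mul_of_one_le_right (norm_nonneg _) (one_le_pow₀ hs)) ha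

/-- Multiplying the analytic factor of the symbol multiplies the Toeplitz matrix from the left. -/
theorem toep_mul_left (hs : 1 ≤ s) (ha : WSummable s a) (hb : WSummable s b) (hc : WSummable s c)
    (j k : ℕ) : toep (b * a) c j k = ∑' i, up b j i * toep a c i k := by
  have hrow : ∀ m, HasSum (fun i => up b j i * up a i m) (up (b * a) j m) := by
    intro m
    rw [up_mul_eq_sum b a j m (m + 1) m.lt_succ_self]
    refine hasSum_sum_of_ne_finset_zero fun i hi => ?_
    rw [up_of_lt a (by simpa using hi), mul_zero]
  have hS : Summable (Function.uncurry fun i m : ℕ => up b j i * up a i m * up c k m) := by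
    refine Summable.of_norm ?_
    rw [summable_prod_of_nonneg (fun _ => norm_nonneg _)]
    have hi : ∀ i, Summable fun m => ‖up b j i * up a i m * up c k m‖ := fun i =>
      Summable.of_nonneg_of_le (fun _ => norm_nonneg _) (fun m => by
        rw [norm_mul, norm_mul]
        exact mul_le_mul_of_nonneg_left (hc.norm_up_le hs k m) (by positivity))
        (((ha.norm_up hs i).mul_left ‖up b j i‖).mul_right (wnorm s c))
    refine ⟨hi, ?_⟩
    refine Summable.of_nonneg_of_le (fun i => tsum_nonneg fun _ => norm_nonneg _) (fun i => ?_)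
      ((hb.norm_up hs j).mul_right (wnorm s a * wnorm s c))
    have hle : ∀ m, ‖up b j i * up a i m * up c k m‖ ≤
        ‖up b j i‖ * (‖up a i m‖ * wnorm s c) := fun m => by
      rw [norm_mul, norm_mul, mul_assoc]
      exact mul_le_mul_of_nonneg_left
        (mul_le_mul_of_nonneg_left (hc.norm_up_le hs k m) (norm_nonneg _)) (norm_nonneg _)
    have h2 := ((ha.norm_up hs i).mul_right (wnorm s c)).mul_left ‖up b j i‖
    refine ((hi i).tsum_le_tsum hle h2).trans ?_
    rw [tsum_mul_left, tsum_mul_right]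
    refine mul_le_mul_of_nonneg_left (mul_le_mul_of_nonneg_right ?_ (wnorm_nonneg hs c))
      (norm_nonneg _)
    have hsp : 0 < s ^ i := by positivity
    refine le_of_mul_le_mul_right ?_ hsp
    rw [← (ha.hasSum_up i).tsum_eq, ← tsum_mul_right]
    refine ((ha.norm_up hs i).mul_right _).tsum_le_tsum (fun m => ?_) (ha.hasSum_up i).summable
    rcases lt_or_ge m i with h | h
    · simp [up_of_lt a h]
    · exact mul_le_mul_of_nonneg_left (pow_le_pow_right₀ hs h) (norm_nonneg _)
  calc toep (b * a) c j k = ∑' m, ∑' i, up b j i * up a i m * up c k m := by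
        refine tsum_congr fun m => ?_
        rw [tsum_mul_right, (hrow m).tsum_eq]
    _ = ∑' i, ∑' m, up b j i * up a i m * up c k m := hS.tsum_comm
    _ = _ := by
        refine tsum_congr fun i => ?_
        rw [toep, ← tsum_mul_left]
        simp only [mul_assoc]

/-- Multiplicativity of infinite Toeplitz matrices in the analytic factor, up to a Hankel term. The sum
over `l` is finite because the matrix of `a` is triangular. -/
theorem toep_mul_eq (hs : 1 ≤ s) (ha : WSummable s a) (hb : WSummable s b) (hc : WSummable s c)
    (j k n : ℕ) (hk : k < n) :
    toep (b * a) c j k = ∑ l ∈ Finset.range n, toep b c j l * up a l k +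
      ∑' i, up b j i * hank a c i k := by
  have h2 : Summable fun i => up b j i * hank a c i k :=
    summable_up_mul hs hb (fun i => norm_hank_le hs ha hc i k) j
  have h1 : ∀ l, Summable fun i => up b j i * up c l i * up a l k := fun l =>
    (summable_up_mul hs hb (hc.norm_up_le hs l) j).mul_right _
  rw [toep_mul_left hs ha hb hc]
  simp only [toep_eq_sum_add_hank hs ha hc _ k n hk, mul_add, Finset.mul_sum, ← mul_assoc]
  rw [Summable.tsum_add (summable_sum fun l _ => h1 l) h2, Summable.tsum_finsetSum fun l _ => h1 l]
  congr 1
  refine Finset.sum_congr rfl fun l _ => ?_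
  rw [toep, tsum_mul_right]

end Toeplitz

section ToeplitzLimit

open PowerSeries

/-! ### Approximate multiplicativity of Toeplitz determinants -/

attribute [local instance] Matrix.linftyOpNormedRing

variable {s : ℝ} {a b c : ℂ⟦X⟧} {n : ℕ}

theorem linfty_norm_le {M : Matrix (Fin n) (Fin n) ℂ} {C : ℝ} (hC : 0 ≤ C)
    (h : ∀ j, ∑ k, ‖M j k‖ ≤ C) : ‖M‖ ≤ C := by
  rw [Matrix.linfty_opNorm_def]
  lift C to NNReal using hC
  refine NNReal.coe_le_coe.2 (Finset.sup_le fun j _ => ?_)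
  rw [← NNReal.coe_le_coe]
  push_cast
  exact h j

theorem sum_row_le_linfty_norm (M : Matrix (Fin n) (Fin n) ℂ) (j : Fin n) :
    ∑ k, ‖M j k‖ ≤ ‖M‖ := by
  rw [Matrix.linfty_opNorm_def]
  refine le_trans (le_of_eq ?_)
    (NNReal.coe_le_coe.2 (Finset.le_sup (f := fun j => ∑ k, ‖M j k‖₊) (Finset.mem_univ j)))
  push_cast
  rfl

theorem linfty_norm_one_le : ‖(1 : Matrix (Fin n) (Fin n) ℂ)‖ ≤ 1 :=
  linfty_norm_le zero_le_one fun j => by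
    rw [Finset.sum_eq_single j] <;> simp +contextual [eq_comm]

/-- The majorant `|a_{k-j}| s^{k-j}` of the entries of an upper triangular Toeplitz matrix. -/
noncomputable def upBound (s : ℝ) (a : ℂ⟦X⟧) (j k : ℕ) : ℝ :=
  if j ≤ k then ‖coeff (k - j) a‖ * s ^ (k - j) else 0

theorem sum_upBound_row_le (hs : 1 ≤ s) (ha : WSummable s a) (j : ℕ) :
    ∑ k : Fin n, upBound s a j k ≤ wnorm s a := by
  rw [← Finset.sum_range (fun k => upBound s a j k)]
  simp only [upBound]
  rw [← Finset.sum_filter, ← Finset.sum_image (f := fun i => ‖coeff i a‖ * s ^ i)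
    (g := fun k => k - j)]
  · exact ha.sum_le_tsum _ fun _ _ => by positivity
  · intro x hx y hy h
    simp at hx hy h; omega

theorem sum_upBound_col_le (hs : 1 ≤ s) (ha : WSummable s a) (k : ℕ) :
    ∑ j : Fin n, upBound s a j k ≤ wnorm s a := by
  rw [← Finset.sum_range (fun j => upBound s a j k)]
  simp only [upBound]
  rw [← Finset.sum_filter, ← Finset.sum_image (f := fun i => ‖coeff i a‖ * s ^ i)
    (g := fun j => k - j)]
  · exact ha.sum_le_tsum _ fun _ _ => by positivity
  · intro x hx y hy h
    simp at hx hy h; omega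

theorem norm_le_wnorm (hs : 1 ≤ s) (ha : WSummable s a) {M : Matrix (Fin n) (Fin n) ℂ}
    (hM : ∀ j k, ‖M j k‖ ≤ upBound s a j k) : ‖M‖ ≤ wnorm s a :=
  linfty_norm_le (wnorm_nonneg hs a) fun j =>
    (Finset.sum_le_sum fun k _ => hM j k).trans (sum_upBound_row_le hs ha j)

theorem norm_le_wnorm' (hs : 1 ≤ s) (ha : WSummable s a) {M : Matrix (Fin n) (Fin n) ℂ}
    (hM : ∀ j k, ‖M j k‖ ≤ upBound s a k j) : ‖M‖ ≤ wnorm s a :=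
  linfty_norm_le (wnorm_nonneg hs a) fun j =>
    (Finset.sum_le_sum fun k _ => hM j k).trans (sum_upBound_col_le hs ha j)

/-- The weight `diag(s^j)`. -/
noncomputable def wdiag (n : ℕ) (s : ℝ) : Matrix (Fin n) (Fin n) ℂ :=
  Matrix.diagonal fun j => (s : ℂ) ^ (j : ℕ)

theorem wdiag_mul_inv (hs : 1 ≤ s) : wdiag n s * wdiag n s⁻¹ = 1 := by
  have : (s : ℂ) ≠ 0 := by exact_mod_cast (zero_lt_one.trans_le hs).ne'
  rw [wdiag, wdiag, Matrix.diagonal_mul_diagonal, ← Matrix.diagonal_one]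
  congr 1
  ext j
  rw [← mul_pow]
  simp [this]

theorem wdiag_inv_mul (hs : 1 ≤ s) : wdiag n s⁻¹ * wdiag n s = 1 :=
  mul_eq_one_comm.1 (wdiag_mul_inv hs)

theorem wdiag_mul_mul_apply (p q : ℝ) (M : Matrix (Fin n) (Fin n) ℂ) (j k : Fin n) :
    (wdiag n p * M * wdiag n q) j k = (p : ℂ) ^ (j : ℕ) * M j k * (q : ℂ) ^ (k : ℕ) := by
  rw [wdiag, wdiag, Matrix.mul_diagonal, Matrix.diagonal_mul]

theorem norm_wdiag_inv_le (hs : 1 ≤ s) : ‖wdiag n s⁻¹‖ ≤ 1 :=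
  linfty_norm_le zero_le_one fun j => by
    have h0 : (0 : ℝ) ≤ s := zero_le_one.trans hs
    rw [Finset.sum_eq_single j]
    · simp only [wdiag, Matrix.diagonal_apply_eq, norm_pow, Complex.norm_real, norm_inv,
        Real.norm_of_nonneg h0]
      exact pow_le_one₀ (by positivity) (inv_le_one_of_one_le₀ hs)
    · intro k _ hk
      simp [wdiag, Matrix.diagonal_apply_ne' _ hk]
    · simp

theorem norm_up_mul_pow_le (a : ℂ⟦X⟧) {p q : ℝ} (hq : 0 ≤ q)
    (hpq : p * q = 1) (hqs : q ≤ s) (j k : ℕ) : p ^ j * ‖up a j k‖ * q ^ k ≤ upBound s a j k := by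
  rw [upBound]
  split_ifs with h
  · rw [up_of_le a h]
    obtain ⟨i, rfl⟩ := Nat.exists_eq_add_of_le h
    rw [Nat.add_sub_cancel_left, pow_add]
    have : p ^ j * q ^ j = 1 := by rw [← mul_pow, hpq, one_pow]
    calc p ^ j * ‖coeff i a‖ * (q ^ j * q ^ i) = (p ^ j * q ^ j) * (‖coeff i a‖ * q ^ i) := by ring
      _ = ‖coeff i a‖ * q ^ i := by rw [this, one_mul]
      _ ≤ _ := mul_le_mul_of_nonneg_left (pow_le_pow_left₀ hq hqs _) (norm_nonneg _)
  · rw [up_of_lt a (not_le.1 h)]; simp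

theorem norm_upMat_le (hs : 1 ≤ s) (ha : WSummable s a) : ‖upMat n a‖ ≤ wnorm s a :=
  norm_le_wnorm hs ha fun j k => by
    simpa [upMat] using norm_up_mul_pow_le a zero_le_one (mul_one 1) hs j k

theorem norm_upMat_transpose_le (hs : 1 ≤ s) (ha : WSummable s a) :
    ‖(upMat n a)ᵀ‖ ≤ wnorm s a :=
  norm_le_wnorm' hs ha fun j k => by
    simpa [upMat] using norm_up_mul_pow_le a zero_le_one (mul_one 1) hs k j

theorem norm_wdiag_upMat_le (hs : 1 ≤ s) (ha : WSummable s a) {p q : ℝ} (hp : 0 ≤ p) (hq : 0 ≤ q)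
    (hpq : p * q = 1) (hqs : q ≤ s) : ‖wdiag n p * upMat n a * wdiag n q‖ ≤ wnorm s a :=
  norm_le_wnorm hs ha fun j k => by
    rw [wdiag_mul_mul_apply]
    simpa [upMat, abs_of_nonneg hp, abs_of_nonneg hq] using
      norm_up_mul_pow_le a hq hpq hqs j k

theorem norm_wdiag_upMat_transpose_le (hs : 1 ≤ s) (ha : WSummable s a) {p q : ℝ} (hp : 0 ≤ p)
    (hq : 0 ≤ q) (hpq : p * q = 1) (hqs : q ≤ s) :
    ‖wdiag n q * (upMat n a)ᵀ * wdiag n p‖ ≤ wnorm s a :=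
  norm_le_wnorm' hs ha fun j k => by
    rw [wdiag_mul_mul_apply]
    have := norm_up_mul_pow_le a hq hpq hqs k j
    simp only [upMat, Matrix.transpose_apply, Matrix.of_apply, norm_mul, norm_pow,
      Complex.norm_real, Real.norm_of_nonneg hp, Real.norm_of_nonneg hq]
    linarith

/-- The Hankel term decays away from the corner in both directions. -/
theorem sum_norm_hank_le (hs : 1 ≤ s) (ha : WSummable s a) (hc : WSummable s c) (j : ℕ) :
    ∑ k : Fin n, ‖hank a c j k‖ * s ^ (k : ℕ) ≤ wnorm s a * wnorm s c * s⁻¹ ^ j := by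
  have h0 : (0 : ℝ) < s := zero_lt_one.trans_le hs
  have hsum : ∀ k, Summable fun l => ‖coeff (k + 1 + l) a * coeff (j + 1 + l) c‖ := fun k =>
    Summable.of_nonneg_of_le (fun _ => norm_nonneg _) (fun l => by
      rw [norm_mul]; exact mul_le_mul_of_nonneg_left (hc.norm_coeff_le hs _) (norm_nonneg _))
      (((ha.norm_coeff hs).comp_injective (add_right_injective (k + 1))).mul_right (wnorm s c))
  have hcsum : Summable fun l => ‖coeff (j + 1 + l) c‖ * s ^ (j + 1 + l) :=
    Summable.comp_injective hc (add_right_injective (j + 1))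
  calc ∑ k : Fin n, ‖hank a c j k‖ * s ^ (k : ℕ)
      ≤ ∑ k : Fin n, ∑' l, ‖coeff ((k : ℕ) + 1 + l) a * coeff (j + 1 + l) c‖ * s ^ (k : ℕ) := by
        refine Finset.sum_le_sum fun k _ => ?_
        rw [tsum_mul_right]
        exact mul_le_mul_of_nonneg_right (norm_tsum_le_tsum_norm (hsum k)) (by positivity)
    _ = ∑' l, ∑ k : Fin n, ‖coeff ((k : ℕ) + 1 + l) a * coeff (j + 1 + l) c‖ * s ^ (k : ℕ) :=
        (Summable.tsum_finsetSum (f := fun (k : Fin n) l =>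
          ‖coeff ((k : ℕ) + 1 + l) a * coeff (j + 1 + l) c‖ * s ^ (k : ℕ))
          fun k _ => (hsum k).mul_right _).symm
    _ ≤ ∑' l, wnorm s a * s⁻¹ ^ j * (‖coeff (j + 1 + l) c‖ * s ^ (j + 1 + l)) := by
        refine Summable.tsum_le_tsum (fun l => ?_) (summable_sum fun k _ => (hsum k).mul_right _)
          (hcsum.mul_left _)
        have h1 : ∑ k : Fin n, ‖coeff ((k : ℕ) + 1 + l) a‖ * s ^ (k : ℕ) ≤ wnorm s a := by
          rw [← Finset.sum_range (fun k => ‖coeff (k + 1 + l) a‖ * s ^ k)]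
          calc ∑ k ∈ Finset.range n, ‖coeff (k + 1 + l) a‖ * s ^ k
              ≤ ∑ k ∈ Finset.range n, ‖coeff (k + 1 + l) a‖ * s ^ (k + 1 + l) :=
                Finset.sum_le_sum fun k _ => mul_le_mul_of_nonneg_left
                  (pow_le_pow_right₀ hs (by omega)) (norm_nonneg _)
            _ = ∑ i ∈ (Finset.range n).image fun k => k + 1 + l, ‖coeff i a‖ * s ^ i := by
                rw [Finset.sum_image]
                intro x _ y _ h
                simpa using h
            _ ≤ wnorm s a := ha.sum_le_tsum _ fun _ _ => by positivity
        have h2 : s⁻¹ ^ j * s ^ (j + 1 + l) = s ^ (1 + l) := by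
          rw [add_assoc, pow_add, ← mul_assoc, ← mul_pow, inv_mul_cancel₀ h0.ne', one_pow, one_mul]
        calc ∑ k : Fin n, ‖coeff ((k : ℕ) + 1 + l) a * coeff (j + 1 + l) c‖ * s ^ (k : ℕ)
            = (∑ k : Fin n, ‖coeff ((k : ℕ) + 1 + l) a‖ * s ^ (k : ℕ)) *
                ‖coeff (j + 1 + l) c‖ := by
              rw [Finset.sum_mul]
              refine Finset.sum_congr rfl fun k _ => ?_
              rw [norm_mul]; ring
          _ ≤ wnorm s a * (‖coeff (j + 1 + l) c‖ * s ^ (1 + l)) :=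
              mul_le_mul h1 (le_mul_of_one_le_right (norm_nonneg _) (one_le_pow₀ hs))
                (norm_nonneg _) (wnorm_nonneg hs a)
          _ = _ := by rw [← h2]; ring
    _ ≤ _ := by
        rw [tsum_mul_left]
        have h3 : ∑' l, ‖coeff (j + 1 + l) c‖ * s ^ (j + 1 + l) ≤ wnorm s c :=
          tsum_comp_le_tsum_of_inj hc (fun _ => by positivity) (add_right_injective (j + 1))
        calc wnorm s a * s⁻¹ ^ j * ∑' l, ‖coeff (j + 1 + l) c‖ * s ^ (j + 1 + l)
            ≤ wnorm s a * s⁻¹ ^ j * wnorm s c := mul_le_mul_of_nonneg_left h3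
              (mul_nonneg (wnorm_nonneg hs a) (by positivity))
          _ = _ := by ring

/-- The `n × n` Hankel matrix. -/
noncomputable def hankMat (n : ℕ) (a c : ℂ⟦X⟧) : Matrix (Fin n) (Fin n) ℂ :=
  Matrix.of fun j k => hank a c j k

/-- The `n × n` Toeplitz matrix of the symbol `a(z) c(1/z)`. -/
noncomputable def toepMat (n : ℕ) (a c : ℂ⟦X⟧) : Matrix (Fin n) (Fin n) ℂ :=
  Matrix.of fun j k => toep a c j k

theorem norm_wdiag_hankMat_le (hs : 1 ≤ s) (ha : WSummable s a) (hc : WSummable s c) :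
    ‖wdiag n s * hankMat n a c * wdiag n s‖ ≤ wnorm s a * wnorm s c := by
  have h0 : (0 : ℝ) < s := zero_lt_one.trans_le hs
  refine linfty_norm_le (mul_nonneg (wnorm_nonneg hs a) (wnorm_nonneg hs c)) fun j => ?_
  have h1 := sum_norm_hank_le (n := n) hs ha hc j
  calc ∑ k, ‖(wdiag n s * hankMat n a c * wdiag n s) j k‖
      = s ^ (j : ℕ) * ∑ k : Fin n, ‖hank a c j k‖ * s ^ (k : ℕ) := by
        rw [Finset.mul_sum]
        refine Finset.sum_congr rfl fun k _ => ?_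
        rw [wdiag_mul_mul_apply]
        simp [hankMat, abs_of_pos h0, mul_assoc]
    _ ≤ s ^ (j : ℕ) * (wnorm s a * wnorm s c * s⁻¹ ^ (j : ℕ)) :=
        mul_le_mul_of_nonneg_left h1 (by positivity)
    _ = (s * s⁻¹) ^ (j : ℕ) * (wnorm s a * wnorm s c) := by rw [mul_pow]; ring
    _ = _ := by rw [mul_inv_cancel₀ h0.ne', one_pow, one_mul]

/-- Truncation at `n` discards only rows that have already decayed. -/
theorem sum_norm_tail_le (hs : 1 ≤ s) (hb : WSummable s b) {v : ℕ → Fin n → ℂ} {K : ℝ}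
    (hK : 0 ≤ K) (hv : ∀ i, ∑ k, ‖v i k‖ ≤ K * s⁻¹ ^ i) (j : ℕ) :
    ∑ k, ‖∑' i, up b j (n + i) * v (n + i) k‖ ≤ wnorm s b * K * s⁻¹ ^ n := by
  have h0 : (0 : ℝ) < s := zero_lt_one.trans_le hs
  have hpow : ∀ i, s⁻¹ ^ i ≤ 1 := fun i =>
    pow_le_one₀ (inv_nonneg.2 h0.le) (inv_le_one_of_one_le₀ hs)
  have hup : Summable fun i => ‖up b j (n + i)‖ :=
    (hb.norm_up hs j).comp_injective (add_right_injective n)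
  have hvk : ∀ i k, ‖v i k‖ ≤ K := fun i k =>
    (Finset.single_le_sum (f := fun k => ‖v i k‖) (fun _ _ => norm_nonneg _)
      (Finset.mem_univ k)).trans ((hv i).trans (mul_le_of_le_one_right hK (hpow i)))
  have hsum : ∀ k, Summable fun i => ‖up b j (n + i) * v (n + i) k‖ := fun k =>
    Summable.of_nonneg_of_le (fun _ => norm_nonneg _) (fun i => by
      rw [norm_mul]; exact mul_le_mul_of_nonneg_left (hvk _ k) (norm_nonneg _)) (hup.mul_right K)
  calc ∑ k, ‖∑' i, up b j (n + i) * v (n + i) k‖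
      ≤ ∑ k, ∑' i, ‖up b j (n + i) * v (n + i) k‖ :=
        Finset.sum_le_sum fun k _ => norm_tsum_le_tsum_norm (hsum k)
    _ = ∑' i, ∑ k, ‖up b j (n + i) * v (n + i) k‖ :=
        (Summable.tsum_finsetSum fun k _ => hsum k).symm
    _ ≤ ∑' i, ‖up b j (n + i)‖ * (K * s⁻¹ ^ n) := by
        refine Summable.tsum_le_tsum (fun i => ?_) (summable_sum fun k _ => hsum k)
          (hup.mul_right _)
        simp only [norm_mul]
        rw [← Finset.mul_sum]
        refine mul_le_mul_of_nonneg_left ((hv _).trans ?_) (norm_nonneg _)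
        rw [pow_add]
        exact mul_le_mul_of_nonneg_left (mul_le_of_le_one_right (by positivity) (hpow i)) hK
    _ ≤ wnorm s b * (K * s⁻¹ ^ n) := by
        rw [tsum_mul_right]
        refine mul_le_mul_of_nonneg_right ?_ (by positivity)
        refine (tsum_comp_le_tsum_of_inj (hb.norm_up hs j) (fun _ => norm_nonneg _)
          (add_right_injective n)).trans ?_
        have hsp : 0 < s ^ j := by positivity
        refine le_of_mul_le_mul_right ?_ hsp
        rw [← (hb.hasSum_up j).tsum_eq, ← tsum_mul_right]
        refine ((hb.norm_up hs j).mul_right _).tsum_le_tsum (fun m => ?_) (hb.hasSum_up j).summable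
        rcases lt_or_ge m j with h | h
        · simp [up_of_lt b h]
        · exact mul_le_mul_of_nonneg_left (pow_le_pow_right₀ hs h) (norm_nonneg _)
    _ = _ := by ring

/-- The remainder of `hank` under truncation in `toep_mul_eq`. -/
noncomputable def hankTail (n : ℕ) (b a c : ℂ⟦X⟧) : Matrix (Fin n) (Fin n) ℂ :=
  Matrix.of fun j k => ∑' i, up b j (n + i) * hank a c (n + i) k

/-- The remainder of the product of triangular matrices under truncation. -/
noncomputable def toepTail (n : ℕ) (b c : ℂ⟦X⟧) : Matrix (Fin n) (Fin n) ℂ :=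
  Matrix.of fun j k => ∑' i, up b j (n + i) * up c k (n + i)

theorem norm_hankTail_le (hs : 1 ≤ s) (ha : WSummable s a) (hb : WSummable s b)
    (hc : WSummable s c) :
    ‖hankTail n b a c‖ ≤ wnorm s b * (wnorm s a * wnorm s c) * s⁻¹ ^ n := by
  have h0 : (0 : ℝ) < s := zero_lt_one.trans_le hs
  have hK := mul_nonneg (wnorm_nonneg hs a) (wnorm_nonneg hs c)
  refine linfty_norm_le (mul_nonneg (mul_nonneg (wnorm_nonneg hs b) hK) (by positivity)) fun j => ?_
  refine sum_norm_tail_le hs hb (v := fun i k => hank a c i k) hK (fun i => ?_) j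
  refine le_trans (Finset.sum_le_sum fun k _ => ?_) (sum_norm_hank_le (n := n) hs ha hc i)
  exact le_mul_of_one_le_right (norm_nonneg _) (one_le_pow₀ hs)

theorem norm_toepTail_mul_wdiag_le (hs : 1 ≤ s) (hb : WSummable s b) (hc : WSummable s c) :
    ‖toepTail n b c * wdiag n s⁻¹‖ ≤ wnorm s b * wnorm s c * s⁻¹ ^ n := by
  have h0 : (0 : ℝ) < s := zero_lt_one.trans_le hs
  refine linfty_norm_le (mul_nonneg (mul_nonneg (wnorm_nonneg hs b) (wnorm_nonneg hs c))
    (by positivity)) fun j => ?_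
  have h := sum_norm_tail_le (n := n) hs hb (K := wnorm s c)
    (v := fun i k => up c k i * (s⁻¹ : ℂ) ^ (k : ℕ)) (wnorm_nonneg hs c) (fun i => ?_) j
  · convert h using 3 with k
    rw [wdiag, Matrix.mul_diagonal, toepTail, Matrix.of_apply, ← tsum_mul_right]
    simp only [mul_assoc, Complex.ofReal_inv]
  · have hcol := sum_upBound_col_le (n := n) hs hc i
    calc ∑ k : Fin n, ‖up c k i * (s⁻¹ : ℂ) ^ (k : ℕ)‖
        ≤ ∑ k : Fin n, upBound s c k i * s⁻¹ ^ i := by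
          refine Finset.sum_le_sum fun k _ => ?_
          have := norm_up_mul_pow_le c (p := s⁻¹) (q := s) h0.le
            (inv_mul_cancel₀ h0.ne') le_rfl k i
          rw [norm_mul, norm_pow, norm_inv, Complex.norm_real, Real.norm_of_nonneg h0.le]
          calc ‖up c k i‖ * s⁻¹ ^ (k : ℕ)
              = (s⁻¹ ^ (k : ℕ) * ‖up c k i‖ * s ^ i) * s⁻¹ ^ i := by
                rw [mul_assoc _ (s ^ i), ← mul_pow s, mul_inv_cancel₀ h0.ne', one_pow]; ring
            _ ≤ _ := mul_le_mul_of_nonneg_right this (by positivity)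
      _ ≤ _ := by
          rw [← Finset.sum_mul]
          exact mul_le_mul_of_nonneg_right hcol (by positivity)

theorem toepMat_eq (hs : 1 ≤ s) (ha : WSummable s a) (hc : WSummable s c) :
    toepMat n a c = (upMat n c)ᵀ * upMat n a + hankMat n a c := by
  ext j k
  rw [Matrix.add_apply, Matrix.mul_apply, toepMat, Matrix.of_apply,
    toep_eq_sum_add_hank hs ha hc j k n k.2, Finset.sum_range]
  rfl

theorem toepMat_eq_add_tail (hs : 1 ≤ s) (hb : WSummable s b) (hc : WSummable s c) :
    toepMat n b c = upMat n b * (upMat n c)ᵀ + toepTail n b c := by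
  ext j k
  rw [Matrix.add_apply, Matrix.mul_apply, toepMat, Matrix.of_apply, toep,
    ← (summable_up_mul hs hb (hc.norm_up_le hs _) _).sum_add_tsum_nat_add n, Finset.sum_range]
  simp only [toepTail, Matrix.of_apply, add_comm n]
  rfl

theorem toepMat_mul_eq (hs : 1 ≤ s) (ha : WSummable s a) (hb : WSummable s b)
    (hc : WSummable s c) : toepMat n (b * a) c =
      toepMat n b c * upMat n a + (upMat n b * hankMat n a c + hankTail n b a c) := by
  ext j k
  rw [Matrix.add_apply, Matrix.add_apply, Matrix.mul_apply, Matrix.mul_apply, toepMat,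
    Matrix.of_apply, toep_mul_eq hs ha hb hc j k n k.2, Finset.sum_range,
    ← (summable_up_mul hs hb (fun i => norm_hank_le hs ha hc i k) j).sum_add_tsum_nat_add n,
    Finset.sum_range]
  simp only [hankTail, Matrix.of_apply, add_comm n]
  rfl

end ToeplitzLimit

section ToeplitzLimit

open PowerSeries
attribute [local instance] Matrix.linftyOpNormedRing

variable {s : ℝ} {a b c : ℂ⟦X⟧} {n : ℕ}

/-- The constant term is `1`, and the power series and its inverse converge absolutely on the closed
disc of radius `s`. -/
structure IsWiener (s : ℝ) (a : ℂ⟦X⟧) : Prop where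
  const : constantCoeff a = 1
  sum : WSummable s a
  sum_inv : WSummable s a⁻¹

theorem IsWiener.mul_inv (ha : IsWiener s a) : a * a⁻¹ = 1 :=
  PowerSeries.mul_inv_cancel a (by rw [ha.const]; exact one_ne_zero)

theorem IsWiener.inv_inv (ha : IsWiener s a) : a⁻¹⁻¹ = a :=
  (PowerSeries.inv_eq_iff_mul_eq_one (by
    rw [constantCoeff_inv, ha.const, inv_one]; exact one_ne_zero)).2 ha.mul_inv

theorem IsWiener.inv (ha : IsWiener s a) : IsWiener s a⁻¹ where
  const := by rw [constantCoeff_inv, ha.const, inv_one]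
  sum := ha.sum_inv
  sum_inv := by rw [ha.inv_inv]; exact ha.sum

theorem WSummable.mul (hs : 1 ≤ s) (ha : WSummable s a) (hb : WSummable s b) :
    WSummable s (a * b) := by
  have h0 : (0 : ℝ) ≤ s := zero_le_one.trans hs
  have hn : ∀ d : ℂ⟦X⟧, WSummable s d → Summable fun k => ‖coeff k d * (s : ℂ) ^ k‖ := by
    intro d hd
    simpa [WSummable, abs_of_nonneg h0] using hd
  have h := summable_norm_sum_mul_antidiagonal_of_summable_norm (hn a ha) (hn b hb)
  refine h.congr fun k => ?_
  have : ∑ p ∈ Finset.HasAntidiagonal.antidiagonal k,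
      coeff p.1 a * (s : ℂ) ^ p.1 * (coeff p.2 b * (s : ℂ) ^ p.2) = coeff k (a * b) * (s : ℂ) ^ k := by
    rw [coeff_mul, Finset.sum_mul]
    refine Finset.sum_congr rfl fun p hp => ?_
    rw [← Finset.HasAntidiagonal.mem_antidiagonal.1 hp, pow_add]; ring
  rw [this]
  simp [abs_of_nonneg h0]

theorem IsWiener.mul (hs : 1 ≤ s) (ha : IsWiener s a) (hb : IsWiener s b) :
    IsWiener s (a * b) where
  const := by rw [map_mul, ha.const, hb.const, mul_one]
  sum := ha.sum.mul hs hb.sum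
  sum_inv := by rw [PowerSeries.mul_inv_rev]; exact hb.sum_inv.mul hs ha.sum_inv

theorem wSummable_one : WSummable s 1 :=
  summable_of_ne_finset_zero (s := {0}) fun k hk => by
    rw [coeff_one, if_neg (by simpa using hk)]; simp

theorem isWiener_one : IsWiener s 1 where
  const := map_one _
  sum := wSummable_one
  sum_inv := by
    have : (1 : ℂ⟦X⟧)⁻¹ = 1 := (PowerSeries.inv_eq_iff_mul_eq_one (by simp)).2 (mul_one 1)
    rw [this]; exact wSummable_one

theorem upMat_mul_inv (ha : IsWiener s a) : upMat n a * upMat n a⁻¹ = 1 := by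
  rw [← upMat_mul, ha.mul_inv, upMat_one]

theorem upMat_inv_mul (ha : IsWiener s a) : upMat n a⁻¹ * upMat n a = 1 :=
  mul_eq_one_comm.1 (upMat_mul_inv ha)

theorem upMat_transpose_mul_inv (ha : IsWiener s a) : (upMat n a)ᵀ * (upMat n a⁻¹)ᵀ = 1 := by
  rw [← Matrix.transpose_mul, upMat_inv_mul ha, Matrix.transpose_one]

theorem upMat_transpose_inv_mul (ha : IsWiener s a) : (upMat n a⁻¹)ᵀ * (upMat n a)ᵀ = 1 := by
  rw [← Matrix.transpose_mul, upMat_mul_inv ha, Matrix.transpose_one]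

/-- The localized perturbation `Y` for which `1 + Y` is the Toeplitz matrix stripped of its
triangular factors. -/
noncomputable def corner (n : ℕ) (a c : ℂ⟦X⟧) : Matrix (Fin n) (Fin n) ℂ :=
  (upMat n c⁻¹)ᵀ * hankMat n a c * upMat n a⁻¹

theorem hankMat_eq_corner (ha : IsWiener s a) (hc : IsWiener s c) :
    hankMat n a c = (upMat n c)ᵀ * corner n a c * upMat n a := by
  rw [corner, mul_assoc, mul_assoc, mul_assoc, upMat_inv_mul ha, mul_one, ← mul_assoc,
    upMat_transpose_mul_inv hc, one_mul]

theorem toepMat_eq_corner (hs : 1 ≤ s) (ha : IsWiener s a) (hc : IsWiener s c) :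
    toepMat n a c = (upMat n c)ᵀ * (1 + corner n a c) * upMat n a := by
  rw [toepMat_eq hs ha.sum hc.sum, hankMat_eq_corner ha hc]; noncomm_ring

/-- The triangular factors have determinant `1`. -/
theorem det_toepMat (hs : 1 ≤ s) (ha : IsWiener s a) (hc : IsWiener s c) :
    (toepMat n a c).det = (1 + corner n a c).det := by
  rw [toepMat_eq_corner hs ha hc, Matrix.det_mul, Matrix.det_mul, Matrix.det_transpose,
    det_upMat n ha.const, det_upMat n hc.const, one_mul, mul_one]

/-- A bound for `corner n a c` in the weighted norm, uniform in `n`. -/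
noncomputable def cornerBound (s : ℝ) (a c : ℂ⟦X⟧) : ℝ :=
  wnorm s c⁻¹ * (wnorm s a * wnorm s c) * wnorm s a⁻¹

theorem cornerBound_nonneg (hs : 1 ≤ s) (a c : ℂ⟦X⟧) : 0 ≤ cornerBound s a c :=
  mul_nonneg (mul_nonneg (wnorm_nonneg hs _) (mul_nonneg (wnorm_nonneg hs _) (wnorm_nonneg hs _)))
    (wnorm_nonneg hs _)

theorem norm_wdiag_corner_wdiag_le (hs : 1 ≤ s) (ha : IsWiener s a) (hc : IsWiener s c) :
    ‖wdiag n s * corner n a c * wdiag n s‖ ≤ cornerBound s a c := by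
  have h0 : (0 : ℝ) < s := zero_lt_one.trans_le hs
  have h1 : wdiag n s * corner n a c * wdiag n s =
      (wdiag n s * (upMat n c⁻¹)ᵀ * wdiag n s⁻¹) * (wdiag n s * hankMat n a c * wdiag n s) *
        (wdiag n s⁻¹ * upMat n a⁻¹ * wdiag n s) := by
    calc wdiag n s * corner n a c * wdiag n s
        = wdiag n s * (upMat n c⁻¹)ᵀ * 1 * hankMat n a c * 1 * upMat n a⁻¹ * wdiag n s := by
          rw [corner]; noncomm_ring
      _ = wdiag n s * (upMat n c⁻¹)ᵀ * (wdiag n s⁻¹ * wdiag n s) * hankMat n a c *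
            (wdiag n s * wdiag n s⁻¹) * upMat n a⁻¹ * wdiag n s := by
          rw [wdiag_inv_mul hs, wdiag_mul_inv hs]
      _ = _ := by noncomm_ring
  rw [h1]
  refine (norm_mul_le _ _).trans (mul_le_mul ((norm_mul_le _ _).trans (mul_le_mul ?_ ?_
    (norm_nonneg _) (wnorm_nonneg hs _))) ?_ (norm_nonneg _)
    (mul_nonneg (wnorm_nonneg hs _) (mul_nonneg (wnorm_nonneg hs _) (wnorm_nonneg hs _))))
  · exact norm_wdiag_upMat_transpose_le hs hc.sum_inv (by positivity) h0.le
      (inv_mul_cancel₀ h0.ne') le_rfl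
  · exact norm_wdiag_hankMat_le hs ha.sum hc.sum
  · exact norm_wdiag_upMat_le hs ha.sum_inv (by positivity) h0.le (inv_mul_cancel₀ h0.ne') le_rfl

theorem norm_mul_wdiag_inv_le (hs : 1 ≤ s) (M : Matrix (Fin n) (Fin n) ℂ) :
    ‖M * wdiag n s⁻¹‖ ≤ ‖M‖ :=
  (norm_mul_le _ _).trans (mul_le_of_le_one_right (norm_nonneg _) (norm_wdiag_inv_le hs))

theorem norm_wdiag_inv_mul_le (hs : 1 ≤ s) (M : Matrix (Fin n) (Fin n) ℂ) :
    ‖wdiag n s⁻¹ * M‖ ≤ ‖M‖ :=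
  (norm_mul_le _ _).trans (mul_le_of_le_one_left (norm_nonneg _) (norm_wdiag_inv_le hs))

theorem norm_wdiag_corner_le (hs : 1 ≤ s) (ha : IsWiener s a) (hc : IsWiener s c) :
    ‖wdiag n s * corner n a c‖ ≤ cornerBound s a c := by
  have h : wdiag n s * corner n a c = (wdiag n s * corner n a c * wdiag n s) * wdiag n s⁻¹ := by
    rw [mul_assoc _ (wdiag n s), wdiag_mul_inv hs, mul_one]
  rw [h]
  exact (norm_mul_wdiag_inv_le hs _).trans (norm_wdiag_corner_wdiag_le hs ha hc)

theorem norm_corner_le (hs : 1 ≤ s) (ha : IsWiener s a) (hc : IsWiener s c) :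
    ‖corner n a c‖ ≤ cornerBound s a c := by
  have h : corner n a c = wdiag n s⁻¹ * (wdiag n s * corner n a c) := by
    rw [← mul_assoc, wdiag_inv_mul hs, one_mul]
  rw [h]
  exact (norm_wdiag_inv_mul_le hs _).trans (norm_wdiag_corner_le hs ha hc)

/-- Rows of `M` approach those of the identity geometrically. -/
theorem sum_row_le_of_wdiag (hs : 1 ≤ s) {M : Matrix (Fin n) (Fin n) ℂ} {K : ℝ}
    (h : ‖wdiag n s * (M - 1)‖ ≤ K) (j : Fin n) : ∑ k, ‖M j k‖ ≤ 1 + K * s⁻¹ ^ (j : ℕ) := by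
  have h0 : (0 : ℝ) < s := zero_lt_one.trans_le hs
  have h1 : ∑ k, ‖(M - 1) j k‖ ≤ K * s⁻¹ ^ (j : ℕ) := by
    have h2 := (sum_row_le_linfty_norm _ j).trans h
    have h3 : ∑ k, ‖(wdiag n s * (M - 1)) j k‖ = s ^ (j : ℕ) * ∑ k, ‖(M - 1) j k‖ := by
      rw [Finset.mul_sum]
      refine Finset.sum_congr rfl fun k _ => ?_
      rw [wdiag, Matrix.diagonal_mul, norm_mul, norm_pow, Complex.norm_real,
        Real.norm_of_nonneg h0.le]
    rw [h3] at h2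
    calc ∑ k, ‖(M - 1) j k‖ = (s * s⁻¹) ^ (j : ℕ) * ∑ k, ‖(M - 1) j k‖ := by
          rw [mul_inv_cancel₀ h0.ne', one_pow, one_mul]
      _ = (s ^ (j : ℕ) * ∑ k, ‖(M - 1) j k‖) * s⁻¹ ^ (j : ℕ) := by rw [mul_pow]; ring
      _ ≤ _ := mul_le_mul_of_nonneg_right h2 (by positivity)
  have h4 : ∑ k, ‖(1 : Matrix (Fin n) (Fin n) ℂ) j k‖ ≤ 1 :=
    (sum_row_le_linfty_norm _ j).trans linfty_norm_one_le
  calc ∑ k, ‖M j k‖ ≤ ∑ k, (‖(1 : Matrix (Fin n) (Fin n) ℂ) j k‖ + ‖(M - 1) j k‖) := by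
        refine Finset.sum_le_sum fun k _ => ?_
        rw [Matrix.sub_apply]
        have := norm_add_le ((1 : Matrix (Fin n) (Fin n) ℂ) j k) (M j k - (1 : Matrix _ _ ℂ) j k)
        rwa [add_sub_cancel] at this
    _ ≤ _ := by rw [Finset.sum_add_distrib]; linarith

theorem norm_det_toepMat_le (hs : 1 < s) (ha : IsWiener s a) (hc : IsWiener s c) (n : ℕ) :
    ‖(toepMat n a c).det‖ ≤ Real.exp (cornerBound s a c * (1 - s⁻¹)⁻¹) := by
  rw [det_toepMat hs.le ha hc]
  refine (norm_det_le_prod_rows _).trans ((Finset.prod_le_prod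
    (fun _ _ => Finset.sum_nonneg fun _ _ => norm_nonneg _) fun j _ => ?_).trans
    (prod_one_add_mul_pow_le (cornerBound_nonneg hs.le a c) (r := s⁻¹)
      (inv_nonneg.2 (zero_le_one.trans hs.le)) (inv_lt_one_of_one_lt₀ hs) n))
  exact sum_row_le_of_wdiag hs.le (by
    rw [add_sub_cancel_left]; exact norm_wdiag_corner_le hs.le ha hc) j

/-- Toeplitz determinants are asymptotically multiplicative in the analytic factor of the symbol. -/
theorem tendsto_det_toepMat_mul_sub (hs : 1 < s) (ha : IsWiener s a) (hb : IsWiener s b)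
    (hc : IsWiener s c) :
    Tendsto (fun n => (toepMat n (b * a) c).det - (toepMat n b c).det * (toepMat n a c).det)
      atTop (𝓝 0) := by
  have hs1 := hs.le
  have h0 : (0 : ℝ) < s := zero_lt_one.trans hs
  have hr1 : s⁻¹ < 1 := inv_lt_one_of_one_lt₀ hs
  have hba := hb.mul hs1 ha
  set A := wnorm s a with hA
  set A' := wnorm s a⁻¹ with hA'
  set B := wnorm s b with hB
  set B' := wnorm s b⁻¹ with hB'
  set C := wnorm s c with hC
  set C' := wnorm s c⁻¹ with hC'
  have hA0 : 0 ≤ A := wnorm_nonneg hs1 _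
  have hA'0 : 0 ≤ A' := wnorm_nonneg hs1 _
  have hB0 : 0 ≤ B := wnorm_nonneg hs1 _
  have hB'0 : 0 ≤ B' := wnorm_nonneg hs1 _
  have hC0 : 0 ≤ C := wnorm_nonneg hs1 _
  have hC'0 : 0 ≤ C' := wnorm_nonneg hs1 _
  set K₁ := cornerBound s (b * a) c with hK₁
  set K₂ := cornerBound s b c with hK₂
  set K₃ := cornerBound s a c with hK₃
  have hK₁0 : 0 ≤ K₁ := cornerBound_nonneg hs1 _ _
  have hK₂0 : 0 ≤ K₂ := cornerBound_nonneg hs1 _ _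
  have hK₃0 : 0 ≤ K₃ := cornerBound_nonneg hs1 _ _
  set K := K₁ + (K₂ * (B * (1 + K₃) * B') + B * K₃ * B') with hK
  have hK0 : 0 ≤ K := by positivity
  set E := C' * (B * (A * C) + B * C * K₃ * A) * A' * B' with hE
  have hE0 : 0 ≤ E := by positivity
  set P := Real.exp (K * (1 - s⁻¹)⁻¹) with hP
  have key : ∀ n : ℕ, ‖(toepMat n (b * a) c).det - (toepMat n b c).det * (toepMat n a c).det‖ ≤
      E * P * (n * s⁻¹ ^ n) := by
    intro n
    -- `Q` is `1 + corner n a c` conjugated by the triangular matrix of `b`. The matrix `M'` has the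
    -- product of the two determinants as its determinant and is close to `1 + corner n (b * a) c`.
    set Q := upMat n b * (1 + corner n a c) * upMat n b⁻¹ with hQ
    set M' := (1 + corner n b c) * Q with hM'
    set D := hankTail n b a c - toepTail n b c * corner n a c * upMat n a with hD
    have hdet' : M'.det = (toepMat n b c).det * (toepMat n a c).det := by
      rw [hM', hQ, Matrix.det_mul, Matrix.det_mul, Matrix.det_mul, det_upMat n hb.const,
        det_upMat n hb.inv.const, det_toepMat hs1 hb hc, det_toepMat hs1 ha hc]
      ring
    have hT : toepMat n (b * a) c =
        toepMat n b c * (1 + corner n a c) * upMat n a + D := by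
      have h1 : upMat n b * hankMat n a c =
          (toepMat n b c - toepTail n b c) * corner n a c * upMat n a := by
        rw [toepMat_eq_add_tail hs1 hb.sum hc.sum, add_sub_cancel_right, hankMat_eq_corner ha hc]
        simp only [mul_assoc]
      rw [toepMat_mul_eq hs1 ha.sum hb.sum hc.sum, h1, hD]
      noncomm_ring
    have hdiff : (1 + corner n (b * a) c) - M' =
        (upMat n c⁻¹)ᵀ * D * (upMat n a⁻¹ * upMat n b⁻¹) := by
      have hU : upMat n (b * a) * (upMat n a⁻¹ * upMat n b⁻¹) = 1 := by
        rw [upMat_mul, mul_assoc, ← mul_assoc (upMat n a), upMat_mul_inv ha, one_mul,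
          upMat_mul_inv hb]
      have h1 : 1 + corner n (b * a) c =
          (upMat n c⁻¹)ᵀ * toepMat n (b * a) c * (upMat n a⁻¹ * upMat n b⁻¹) := by
        have h2 : (upMat n c⁻¹)ᵀ * ((upMat n c)ᵀ * (1 + corner n (b * a) c) * upMat n (b * a)) *
            (upMat n a⁻¹ * upMat n b⁻¹) = ((upMat n c⁻¹)ᵀ * (upMat n c)ᵀ) *
              (1 + corner n (b * a) c) * (upMat n (b * a) * (upMat n a⁻¹ * upMat n b⁻¹)) := by
          simp only [mul_assoc]
        rw [toepMat_eq_corner hs1 hba hc, h2, upMat_transpose_inv_mul hc, hU, one_mul, mul_one]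
      have h2 : M' = (upMat n c⁻¹)ᵀ * (toepMat n b c * (1 + corner n a c) * upMat n a) *
          (upMat n a⁻¹ * upMat n b⁻¹) := by
        calc M' = 1 * (1 + corner n b c) * upMat n b * (1 + corner n a c) * 1 * upMat n b⁻¹ := by
              rw [hM', hQ]; noncomm_ring
          _ = ((upMat n c⁻¹)ᵀ * (upMat n c)ᵀ) * (1 + corner n b c) * upMat n b *
                (1 + corner n a c) * (upMat n a * upMat n a⁻¹) * upMat n b⁻¹ := by
              rw [upMat_transpose_inv_mul hc, upMat_mul_inv ha]
          _ = _ := by rw [toepMat_eq_corner hs1 hb hc]; simp only [mul_assoc]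
      rw [h1, h2, hT]; noncomm_ring
    have hDnorm : ‖D‖ ≤ (B * (A * C) + B * C * K₃ * A) * s⁻¹ ^ n := by
      have h1 : toepTail n b c * corner n a c * upMat n a =
          (toepTail n b c * wdiag n s⁻¹) * (wdiag n s * corner n a c) * upMat n a := by
        rw [mul_assoc (toepTail n b c) (wdiag n s⁻¹), ← mul_assoc (wdiag n s⁻¹),
          wdiag_inv_mul hs1, one_mul]
      have h2 : ‖toepTail n b c * corner n a c * upMat n a‖ ≤ B * C * s⁻¹ ^ n * K₃ * A := by
        rw [h1]
        refine (norm_mul_le _ _).trans (mul_le_mul ((norm_mul_le _ _).trans (mul_le_mul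
          (norm_toepTail_mul_wdiag_le hs1 hb.sum hc.sum) (norm_wdiag_corner_le hs1 ha hc)
          (norm_nonneg _) (by positivity))) (norm_upMat_le hs1 ha.sum) (norm_nonneg _)
          (by positivity))
      calc ‖D‖ ≤ B * (A * C) * s⁻¹ ^ n + B * C * s⁻¹ ^ n * K₃ * A :=
            (norm_sub_le _ _).trans (add_le_add (norm_hankTail_le hs1 ha.sum hb.sum hc.sum) h2)
        _ = _ := by ring
    have hdiffnorm : ‖(1 + corner n (b * a) c) - M'‖ ≤ E * s⁻¹ ^ n := by
      rw [hdiff]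
      calc ‖(upMat n c⁻¹)ᵀ * D * (upMat n a⁻¹ * upMat n b⁻¹)‖
          ≤ (C' * ((B * (A * C) + B * C * K₃ * A) * s⁻¹ ^ n)) * (A' * B') := by
            refine (norm_mul_le _ _).trans (mul_le_mul ((norm_mul_le _ _).trans (mul_le_mul
              (norm_upMat_transpose_le hs1 hc.sum_inv) hDnorm (norm_nonneg _) hC'0))
              ((norm_mul_le _ _).trans (mul_le_mul (norm_upMat_le hs1 ha.sum_inv)
                (norm_upMat_le hs1 hb.sum_inv) (norm_nonneg _) hA'0)) (norm_nonneg _)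
              (by positivity))
        _ = _ := by rw [hE]; ring
    have hQnorm : ‖Q‖ ≤ B * (1 + K₃) * B' := by
      refine (norm_mul_le _ _).trans (mul_le_mul ((norm_mul_le _ _).trans (mul_le_mul
        (norm_upMat_le hs1 hb.sum) ((norm_add_le _ _).trans (add_le_add linfty_norm_one_le
          (norm_corner_le hs1 ha hc))) (norm_nonneg _) hB0)) (norm_upMat_le hs1 hb.sum_inv)
        (norm_nonneg _) (by positivity))
    have hrow' : ‖wdiag n s * (M' - 1)‖ ≤ K₂ * (B * (1 + K₃) * B') + B * K₃ * B' := by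
      have h1 : wdiag n s * (M' - 1) = wdiag n s * corner n b c * Q +
          (wdiag n s * upMat n b * wdiag n s⁻¹) * (wdiag n s * corner n a c) * upMat n b⁻¹ := by
        have h2 : Q - 1 = upMat n b * corner n a c * upMat n b⁻¹ := by
          rw [hQ, mul_add, mul_one, add_mul, upMat_mul_inv hb, add_sub_cancel_left]
        have h3 : M' - 1 = corner n b c * Q + (Q - 1) := by rw [hM']; noncomm_ring
        have h4 : wdiag n s * upMat n b * wdiag n s⁻¹ * (wdiag n s * corner n a c) =
            wdiag n s * upMat n b * corner n a c := by
          rw [mul_assoc (wdiag n s * upMat n b), ← mul_assoc (wdiag n s⁻¹), wdiag_inv_mul hs1,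
            one_mul]
        rw [h4, h3, h2]
        noncomm_ring
      rw [h1]
      refine (norm_add_le _ _).trans (add_le_add ?_ ?_)
      · exact (norm_mul_le _ _).trans (mul_le_mul (norm_wdiag_corner_le hs1 hb hc) hQnorm
          (norm_nonneg _) hK₂0)
      · refine (norm_mul_le _ _).trans (mul_le_mul ((norm_mul_le _ _).trans (mul_le_mul
          (norm_wdiag_upMat_le hs1 hb.sum h0.le (by positivity) (mul_inv_cancel₀ h0.ne') ?_)
          (norm_wdiag_corner_le hs1 ha hc) (norm_nonneg _) hB0)) (norm_upMat_le hs1 hb.sum_inv)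
          (norm_nonneg _) (by positivity))
        exact hr1.le.trans hs1
    have hrow : ‖wdiag n s * ((1 + corner n (b * a) c) - 1)‖ ≤ K₁ := by
      rw [add_sub_cancel_left]; exact norm_wdiag_corner_le hs1 hba hc
    have hfin := norm_det_sub_det_le (1 + corner n (b * a) c) M'
      (fun j => 1 + K * s⁻¹ ^ (j : ℕ)) (E * s⁻¹ ^ n)
      (fun j => le_add_of_nonneg_right (by positivity))
      (sum_row_le_of_wdiag hs1 (hrow.trans (le_add_of_nonneg_right (by positivity))))
      (sum_row_le_of_wdiag hs1 (hrow'.trans (le_add_of_nonneg_left hK₁0)))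
      (fun j => (sum_row_le_linfty_norm ((1 + corner n (b * a) c) - M') j).trans hdiffnorm)
    rw [← det_toepMat hs1 hba hc, hdet'] at hfin
    refine hfin.trans ?_
    calc (n : ℝ) * (E * s⁻¹ ^ n) * ∏ j : Fin n, (1 + K * s⁻¹ ^ (j : ℕ))
        ≤ n * (E * s⁻¹ ^ n) * P := mul_le_mul_of_nonneg_left
          (prod_one_add_mul_pow_le hK0 (inv_nonneg.2 h0.le) hr1 n) (by positivity)
      _ = _ := by ring
  refine squeeze_zero_norm key ?_
  have := (tendsto_self_mul_const_pow_of_lt_one (inv_nonneg.2 h0.le) hr1).const_mul (E * P)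
  rwa [mul_zero] at this

end ToeplitzLimit

section DetLimit

open PowerSeries

/-! ### Limits of Toeplitz determinants -/

variable {s : ℝ} {a b c : ℂ⟦X⟧}

theorem det_toepMat_comm (n : ℕ) (a c : ℂ⟦X⟧) : (toepMat n a c).det = (toepMat n c a).det := by
  rw [← Matrix.det_transpose]
  congr 1
  ext j k
  exact tsum_congr fun l => mul_comm _ _

/-- The Toeplitz determinants of the symbol `a(z) c(1/z)` converge to `e`. -/
def HasDetLimit (a c : ℂ⟦X⟧) (e : ℂ) : Prop :=
  Tendsto (fun n => (toepMat n a c).det) atTop (𝓝 e)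

theorem HasDetLimit.symm {e : ℂ} (h : HasDetLimit a c e) : HasDetLimit c a e :=
  h.congr fun n => det_toepMat_comm n a c

theorem HasDetLimit.mul (hs : 1 < s) (ha : IsWiener s a) (hb : IsWiener s b) (hc : IsWiener s c)
    {e e' : ℂ} (h : HasDetLimit a c e) (h' : HasDetLimit b c e') :
    HasDetLimit (b * a) c (e' * e) := by
  have := (tendsto_det_toepMat_mul_sub hs ha hb hc).add (Tendsto.mul h' h)
  simpa [HasDetLimit] using this

theorem det_toepMat_one_left (hs : 1 < s) (hc : IsWiener s c) (n : ℕ) :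
    (toepMat n 1 c).det = 1 := by
  have h : hankMat n 1 c = 0 := by
    ext j k
    rw [hankMat, Matrix.of_apply, hank]
    have : ∀ l, coeff ((k : ℕ) + 1 + l) (1 : ℂ⟦X⟧) = 0 := fun l => by
      rw [coeff_one, if_neg (by omega)]
    simp [this]
  rw [toepMat_eq hs.le wSummable_one hc.sum, h, upMat_one, mul_one, add_zero,
    Matrix.det_transpose, det_upMat n hc.const]

theorem HasDetLimit.inv (hs : 1 < s) (ha : IsWiener s a) (hc : IsWiener s c)
    {e : ℂ} (he : e ≠ 0) (h : HasDetLimit a c e) : HasDetLimit a⁻¹ c e⁻¹ := by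
  have h1 : Tendsto (fun n => (toepMat n a⁻¹ c).det * (toepMat n a c).det) atTop (𝓝 1) := by
    have := (tendsto_det_toepMat_mul_sub hs ha ha.inv hc).const_sub 1
    rw [mul_comm a⁻¹, ha.mul_inv] at this
    simpa [det_toepMat_one_left hs hc] using this
  have h2 := h1.div h he
  rw [one_div] at h2
  refine h2.congr' ?_
  filter_upwards [h.eventually_ne he] with n hn
  exact mul_div_cancel_right₀ _ hn

/-- The fourth power enters because the symbol is a product of two factors, each of which is a
square root. -/
theorem HasDetLimit.of_mul_self (hs : 1 < s) (ha : IsWiener s a) (hc : IsWiener s c) {e : ℂ}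
    (h : HasDetLimit (a * a) (c * c) e) :
    Tendsto (fun n => (toepMat n a c).det ^ 4) atTop (𝓝 e) := by
  have hcc := hc.mul hs.le hc
  have h1 := tendsto_det_toepMat_mul_sub hs ha ha hcc
  have h2 := tendsto_det_toepMat_mul_sub hs hc hc ha
  simp only [det_toepMat_comm _ (c * c) a, det_toepMat_comm _ c a] at h2
  set x := fun n => (toepMat n a c).det with hx
  set y := fun n => (toepMat n a (c * c)).det with hy
  have hb : IsBoundedUnder (· ≤ ·) atTop fun n => ‖y n + x n * x n‖ := by
    refine isBoundedUnder_of ⟨Real.exp (cornerBound s a (c * c) * (1 - s⁻¹)⁻¹) +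
      Real.exp (cornerBound s a c * (1 - s⁻¹)⁻¹) * Real.exp (cornerBound s a c * (1 - s⁻¹)⁻¹),
      fun n => (norm_add_le _ _).trans (add_le_add (norm_det_toepMat_le hs ha hcc n) ?_)⟩
    rw [norm_mul]
    exact mul_le_mul (norm_det_toepMat_le hs ha hc n) (norm_det_toepMat_le hs ha hc n)
      (norm_nonneg _) (Real.exp_nonneg _)
  have h3 : Tendsto (fun n => (y n - x n * x n) * (y n + x n * x n)) atTop (𝓝 0) :=
    h2.zero_mul_isBoundedUnder_le hb
  have h4 := (Tendsto.sub h h1).sub h3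
  simp only [sub_zero] at h4
  refine h4.congr fun n => ?_
  simp only [hx, hy]
  ring

/-! ### Linear factors -/

/-- The linear factor `1 - u X`. -/
noncomputable def lin (u : ℂ) : ℂ⟦X⟧ := 1 - C u * X

theorem coeff_lin_zero (u : ℂ) : coeff 0 (lin u) = 1 := by simp [lin]

theorem coeff_lin_one (u : ℂ) : coeff 1 (lin u) = -u := by
  simp [lin, coeff_one]

theorem coeff_lin_of_two_le (u : ℂ) {k : ℕ} (hk : 2 ≤ k) : coeff k (lin u) = 0 := by
  simp only [lin, map_sub, coeff_one, coeff_C_mul, coeff_X]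
  rw [if_neg (by omega), if_neg (by omega)]; simp

theorem inv_lin (u : ℂ) : (lin u)⁻¹ = mk fun k => u ^ k := by
  rw [PowerSeries.inv_eq_iff_mul_eq_one (by simp [lin])]
  ext k
  rw [lin, mul_sub, mul_one, map_sub, coeff_mk, ← mul_assoc, mul_comm _ (C u), mul_assoc,
    coeff_C_mul]
  cases k with
  | zero => simp
  | succ k => rw [coeff_succ_mul_X, coeff_mk, coeff_one, if_neg (Nat.succ_ne_zero k), pow_succ']; ring

theorem isWiener_lin (hs : 1 ≤ s) {u : ℂ} (hu : ‖u‖ * s < 1) : IsWiener s (lin u) where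
  const := by simp [lin]
  sum := summable_of_ne_finset_zero (s := Finset.range 2) fun k hk => by
    rw [coeff_lin_of_two_le u (by rw [Finset.mem_range] at hk; omega)]; simp
  sum_inv := by
    rw [inv_lin]
    refine (summable_geometric_of_lt_one (by positivity) hu).congr fun k => ?_
    rw [coeff_mk, norm_pow, mul_pow]

/-- For this symbol all nonempty Toeplitz determinants coincide, as the perturbation of the triangular
factorization sits in the corner entry. -/
theorem hasDetLimit_inv_lin_lin (hs : 1 < s) {u v : ℂ} (hu : ‖u‖ * s < 1) (hv : ‖v‖ * s < 1) :
    HasDetLimit (lin u)⁻¹ (lin v) (1 - u * v) := by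
  have hlu := isWiener_lin hs.le hu
  have hlv := isWiener_lin hs.le hv
  refine tendsto_const_nhds.congr' ?_
  filter_upwards [eventually_ge_atTop 1] with n hn
  obtain ⟨m, rfl⟩ : ∃ m, n = m + 1 := ⟨n - 1, by omega⟩
  set E : Matrix (Fin (m + 1)) (Fin (m + 1)) ℂ :=
    Matrix.diagonal fun j => if j = 0 then -(u * v) else 0 with hE
  have hX : hankMat (m + 1) (lin u)⁻¹ (lin v) = E * upMat (m + 1) (lin u)⁻¹ := by
    ext j k
    rw [hE, Matrix.diagonal_mul, hankMat, Matrix.of_apply, hank, upMat, Matrix.of_apply]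
    rw [tsum_eq_single 0 fun l hl => by
      rw [coeff_lin_of_two_le v (by omega), mul_zero]]
    by_cases hj : j = 0
    · subst hj
      rw [if_pos rfl, Fin.val_zero, up_zero_left, inv_lin, coeff_mk, coeff_mk]
      simp only [zero_add, add_zero, coeff_lin_one]
      ring
    · have : 0 < (j : ℕ) := Nat.pos_of_ne_zero fun h => hj (Fin.ext h)
      rw [if_neg hj, coeff_lin_of_two_le v (by omega)]; simp
  rw [toepMat_eq hs.le hlu.inv.sum hlv.sum, hX, ← add_mul, Matrix.det_mul,
    det_upMat _ hlu.inv.const, mul_one, Matrix.det_of_isLowerTriangular]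
  · have hd : ∀ j : Fin (m + 1), ((upMat (m + 1) (lin v))ᵀ + E) j j =
        if j = 0 then 1 - u * v else 1 := by
      intro j
      rw [Matrix.add_apply, Matrix.transpose_apply, upMat, Matrix.of_apply, up_of_le _ le_rfl,
        Nat.sub_self, coeff_lin_zero, hE, Matrix.diagonal_apply_eq]
      split_ifs <;> ring
    simp only [hd, Finset.prod_ite_eq', Finset.mem_univ, if_true]
  · intro j k hjk
    have hjk' : j < k := hjk
    rw [Matrix.add_apply, Matrix.transpose_apply, upMat, Matrix.of_apply, up_of_lt _ hjk', hE,
      Matrix.diagonal_apply_ne _ hjk'.ne, add_zero]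

theorem one_sub_mul_ne_zero (hs : 1 ≤ s) {u v : ℂ} (hu : ‖u‖ * s < 1) (hv : ‖v‖ * s < 1) :
    1 - u * v ≠ 0 := by
  have h : ∀ w : ℂ, ‖w‖ * s < 1 → ‖w‖ < 1 := fun w hw =>
    (le_mul_of_one_le_right (norm_nonneg w) hs).trans_lt hw
  intro h0
  have h1 : ‖u * v‖ < 1 := by
    rw [norm_mul]; exact mul_lt_one_of_nonneg_of_lt_one_left (norm_nonneg _) (h u hu) (h v hv).le
  rw [← sub_eq_zero.1 h0, norm_one] at h1
  exact lt_irrefl _ h1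

theorem hasDetLimit_lin_lin (hs : 1 < s) {u v : ℂ} (hu : ‖u‖ * s < 1) (hv : ‖v‖ * s < 1) :
    HasDetLimit (lin u) (lin v) (1 - u * v)⁻¹ := by
  have hlu := isWiener_lin hs.le hu
  have := (hasDetLimit_inv_lin_lin hs hu hv).inv hs hlu.inv (isWiener_lin hs.le hv)
    (one_sub_mul_ne_zero hs.le hu hv)
  rwa [hlu.inv_inv] at this

theorem isWiener_multiset_prod (hs : 1 ≤ s) {ι : Type*} (S : Multiset ι) (F : ι → ℂ⟦X⟧)
    (hF : ∀ x ∈ S, IsWiener s (F x)) : IsWiener s (S.map F).prod := by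
  induction S using Multiset.induction_on with
  | empty => simpa using isWiener_one
  | cons x S ih =>
    rw [Multiset.map_cons, Multiset.prod_cons]
    exact (hF x (Multiset.mem_cons_self x S)).mul hs
      (ih fun y hy => hF y (Multiset.mem_cons_of_mem hy))

theorem hasDetLimit_multiset_prod (hs : 1 < s) (hc : IsWiener s c) {ι : Type*} (S : Multiset ι)
    (F : ι → ℂ⟦X⟧) (e : ι → ℂ) (hF : ∀ x ∈ S, IsWiener s (F x))
    (h : ∀ x ∈ S, HasDetLimit (F x) c (e x)) : HasDetLimit (S.map F).prod c (S.map e).prod := by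
  induction S using Multiset.induction_on with
  | empty => simp [HasDetLimit, det_toepMat_one_left hs hc]
  | cons x S ih =>
    have hS : ∀ y ∈ S, y ∈ x ::ₘ S := fun y hy => Multiset.mem_cons_of_mem hy
    rw [Multiset.map_cons, Multiset.prod_cons, Multiset.map_cons, Multiset.prod_cons]
    exact (ih (fun y hy => hF y (hS y hy)) fun y hy => h y (hS y hy)).mul hs
      (isWiener_multiset_prod hs.le S F fun y hy => hF y (hS y hy))
      (hF x (Multiset.mem_cons_self x S)) hc (h x (Multiset.mem_cons_self x S))

/-- The polynomial `∏_{u ∈ S} (1 - u X)`. -/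
noncomputable def linProd (S : Multiset ℂ) : ℂ⟦X⟧ := (S.map lin).prod

/-- The product `∏_{u ∈ S, v ∈ T} (1 - u v)`. -/
noncomputable def crossProd (S T : Multiset ℂ) : ℂ := ((S ×ˢ T).map fun p => 1 - p.1 * p.2).prod

theorem isWiener_linProd (hs : 1 ≤ s) {S : Multiset ℂ} (hS : ∀ u ∈ S, ‖u‖ * s < 1) :
    IsWiener s (linProd S) :=
  isWiener_multiset_prod hs S lin fun u hu => isWiener_lin hs (hS u hu)

theorem crossProd_ne_zero (hs : 1 ≤ s) {S T : Multiset ℂ} (hS : ∀ u ∈ S, ‖u‖ * s < 1)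
    (hT : ∀ u ∈ T, ‖u‖ * s < 1) : crossProd S T ≠ 0 := by
  refine Multiset.prod_ne_zero ?_
  simp only [Multiset.mem_map, not_exists, not_and]
  rintro ⟨u, v⟩ h
  rw [Multiset.mem_product] at h
  exact one_sub_mul_ne_zero hs (hS u h.1) (hT v h.2)

theorem hasDetLimit_linProd (hs : 1 < s) {S T : Multiset ℂ} (hS : ∀ u ∈ S, ‖u‖ * s < 1)
    (hT : ∀ u ∈ T, ‖u‖ * s < 1) : HasDetLimit (linProd S) (linProd T) (crossProd S T)⁻¹ := by
  have h1 : ∀ u ∈ S, HasDetLimit (lin u) (linProd T) (T.map fun v => (1 - u * v)⁻¹).prod :=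
    fun u hu => (hasDetLimit_multiset_prod hs (isWiener_lin hs.le (hS u hu)) T lin
      (fun v => (1 - u * v)⁻¹) (fun v hv => isWiener_lin hs.le (hT v hv))
      fun v hv => (hasDetLimit_lin_lin hs (hS u hu) (hT v hv)).symm).symm
  have h2 : HasDetLimit (linProd S) _ _ := hasDetLimit_multiset_prod hs
    (isWiener_linProd hs.le hT) S lin _
    (fun u hu => isWiener_lin hs.le (hS u hu)) h1
  convert h2 using 1
  rw [crossProd, Multiset.prod_map_product_eq_prod_prod]
  simp only [Multiset.prod_map_inv]

/-- The Toeplitz limit for the quotient of two products of linear factors. -/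
theorem hasDetLimit_quotient (hs : 1 < s) {S T : Multiset ℂ} (hS : ∀ u ∈ S, ‖u‖ * s < 1)
    (hT : ∀ u ∈ T, ‖u‖ * s < 1) :
    HasDetLimit (linProd S * (linProd T)⁻¹) (linProd S * (linProd T)⁻¹)⁻¹
      (crossProd S S * crossProd T T / (crossProd S T * crossProd T S)) := by
  have hWS := isWiener_linProd hs.le hS
  have hWT := isWiener_linProd hs.le hT
  have hne : ∀ {A B : Multiset ℂ}, (∀ u ∈ A, ‖u‖ * s < 1) → (∀ u ∈ B, ‖u‖ * s < 1) →
      (crossProd A B)⁻¹ ≠ 0 := fun hA hB => inv_ne_zero (crossProd_ne_zero hs.le hA hB)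
  have hST := hasDetLimit_linProd hs hS hT
  have hTS := hasDetLimit_linProd hs hT hS
  have hSS := ((hasDetLimit_linProd hs hS hS).inv hs hWS hWS (hne hS hS)).symm
  have hTT := (hasDetLimit_linProd hs hT hT).inv hs hWT hWT (hne hT hT)
  have hTS' := (((hTS.inv hs hWT hWS (hne hT hS)).symm).inv hs hWS hWT.inv
    (inv_ne_zero (hne hT hS))).symm
  have hinv : (linProd S * (linProd T)⁻¹)⁻¹ = linProd T * (linProd S)⁻¹ := by
    rw [PowerSeries.mul_inv_rev, hWT.inv_inv]
  have h1 : HasDetLimit (linProd S) (linProd T * (linProd S)⁻¹)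
      ((crossProd S T)⁻¹ * crossProd S S) := by
    have := (hSS.symm.mul hs hWS.inv hWT hWS hST.symm)
    rw [inv_inv] at this
    exact this.symm
  have h2 : HasDetLimit (linProd T)⁻¹ (linProd T * (linProd S)⁻¹)
      (crossProd T T * (crossProd T S)⁻¹) := by
    have := (hTS'.symm.mul hs hWS.inv hWT hWT.inv hTT.symm)
    rw [inv_inv, inv_inv] at this
    exact this.symm
  rw [hinv]
  have h3 := h2.mul hs hWT.inv hWS (hWT.mul hs.le hWS.inv) h1
  convert h3 using 1
  rw [div_eq_mul_inv, mul_inv]; ring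

/-! ### Square roots of linear factors -/

theorem norm_choose_half_le (k : ℕ) : ‖Ring.choose (1 / 2 : ℂ) k‖ ≤ 1 := by
  have hrec : ∀ k : ℕ, Ring.choose (1 / 2 : ℂ) (k + 1) * ((k : ℂ) + 1) =
      Ring.choose (1 / 2 : ℂ) k * (1 / 2 - k) := by
    intro k
    rw [Ring.choose_eq_smul, Ring.choose_eq_smul, descPochhammer_succ_right,
      Polynomial.smeval_mul, Polynomial.smeval_sub, Polynomial.smeval_X,
      Polynomial.smeval_natCast, Nat.factorial_succ]
    have h1 : ((k : ℂ) + 1) ≠ 0 := by exact_mod_cast k.succ_ne_zero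
    have h2 : (k.factorial : ℂ) ≠ 0 := by exact_mod_cast k.factorial_ne_zero
    simp only [smul_eq_mul, pow_zero, pow_one]
    push_cast
    field_simp
    simp only [one_div]
    ring
  induction k with
  | zero => simp
  | succ k ih =>
    have h := congrArg norm (hrec k)
    rw [norm_mul, norm_mul] at h
    have h1 : ‖(k : ℂ) + 1‖ = (k : ℝ) + 1 := by
      rw [← Nat.cast_succ, Complex.norm_natCast]; push_cast; rfl
    have h2 : ‖(1 / 2 - k : ℂ)‖ ≤ (k : ℝ) + 1 := by
      refine (norm_sub_le _ _).trans ?_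
      rw [Complex.norm_natCast, norm_div]; simp; linarith
    rw [h1] at h
    have h3 : (0 : ℝ) < (k : ℝ) + 1 := by positivity
    refine le_of_mul_le_mul_right ?_ h3
    rw [h, one_mul]
    exact (mul_le_of_le_one_left (norm_nonneg _) ih).trans h2

/-- The square root `(1 - u X)^{1/2}`. -/
noncomputable def sqrtLin (u : ℂ) : ℂ⟦X⟧ := rescale (-u) (PowerSeries.binomialSeries ℂ (1 / 2 : ℂ))

theorem sqrtLin_mul_self (u : ℂ) : sqrtLin u * sqrtLin u = lin u := by
  have h : PowerSeries.binomialSeries ℂ (1 / 2 : ℂ) * PowerSeries.binomialSeries ℂ (1 / 2 : ℂ) = 1 + X := by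
    rw [← binomialSeries_add, show (1 / 2 + 1 / 2 : ℂ) = ((1 : ℕ) : ℂ) by norm_num,
      binomialSeries_nat, pow_one]
  rw [sqrtLin, ← map_mul, h, map_add, map_one, rescale_X, lin, map_neg]
  ring

theorem isWiener_sqrtLin (hs : 1 ≤ s) {u : ℂ} (hu : ‖u‖ * s < 1) : IsWiener s (sqrtLin u) := by
  have hconst : constantCoeff (sqrtLin u) = 1 := by
    rw [← coeff_zero_eq_constantCoeff_apply, sqrtLin, coeff_rescale]; simp
  have hsum : WSummable s (sqrtLin u) := by
    refine Summable.of_nonneg_of_le (fun _ => by positivity) (fun k => ?_)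
      (summable_geometric_of_lt_one (by positivity) hu)
    rw [sqrtLin, coeff_rescale, binomialSeries_coeff, norm_mul, norm_pow, norm_neg, mul_pow,
      smul_eq_mul, mul_one]
    exact mul_le_mul_of_nonneg_right
      (mul_le_of_le_one_right (by positivity) (norm_choose_half_le k)) (by positivity)
  have hlin := isWiener_lin hs hu
  have hinv : (sqrtLin u)⁻¹ = sqrtLin u * (lin u)⁻¹ := by
    rw [PowerSeries.inv_eq_iff_mul_eq_one (by rw [hconst]; exact one_ne_zero), mul_right_comm,
      sqrtLin_mul_self, hlin.mul_inv]
  exact ⟨hconst, hsum, by rw [hinv]; exact hsum.mul hs hlin.sum_inv⟩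

theorem exists_sqrt_linProd (hs : 1 ≤ s) {S : Multiset ℂ} (hS : ∀ u ∈ S, ‖u‖ * s < 1) :
    ∃ q : ℂ⟦X⟧, IsWiener s q ∧ q * q = linProd S := by
  refine ⟨(S.map sqrtLin).prod, isWiener_multiset_prod hs S _
    fun u hu => isWiener_sqrtLin hs (hS u hu), ?_⟩
  rw [← Multiset.prod_map_mul, linProd]
  simp only [sqrtLin_mul_self]

end DetLimit

section Evaluation

open PowerSeries

/-! ### Boundary values of power series -/

variable {s : ℝ} {a b c : ℂ⟦X⟧}

/-- The value `∑ a_k z^k`. -/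
noncomputable def psEval (a : ℂ⟦X⟧) (z : ℂ) : ℂ := ∑' k, coeff k a * z ^ k

theorem summable_norm_psEval (hs : 1 ≤ s) (ha : WSummable s a) {z : ℂ} (hz : ‖z‖ = 1) :
    Summable fun k => ‖coeff k a * z ^ k‖ := by
  simpa [hz] using ha.norm_coeff hs

theorem psEval_mul (hs : 1 ≤ s) (ha : WSummable s a) (hb : WSummable s b) {z : ℂ} (hz : ‖z‖ = 1) :
    psEval (a * b) z = psEval a z * psEval b z := by
  rw [psEval, psEval, psEval, tsum_mul_tsum_eq_tsum_sum_antidiagonal_of_summable_norm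
    (summable_norm_psEval hs ha hz) (summable_norm_psEval hs hb hz)]
  refine tsum_congr fun k => ?_
  rw [coeff_mul, Finset.sum_mul]
  refine Finset.sum_congr rfl fun p hp => ?_
  rw [← Finset.HasAntidiagonal.mem_antidiagonal.1 hp, pow_add]; ring

theorem psEval_one (z : ℂ) : psEval 1 z = 1 := by
  rw [psEval, tsum_eq_single 0]
  · simp
  · intro k hk; rw [coeff_one, if_neg hk, zero_mul]

theorem psEval_lin (u z : ℂ) : psEval (lin u) z = 1 - u * z := by
  rw [psEval, tsum_eq_sum (s := Finset.range 2)]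
  · simp [Finset.sum_range_succ, lin, sub_eq_add_neg]
  · intro k hk
    rw [coeff_lin_of_two_le u (by rw [Finset.mem_range] at hk; omega), zero_mul]

theorem psEval_linProd (hs : 1 ≤ s) {S : Multiset ℂ} (hS : ∀ u ∈ S, ‖u‖ * s < 1) {z : ℂ}
    (hz : ‖z‖ = 1) : psEval (linProd S) z = (S.map fun u => 1 - u * z).prod := by
  induction S using Multiset.induction_on with
  | empty => simp [linProd, psEval_one]
  | cons u S ih =>
    have hS' : ∀ v ∈ S, ‖v‖ * s < 1 := fun v hv => hS v (Multiset.mem_cons_of_mem hv)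
    have h : linProd (u ::ₘ S) = lin u * linProd S := by simp [linProd]
    rw [h, psEval_mul hs (isWiener_lin hs (hS u (Multiset.mem_cons_self u S))).sum
      (isWiener_linProd hs hS').sum hz, ih hS', psEval_lin, Multiset.map_cons, Multiset.prod_cons]

theorem psEval_mul_psEval_inv (hs : 1 ≤ s) (ha : IsWiener s a) {z : ℂ} (hz : ‖z‖ = 1) :
    psEval a z * psEval a⁻¹ z = 1 := by
  rw [← psEval_mul hs ha.sum ha.sum_inv hz, ha.mul_inv, psEval_one]

theorem psEval_ne_zero (hs : 1 ≤ s) (ha : IsWiener s a) {z : ℂ} (hz : ‖z‖ = 1) :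
    psEval a z ≠ 0 := left_ne_zero_of_mul_eq_one (psEval_mul_psEval_inv hs ha hz)

theorem continuousOn_psEval (hs : 1 ≤ s) (ha : WSummable s a) :
    ContinuousOn (psEval a) (Metric.sphere 0 1) :=
  continuousOn_tsum (fun k => (continuous_const.mul (continuous_pow k)).continuousOn)
    (ha.norm_coeff hs) fun k z hz => by
      rw [mem_sphere_zero_iff_norm] at hz
      simp [hz]

theorem exists_radius (S : Multiset ℂ) (hS : ∀ u ∈ S, ‖u‖ < 1) :
    ∃ s : ℝ, 1 < s ∧ ∀ u ∈ S, ‖u‖ * s < 1 := by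
  induction S using Multiset.induction_on with
  | empty => exact ⟨2, by norm_num, by simp⟩
  | cons u S ih =>
    obtain ⟨r, hr, h⟩ := ih fun v hv => hS v (Multiset.mem_cons_of_mem hv)
    have hu := hS u (Multiset.mem_cons_self u S)
    have h0 : 0 < 1 + ‖u‖ := by positivity
    refine ⟨min r (2 / (1 + ‖u‖)), lt_min hr ?_, fun v hv => ?_⟩
    · rw [lt_div_iff₀ h0]; linarith
    · rcases Multiset.mem_cons.1 hv with rfl | hv
      · refine (mul_le_mul_of_nonneg_left (min_le_right _ _) (norm_nonneg v)).trans_lt ?_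
        rw [mul_div_assoc', div_lt_one h0]; linarith
      · exact (mul_le_mul_of_nonneg_left (min_le_left _ _) (norm_nonneg v)).trans_lt (h v hv)

end Evaluation

section SymbolFactorization

open PowerSeries

/-! ### Factorization of the symbol on the unit circle -/

variable {t : ℤ →₀ ℝ}

theorem numerator_ne_zero (ht : t ≠ 0) : numerator t ≠ 0 := by
  obtain ⟨α, hα⟩ := Finsupp.support_nonempty_iff.2 ht
  intro h0
  have hle : ∀ β ∈ t.support, 0 ≤ β + (poleOrder t : ℤ) := fun β hβ => by
    have : (-β).toNat ≤ poleOrder t := Finset.le_sup (f := fun α : ℤ => (-α).toNat) hβ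
    omega
  have h := congrArg (fun p : Polynomial ℂ => p.coeff (α + (poleOrder t : ℤ)).toNat) h0
  simp only [numerator, Polynomial.finsetSum_coeff, Polynomial.coeff_C_mul, Polynomial.coeff_X_pow,
    Polynomial.coeff_zero] at h
  rw [Finset.sum_eq_single α] at h
  · simp only [if_true, mul_one, Complex.ofReal_eq_zero] at h
    exact Finsupp.mem_support_iff.1 hα h
  · intro β hβ hne
    have h1 := hle β hβ
    have h2 := hle α hα
    rw [if_neg (by omega), mul_zero]
  · intro h'; exact absurd hα h'

theorem zerosOn_eq_zero (hc : centralCharge t = 0) : zerosOn t = 0 := by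
  rw [centralCharge, div_eq_zero_iff] at hc
  rcases hc with h | h
  · exact Multiset.card_eq_zero.1 (by exact_mod_cast h)
  · norm_num at h

theorem symbol_ne_zero (ht : t ≠ 0) (hc : centralCharge t = 0) {z : ℂ} (hz : ‖z‖ = 1) :
    symbol t z ≠ 0 := by
  intro h
  have hz0 : z ≠ 0 := norm_ne_zero_iff.1 (by rw [hz]; exact one_ne_zero)
  have h1 : z ∈ zerosOn t := by
    rw [zerosOn, Multiset.mem_filter, zeros, Polynomial.mem_roots (numerator_ne_zero ht),
      Polynomial.IsRoot.def, eval_numerator t hz0, h, mul_zero]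
    exact ⟨rfl, hz⟩
  rw [zerosOn_eq_zero hc] at h1
  exact Multiset.notMem_zero z h1

theorem zeros_eq_add (hc : centralCharge t = 0) : zeros t = zerosIn t + zerosOut t := by
  rw [zerosIn, zerosOut]
  conv_lhs => rw [← Multiset.filter_add_not (fun z : ℂ => ‖z‖ < 1) (zeros t)]
  congr 1
  refine Multiset.filter_congr fun z hz => ?_
  have h : ‖z‖ ≠ 1 := fun h => by
    have : z ∈ zerosOn t := Multiset.mem_filter.2 ⟨hz, h⟩
    rw [zerosOn_eq_zero hc] at this
    exact Multiset.notMem_zero z this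
  exact ⟨fun h1 => lt_of_le_of_ne (not_lt.1 h1) h.symm, fun h1 => not_lt.2 h1.le⟩

/-- The inverses `1 / Z_j` of the zeros outside the unit circle. -/
noncomputable def invZerosOut (t : ℤ →₀ ℝ) : Multiset ℂ := (zerosOut t).map fun z => z⁻¹

theorem norm_lt_one_of_mem_zerosIn {z : ℂ} (h : z ∈ zerosIn t) : ‖z‖ < 1 :=
  (Multiset.mem_filter.1 h).2

theorem one_lt_norm_of_mem_zerosOut {z : ℂ} (h : z ∈ zerosOut t) : 1 < ‖z‖ :=
  (Multiset.mem_filter.1 h).2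

theorem ne_zero_of_mem_zerosOut {z : ℂ} (h : z ∈ zerosOut t) : z ≠ 0 :=
  norm_pos_iff.1 (zero_lt_one.trans (one_lt_norm_of_mem_zerosOut h))

theorem norm_lt_one_of_mem_invZerosOut {z : ℂ} (h : z ∈ invZerosOut t) : ‖z‖ < 1 := by
  obtain ⟨w, hw, rfl⟩ := Multiset.mem_map.1 h
  rw [norm_inv]
  exact inv_lt_one_of_one_lt₀ (one_lt_norm_of_mem_zerosOut hw)

theorem exists_symbol_eq (hc : centralCharge t = 0) : ∃ κ : ℂ, ∀ z : ℂ, ‖z‖ = 1 →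
    symbol t z = κ * z ^ windingNumber t * ((zerosIn t).map fun u => 1 - u * z⁻¹).prod *
      ((invZerosOut t).map fun u => 1 - u * z).prod := by
  refine ⟨(numerator t).leadingCoeff * ((zerosOut t).map fun u => -u).prod, fun z hz => ?_⟩
  have hz0 : z ≠ 0 := norm_ne_zero_iff.1 (by rw [hz]; exact one_ne_zero)
  have h1 := eval_numerator t hz0
  have h2 : (numerator t).eval z = (numerator t).leadingCoeff *
      (((zerosIn t).map fun u => z - u).prod * ((zerosOut t).map fun u => z - u).prod) := by
    conv_lhs => rw [(IsAlgClosed.splits (numerator t)).eq_prod_roots]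
    rw [Polynomial.eval_mul, Polynomial.eval_C, Polynomial.eval_multiset_prod, Multiset.map_map]
    change _ * ((zeros t).map _).prod = _
    rw [zeros_eq_add hc, Multiset.map_add, Multiset.prod_add]
    simp
  have h3 : ((zerosIn t).map fun u => z - u).prod =
      z ^ (zerosIn t).card * ((zerosIn t).map fun u => 1 - u * z⁻¹).prod := by
    rw [← Multiset.prod_replicate, ← Multiset.map_const', ← Multiset.prod_map_mul]
    congr 1
    refine Multiset.map_congr rfl fun u _ => ?_
    field_simp
  have h4 : ((zerosOut t).map fun u => z - u).prod =
      ((zerosOut t).map fun u => -u).prod * ((invZerosOut t).map fun u => 1 - u * z).prod := by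
    rw [invZerosOut, Multiset.map_map, ← Multiset.prod_map_mul]
    congr 1
    refine Multiset.map_congr rfl fun u hu => ?_
    have := ne_zero_of_mem_zerosOut hu
    simp only [Function.comp_apply]
    field_simp
    ring
  rw [h2, h3, h4] at h1
  have h5 : z ^ windingNumber t * z ^ poleOrder t = z ^ (zerosIn t).card := by
    rw [windingNumber, zpow_sub₀ hz0, zpow_natCast, zpow_natCast,
      div_mul_cancel₀ _ (pow_ne_zero _ hz0)]
  refine mul_left_cancel₀ (pow_ne_zero (poleOrder t) hz0) ?_
  rw [← h1, ← h5]
  ring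

theorem continuousOn_phase (hf : ∀ z : ℂ, ‖z‖ = 1 → symbol t z ≠ 0) :
    ContinuousOn (phase t) (Metric.sphere 0 1) := by
  have h : ContinuousOn (symbol t) (Metric.sphere 0 1) := by
    refine continuousOn_finsetSum _ fun α _ => continuousOn_const.mul ?_
    refine continuousOn_id.zpow₀ α fun z hz => Or.inl ?_
    rw [mem_sphere_zero_iff_norm] at hz
    exact norm_ne_zero_iff.1 (by rw [id, hz]; exact one_ne_zero)
  refine h.div (Complex.continuous_ofReal.comp_continuousOn h.norm) fun z hz => ?_
  rw [mem_sphere_zero_iff_norm] at hz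
  exact_mod_cast norm_ne_zero_iff.2 (hf z hz)

/-- The coefficients of `f` are real, so that `|f(z)|² = f(z) f(1/z)` on the unit circle. -/
theorem phase_sq (t : ℤ →₀ ℝ) {z : ℂ} (hz : ‖z‖ = 1) (hf : symbol t z ≠ 0) :
    phase t z ^ 2 = symbol t z / symbol t z⁻¹ := by
  have h1 : (‖symbol t z‖ : ℂ) ≠ 0 := by exact_mod_cast norm_ne_zero_iff.2 hf
  have h2 : symbol t z * symbol t z⁻¹ = (‖symbol t z‖ : ℂ) ^ 2 := by
    rw [symbol_inv_of_norm_eq_one t hz, Complex.mul_conj, Complex.normSq_eq_norm_sq]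
    push_cast; ring
  have h3 : symbol t z⁻¹ ≠ 0 := by
    intro h; rw [h, mul_zero] at h2; exact pow_ne_zero 2 h1 h2.symm
  rw [phase, div_pow, ← h2]
  field_simp

/-- Up to a global sign the phase of `f` is `z^ω g(z) / g(1/z)`, where
`g² = ∏ (1 - z/Z_j) / ∏ (1 - z_i z)`. -/
theorem exists_phase_factorization (ht : t ≠ 0) (hc : centralCharge t = 0) :
    ∃ s : ℝ, 1 < s ∧ (∀ u ∈ invZerosOut t, ‖u‖ * s < 1) ∧ (∀ u ∈ zerosIn t, ‖u‖ * s < 1) ∧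
      ∃ g : ℂ⟦X⟧, IsWiener s g ∧ g * g = linProd (invZerosOut t) * (linProd (zerosIn t))⁻¹ ∧
        ∃ σ : ℂ, σ * σ = 1 ∧ ∀ z : ℂ, ‖z‖ = 1 →
          phase t z = σ * (z ^ windingNumber t * (psEval g z * psEval g⁻¹ z⁻¹)) := by
  obtain ⟨s, hs, hST⟩ := exists_radius (invZerosOut t + zerosIn t) fun u hu =>
    (Multiset.mem_add.1 hu).elim norm_lt_one_of_mem_invZerosOut norm_lt_one_of_mem_zerosIn
  have hS : ∀ u ∈ invZerosOut t, ‖u‖ * s < 1 := fun u hu => hST u (Multiset.mem_add.2 (Or.inl hu))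
  have hT : ∀ u ∈ zerosIn t, ‖u‖ * s < 1 := fun u hu => hST u (Multiset.mem_add.2 (Or.inr hu))
  have hs1 := hs.le
  obtain ⟨p, hp, hpp⟩ := exists_sqrt_linProd hs1 hS
  obtain ⟨q, hq, hqq⟩ := exists_sqrt_linProd hs1 hT
  have hg := hp.mul hs1 hq.inv
  set g := p * q⁻¹ with hgdef
  have hgg : g * g = linProd (invZerosOut t) * (linProd (zerosIn t))⁻¹ := by
    rw [← hpp, ← hqq, PowerSeries.mul_inv_rev, hgdef]; ring
  refine ⟨s, hs, hS, hT, g, hg, hgg, ?_⟩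
  have hinv : ∀ z : ℂ, ‖z‖ = 1 → ‖z⁻¹‖ = 1 := fun z hz => by rw [norm_inv, hz, inv_one]
  have hne : ∀ z : ℂ, ‖z‖ = 1 → z ≠ 0 := fun z hz =>
    norm_ne_zero_iff.1 (by rw [hz]; exact one_ne_zero)
  have hWT := isWiener_linProd hs1 hT
  have hWS := isWiener_linProd hs1 hS
  have hsq : ∀ z : ℂ, ‖z‖ = 1 → psEval g z ^ 2 * psEval (linProd (zerosIn t)) z =
      psEval (linProd (invZerosOut t)) z := by
    intro z hz
    rw [sq, ← psEval_mul hs1 hg.sum hg.sum hz, hgg, psEval_mul hs1 hWS.sum hWT.sum_inv hz, mul_assoc,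
      mul_comm (psEval _⁻¹ z), psEval_mul_psEval_inv hs1 hWT hz, mul_one]
  obtain ⟨κ, hκ⟩ := exists_symbol_eq hc
  set F : ℂ → ℂ := fun z => z ^ windingNumber t * (psEval g z * psEval g⁻¹ z⁻¹) with hF
  have hFne : ∀ z : ℂ, ‖z‖ = 1 → F z ≠ 0 := fun z hz =>
    mul_ne_zero (zpow_ne_zero _ (hne z hz))
      (mul_ne_zero (psEval_ne_zero hs1 hg hz) (psEval_ne_zero hs1 hg.inv (hinv z hz)))
  have hsqF : ∀ z : ℂ, ‖z‖ = 1 → phase t z ^ 2 = F z ^ 2 := by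
    intro z hz
    have hf := symbol_ne_zero ht hc hz
    have hf' := symbol_ne_zero ht hc (hinv z hz)
    rw [phase_sq t hz hf, div_eq_iff hf']
    have e1 := hsq z hz
    have e2 := hsq z⁻¹ (hinv z hz)
    have e3 := psEval_mul_psEval_inv hs1 hg (hinv z hz)
    have e4 := hκ z hz
    have e5 := hκ z⁻¹ (hinv z hz)
    rw [inv_inv, ← psEval_linProd hs1 hT hz, ← psEval_linProd hs1 hS (hinv z hz), ← e2] at e5
    rw [← psEval_linProd hs1 hT (hinv z hz), ← psEval_linProd hs1 hS hz, ← e1] at e4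
    rw [e4, e5]
    have e6 : z ^ windingNumber t * z⁻¹ ^ windingNumber t = 1 := by
      rw [← mul_zpow, mul_inv_cancel₀ (hne z hz), one_zpow]
    have e7 : F z = z ^ windingNumber t * (psEval g z * psEval g⁻¹ z⁻¹) := rfl
    rw [e7]
    generalize z⁻¹ ^ windingNumber t = w' at *
    generalize z ^ windingNumber t = w at *
    generalize psEval g z = x at *
    generalize psEval g z⁻¹ = y at *
    generalize psEval g⁻¹ z⁻¹ = y' at *
    generalize psEval (linProd (zerosIn t)) z = A at *
    generalize psEval (linProd (zerosIn t)) z⁻¹ = B at *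
    calc κ * w * B * (x ^ 2 * A) = κ * w * B * (x ^ 2 * A) * (w * w') * (y * y') ^ 2 := by
          rw [e3, e6]; ring
      _ = _ := by ring
  have hcF : ContinuousOn F (Metric.sphere 0 1) := by
    have hmaps : Set.MapsTo (fun z : ℂ => z⁻¹) (Metric.sphere 0 1) (Metric.sphere 0 1) :=
      fun z hz => by
        rw [mem_sphere_zero_iff_norm] at hz ⊢; exact hinv z hz
    have hcinv : ContinuousOn (fun z : ℂ => z⁻¹) (Metric.sphere 0 1) :=
      continuousOn_inv₀.mono fun z hz => by
        rw [mem_sphere_zero_iff_norm] at hz; exact hne z hz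
    refine (continuousOn_id.zpow₀ _ fun z hz => Or.inl ?_).mul
      ((continuousOn_psEval hs1 hg.sum).mul
        ((continuousOn_psEval hs1 hg.sum_inv).comp hcinv hmaps))
    rw [mem_sphere_zero_iff_norm] at hz; exact hne z hz
  -- Two continuous functions with equal squares and no zeros on a connected set agree up to a sign.
  have hconn : IsPreconnected (Metric.sphere (0 : ℂ) 1) :=
    isPreconnected_sphere (by rw [Complex.rank_real_complex]; norm_num) 0 1
  rcases hconn.eq_or_eq_neg_of_sq_eq
    (continuousOn_phase fun z hz => symbol_ne_zero ht hc hz) hcF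
    (fun z hz => hsqF z (mem_sphere_zero_iff_norm.1 hz))
    (fun {z} hz => hFne z (mem_sphere_zero_iff_norm.1 hz)) with h | h
  · refine ⟨1, one_mul 1, fun z hz => ?_⟩
    rw [h (mem_sphere_zero_iff_norm.2 hz), one_mul]
  · refine ⟨-1, by norm_num, fun z hz => ?_⟩
    rw [h (mem_sphere_zero_iff_norm.2 hz), neg_one_mul]; rfl

end SymbolFactorization

section FiniteChain

open PowerSeries

/-! ### Comparison of the finite chain with its thermodynamic limit -/

variable {s : ℝ} {a c : ℂ⟦X⟧}

theorem summable_norm_coeff_mul_coeff (hs : 1 ≤ s) (ha : WSummable s a) (hc : WSummable s c) :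
    Summable fun x : ℕ × ℕ => ‖coeff x.1 a * coeff x.2 c‖ :=
  Summable.mul_norm (f := fun k => coeff k a) (g := fun k => coeff k c) (ha.norm_coeff hs)
    (hc.norm_coeff hs)

theorem summable_coeff_mul_ite (hs : 1 ≤ s) (ha : WSummable s a) (hc : WSummable s c)
    (P : ℕ × ℕ → Prop) [DecidablePred P] :
    Summable fun x : ℕ × ℕ => if P x then coeff x.1 a * coeff x.2 c else 0 :=
  Summable.of_norm_bounded (summable_norm_coeff_mul_coeff hs ha hc) fun x => by
    split_ifs
    · exact le_rfl
    · rw [norm_zero]; exact norm_nonneg _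

/-- The Toeplitz entries as the convolution of the coefficients. -/
theorem toep_eq_tsum_prod (hs : 1 ≤ s) (ha : WSummable s a) (hc : WSummable s c) (j k : ℕ) :
    toep a c j k = ∑' x : ℕ × ℕ, if x.1 + j = x.2 + k then coeff x.1 a * coeff x.2 c else 0 := by
  rw [(summable_coeff_mul_ite hs ha hc fun x => x.1 + j = x.2 + k).tsum_prod, toep,
    ← (add_right_injective j).tsum_eq (f := fun l => up a j l * up c k l)]
  · refine tsum_congr fun p => ?_
    simp only [up_add]
    rcases lt_or_ge (j + p) k with h | h
    · rw [up_of_lt c h, mul_zero]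
      symm
      refine (tsum_congr fun q => ?_).trans tsum_zero
      rw [if_neg (by omega)]
    · rw [up_of_le c h, tsum_eq_single (j + p - k), if_pos (by omega)]
      intro q hq
      rw [if_neg (by omega)]
  · intro l hl
    by_contra h
    refine hl ?_
    have : l < j := by
      by_contra h'
      exact h ⟨l - j, by simp; omega⟩
    simp [up_of_lt a this]

/-- The Fourier coefficients on the finite chain are those of the infinite chain, folded modulo
`L`. -/
theorem phaseCoeff_eq_tsum {t : ℤ →₀ ℝ} {ω : ℤ} {σ : ℂ} (hs : 1 ≤ s) (ha : WSummable s a)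
    (hc : WSummable s c)
    (hphase : ∀ z : ℂ, ‖z‖ = 1 → phase t z = σ * (z ^ ω * (psEval a z * psEval c z⁻¹)))
    (L : ℕ) [NeZero L] (d : ℤ) :
    phaseCoeff t ((d + ω : ℤ) : ZMod L) = σ * ∑' x : ℕ × ℕ,
      if ((x.1 : ℤ) : ZMod L) - ((x.2 : ℤ) : ZMod L) = (d : ZMod L) then
        coeff x.1 a * coeff x.2 c else 0 := by
  have hL : (L : ℂ) ≠ 0 := by exact_mod_cast NeZero.ne L
  have hterm : ∀ k : ZMod L, HasSum (fun x : ℕ × ℕ => σ * (coeff x.1 a * coeff x.2 c *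
      ZMod.stdAddChar (k * (((x.1 : ℤ) : ZMod L) - ((x.2 : ℤ) : ZMod L) - (d : ZMod L)))))
      (ZMod.stdAddChar (-(k * ((d + ω : ℤ) : ZMod L))) * phase t (ZMod.stdAddChar k)) := by
    intro k
    set z : ℂ := ZMod.stdAddChar k with hz
    have hz1 : ‖z‖ = 1 := norm_addChar_eq_one _ _
    have hz1' : ‖z⁻¹‖ = 1 := by rw [norm_inv, hz1, inv_one]
    have hz0 : z ≠ 0 := norm_ne_zero_iff.1 (by rw [hz1]; exact one_ne_zero)
    have hpow : ∀ m : ℤ, (ZMod.stdAddChar (k * (m : ZMod L)) : ℂ) = z ^ m := fun m => by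
      rw [hz, mul_comm, ← zsmul_eq_mul, AddChar.map_zsmul_eq_zpow]
    have h1 := summable_norm_psEval hs ha hz1
    have h2 := summable_norm_psEval hs hc hz1'
    have h3 : HasSum (fun x : ℕ × ℕ => (coeff x.1 a * z ^ x.1) * (coeff x.2 c * z⁻¹ ^ x.2))
        (psEval a z * psEval c z⁻¹) :=
      HasSum.mul (f := fun p => coeff p a * z ^ p) (g := fun q => coeff q c * z⁻¹ ^ q)
        h1.of_norm.hasSum h2.of_norm.hasSum (summable_mul_of_summable_norm
          (f := fun p => coeff p a * z ^ p) (g := fun q => coeff q c * z⁻¹ ^ q) h1 h2)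
    have h4 := h3.mul_left (σ * z ^ (-d))
    have e1 : (ZMod.stdAddChar (-(k * ((d + ω : ℤ) : ZMod L))) : ℂ) * phase t z =
        σ * z ^ (-d) * (psEval a z * psEval c z⁻¹) := by
      rw [hphase z hz1, ← mul_neg, ← Int.cast_neg, hpow, neg_add, zpow_add₀ hz0, zpow_neg z ω]
      have := zpow_ne_zero ω hz0
      field_simp
    rw [e1]
    have e2 : ∀ x : ℕ × ℕ, σ * (coeff x.1 a * coeff x.2 c *
        ZMod.stdAddChar (k * (((x.1 : ℤ) : ZMod L) - ((x.2 : ℤ) : ZMod L) - (d : ZMod L)))) =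
        σ * z ^ (-d) * (coeff x.1 a * z ^ x.1 * (coeff x.2 c * z⁻¹ ^ x.2)) := fun x => by
      rw [← Int.cast_sub, ← Int.cast_sub, hpow, sub_eq_add_neg ((x.1 : ℤ) - x.2), zpow_add₀ hz0,
        zpow_sub₀ hz0, zpow_natCast, zpow_natCast, inv_pow, div_eq_mul_inv]
      ring
    rw [funext e2]
    exact h4
  have hsum := (hasSum_sum fun k (_ : k ∈ Finset.univ) => hterm k).mul_left (L : ℂ)⁻¹
  rw [phaseCoeff, ← hsum.tsum_eq, ← tsum_mul_left]
  refine tsum_congr fun x => ?_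
  rw [← Finset.mul_sum, ← Finset.mul_sum, sum_stdAddChar_mul]
  simp only [sub_eq_zero (b := (d : ZMod L))]
  split_ifs
  · field_simp
  · simp

/-- Folding changes a Fourier coefficient by an exponentially small amount. -/
theorem norm_phaseCoeff_sub_toep_le {t : ℤ →₀ ℝ} {ω : ℤ} {σ : ℂ} (hs : 1 ≤ s)
    (ha : WSummable s a) (hc : WSummable s c) (hσ : ‖σ‖ = 1)
    (hphase : ∀ z : ℂ, ‖z‖ = 1 → phase t z = σ * (z ^ ω * (psEval a z * psEval c z⁻¹)))
    (L : ℕ) [NeZero L] {N : ℕ} (hNL : N ≤ L) (j k : Fin N) :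
    ‖phaseCoeff t ((((k : ℕ) : ℤ) - ((j : ℕ) : ℤ) + ω : ℤ) : ZMod L) - σ * toep a c j k‖ ≤
      wnorm s a * wnorm s c * s⁻¹ ^ (L - N) := by
  have h0 : (0 : ℝ) < s := zero_lt_one.trans_le hs
  rw [phaseCoeff_eq_tsum hs ha hc hphase, toep_eq_tsum_prod hs ha hc, ← mul_sub, norm_mul, hσ,
    one_mul, ← Summable.tsum_sub (summable_coeff_mul_ite hs ha hc _)
      (summable_coeff_mul_ite hs ha hc _)]
  have hprod : HasSum (fun x : ℕ × ℕ => (‖coeff x.1 a‖ * s ^ x.1) * (‖coeff x.2 c‖ * s ^ x.2))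
      (wnorm s a * wnorm s c) :=
    HasSum.mul (f := fun p => ‖coeff p a‖ * s ^ p) (g := fun q => ‖coeff q c‖ * s ^ q)
      (Summable.hasSum ha) (Summable.hasSum hc)
      (Summable.mul_of_nonneg (f := fun p => ‖coeff p a‖ * s ^ p)
        (g := fun q => ‖coeff q c‖ * s ^ q) ha hc (fun _ => by positivity)
        (fun _ => by positivity))
  refine tsum_of_norm_bounded (hprod.mul_right (s⁻¹ ^ (L - N))) fun x => ?_
  have hpos : 0 ≤ ‖coeff x.1 a‖ * s ^ x.1 * (‖coeff x.2 c‖ * s ^ x.2) * s⁻¹ ^ (L - N) := by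
    positivity
  have hcong : ((x.1 : ℤ) : ZMod L) - ((x.2 : ℤ) : ZMod L) =
      ((((k : ℕ) : ℤ) - ((j : ℕ) : ℤ) : ℤ) : ZMod L) ↔
        (L : ℤ) ∣ ((x.1 : ℤ) - x.2) - (((k : ℕ) : ℤ) - ((j : ℕ) : ℤ)) := by
    rw [← Int.cast_sub, ← sub_eq_zero, ← Int.cast_sub, ZMod.intCast_zmod_eq_zero_iff_dvd]
  by_cases h1 : x.1 + (j : ℕ) = x.2 + (k : ℕ)
  · have h2 : (L : ℤ) ∣ ((x.1 : ℤ) - x.2) - (((k : ℕ) : ℤ) - ((j : ℕ) : ℤ)) := by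
      have : ((x.1 : ℤ) - x.2) - (((k : ℕ) : ℤ) - ((j : ℕ) : ℤ)) = 0 := by omega
      rw [this]; exact dvd_zero _
    rw [if_pos (hcong.2 h2), if_pos h1, sub_self, norm_zero]
    exact hpos
  · rw [if_neg h1, sub_zero]
    split_ifs with h2
    · rw [hcong] at h2
      have h3 : (L : ℤ) ≤ |((x.1 : ℤ) - x.2) - (((k : ℕ) : ℤ) - ((j : ℕ) : ℤ))| :=
        Int.le_of_dvd (abs_pos.2 (by omega)) ((dvd_abs _ _).2 h2)
      have hj := j.2
      have hk := k.2
      have h4 : L - N ≤ x.1 + x.2 := by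
        rcases abs_cases (((x.1 : ℤ) - x.2) - (((k : ℕ) : ℤ) - ((j : ℕ) : ℤ))) with h | h <;> omega
      have h5 : 1 ≤ s ^ (x.1 + x.2) * s⁻¹ ^ (L - N) := by
        rw [inv_pow, ← div_eq_mul_inv, one_le_div (by positivity)]
        exact pow_le_pow_right₀ hs h4
      calc ‖coeff x.1 a * coeff x.2 c‖ = ‖coeff x.1 a‖ * ‖coeff x.2 c‖ * 1 := by
            rw [norm_mul, mul_one]
        _ ≤ ‖coeff x.1 a‖ * ‖coeff x.2 c‖ * (s ^ (x.1 + x.2) * s⁻¹ ^ (L - N)) :=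
            mul_le_mul_of_nonneg_left h5 (by positivity)
        _ = _ := by rw [pow_add]; ring
    · rw [norm_zero]; exact hpos

attribute [local instance] Matrix.linftyOpNormedRing

/-- The matrix of contractions on `N` sites of the chain with `L` sites. -/
noncomputable def chainMat (t : ℤ →₀ ℝ) (ω : ℤ) (N L : ℕ) [NeZero L] :
    Matrix (Fin N) (Fin N) ℂ :=
  Matrix.of fun a b => phaseCoeff t ((((b : ℕ) : ℤ) - ((a : ℕ) : ℤ) + ω : ℤ) : ZMod L)

theorem conj_det_chainMat (t : ℤ →₀ ℝ) (ω : ℤ) (N L : ℕ) [NeZero L] :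
    (starRingEnd ℂ) (chainMat t ω N L).det = (chainMat t ω N L).det := by
  rw [RingHom.map_det]
  congr 1
  ext i j
  exact conj_phaseCoeff t _

/-- A bound for the rows of all Toeplitz matrices of the symbol `a(z) c(1/z)`. -/
noncomputable def toepBound (s : ℝ) (a c : ℂ⟦X⟧) : ℝ :=
  wnorm s c * (1 + cornerBound s a c) * wnorm s a

theorem toepBound_nonneg (hs : 1 ≤ s) (a c : ℂ⟦X⟧) : 0 ≤ toepBound s a c :=
  mul_nonneg (mul_nonneg (wnorm_nonneg hs _) (add_nonneg zero_le_one (cornerBound_nonneg hs _ _)))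
    (wnorm_nonneg hs _)

theorem norm_toepMat_le (hs : 1 ≤ s) (ha : IsWiener s a) (hc : IsWiener s c) (n : ℕ) :
    ‖toepMat n a c‖ ≤ toepBound s a c := by
  have h1 : ‖(1 : Matrix (Fin n) (Fin n) ℂ) + corner n a c‖ ≤ 1 + cornerBound s a c :=
    (norm_add_le _ _).trans (add_le_add linfty_norm_one_le (norm_corner_le hs ha hc))
  rw [toepMat_eq_corner hs ha hc]
  refine (norm_mul_le _ _).trans (mul_le_mul ((norm_mul_le _ _).trans (mul_le_mul
    (norm_upMat_transpose_le hs hc.sum) h1 (norm_nonneg _) (wnorm_nonneg hs _)))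
    (norm_upMat_le hs ha.sum) (norm_nonneg _) (mul_nonneg (wnorm_nonneg hs _)
      (add_nonneg zero_le_one (cornerBound_nonneg hs _ _))))

theorem norm_det_chainMat_sub_le {t : ℤ →₀ ℝ} {ω : ℤ} {σ : ℂ} (hs : 1 ≤ s)
    (ha : IsWiener s a) (hc : IsWiener s c) (hσ : ‖σ‖ = 1)
    (hphase : ∀ z : ℂ, ‖z‖ = 1 → phase t z = σ * (z ^ ω * (psEval a z * psEval c z⁻¹)))
    (L : ℕ) [NeZero L] {N : ℕ} (hNL : N ≤ L) :
    ‖(chainMat t ω N L).det - σ ^ N * (toepMat N a c).det‖ ≤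
      N * (N * (wnorm s a * wnorm s c * s⁻¹ ^ (L - N))) *
        (1 + toepBound s a c + N * (wnorm s a * wnorm s c * s⁻¹ ^ (L - N))) ^ N := by
  have h0 : (0 : ℝ) < s := zero_lt_one.trans_le hs
  set ε := wnorm s a * wnorm s c * s⁻¹ ^ (L - N) with hε
  have hε0 : 0 ≤ ε := mul_nonneg (mul_nonneg (wnorm_nonneg hs _) (wnorm_nonneg hs _))
    (by positivity)
  have hB := toepBound_nonneg hs a c
  have hdet : σ ^ N * (toepMat N a c).det = (σ • toepMat N a c).det := by
    rw [Matrix.det_smul, Fintype.card_fin]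
  have hdiff : ∀ j, ∑ k, ‖chainMat t ω N L j k - (σ • toepMat N a c) j k‖ ≤ N * ε := by
    intro j
    calc ∑ k, ‖chainMat t ω N L j k - (σ • toepMat N a c) j k‖ ≤ ∑ _k : Fin N, ε :=
          Finset.sum_le_sum fun k _ =>
            norm_phaseCoeff_sub_toep_le hs ha.sum hc.sum hσ hphase L hNL j k
      _ = N * ε := by simp
  have hrow : ∀ j, ∑ k, ‖(σ • toepMat N a c) j k‖ ≤ toepBound s a c := by
    intro j
    simp only [Matrix.smul_apply, smul_eq_mul, norm_mul, hσ, one_mul]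
    exact (sum_row_le_linfty_norm _ j).trans (norm_toepMat_le hs ha hc N)
  have hNε : 0 ≤ (N : ℝ) * ε := by positivity
  have h := norm_det_sub_det_le (chainMat t ω N L) (σ • toepMat N a c)
    (fun _ => 1 + toepBound s a c + N * ε) (N * ε) (fun _ => by linarith) (fun j => ?_)
    (fun j => (hrow j).trans (by linarith)) hdiff
  · rw [hdet]
    simpa using h
  · have h1 : ∀ k, ‖chainMat t ω N L j k‖ ≤
        ‖(σ • toepMat N a c) j k‖ + ‖chainMat t ω N L j k - (σ • toepMat N a c) j k‖ := fun k => by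
      have := norm_add_le ((σ • toepMat N a c) j k)
        (chainMat t ω N L j k - (σ • toepMat N a c) j k)
      rwa [add_sub_cancel] at this
    have h2 := Finset.sum_le_sum fun k (_ : k ∈ Finset.univ) => h1 k
    rw [Finset.sum_add_distrib] at h2
    have := hrow j
    have := hdiff j
    linarith

theorem tendsto_det_chainMat {t : ℤ →₀ ℝ} {ω : ℤ} {σ : ℂ} (hs : 1 < s)
    (ha : IsWiener s a) (hc : IsWiener s c) (hσ : ‖σ‖ = 1)
    (hphase : ∀ z : ℂ, ‖z‖ = 1 → phase t z = σ * (z ^ ω * (psEval a z * psEval c z⁻¹))) (N : ℕ) :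
    Tendsto (fun L : ℕ+ => (chainMat t ω N (L : ℕ)).det) atTop
      (𝓝 (σ ^ N * (toepMat N a c).det)) := by
  have hr0 : 0 ≤ s⁻¹ := inv_nonneg.2 (zero_le_one.trans hs.le)
  have hLtop : Tendsto (fun L : ℕ+ => (L : ℕ)) atTop atTop :=
    PNat.tendsto_comp_val_iff.2 tendsto_id
  have hpow : Tendsto (fun L : ℕ+ => s⁻¹ ^ ((L : ℕ) - N)) atTop (𝓝 0) :=
    (tendsto_pow_atTop_nhds_zero_of_lt_one hr0 (inv_lt_one_of_one_lt₀ hs)).comp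
      ((tendsto_sub_atTop_nat N).comp hLtop)
  have hε := (hpow.const_mul (wnorm s a * wnorm s c)).const_mul (N : ℝ)
  have hbound := (hε.const_mul (N : ℝ)).mul ((hε.const_add (1 + toepBound s a c)).pow N)
  simp only [mul_zero, zero_mul] at hbound
  rw [tendsto_iff_norm_sub_tendsto_zero]
  refine squeeze_zero' (Eventually.of_forall fun _ => norm_nonneg _) ?_ hbound
  filter_upwards [hLtop.eventually_ge_atTop N] with L hL
  exact norm_det_chainMat_sub_le hs.le ha hc hσ hphase (L : ℕ) hL

/-- When `N / L → 0` the folding error `s^{-(L-N)}` beats the growth `C ^ N` allowed by the size of the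
determinant. -/
theorem tendsto_det_chainMat_sub {t : ℤ →₀ ℝ} {ω : ℤ} {σ : ℂ} (hs : 1 < s)
    (ha : IsWiener s a) (hc : IsWiener s c) (hσ : ‖σ‖ = 1)
    (hphase : ∀ z : ℂ, ‖z‖ = 1 → phase t z = σ * (z ^ ω * (psEval a z * psEval c z⁻¹)))
    {N : ℕ → ℕ} {L : ℕ → ℕ+} (hN : Tendsto N atTop atTop)
    (hNL : Tendsto (fun k : ℕ => (N k : ℝ) / ((L k : ℕ) : ℝ)) atTop (𝓝 0)) :
    Tendsto (fun k => (chainMat t ω (N k) (L k : ℕ)).det -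
      σ ^ N k * (toepMat (N k) a c).det) atTop (𝓝 0) := by
  have h0 : 0 < s := zero_lt_one.trans hs
  have hr0 : 0 ≤ s⁻¹ := inv_nonneg.2 h0.le
  have hr1 : s⁻¹ < 1 := inv_lt_one_of_one_lt₀ hs
  set A := wnorm s a * wnorm s c with hA
  have hA0 : 0 ≤ A := mul_nonneg (wnorm_nonneg hs.le _) (wnorm_nonneg hs.le _)
  have hB := toepBound_nonneg hs.le a c
  have hlim := tendsto_self_mul_const_pow_of_lt_one hr0 hr1
  obtain ⟨M, hM⟩ := hlim.bddAbove_range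
  have hM' : ∀ n : ℕ, (n : ℝ) * s⁻¹ ^ n ≤ M := fun n => hM ⟨n, rfl⟩
  have hM0 : 0 ≤ M := by simpa using hM' 0
  set β := 1 + toepBound s a c + A * M with hβ
  have hβ1 : 1 ≤ β := by have := mul_nonneg hA0 hM0; linarith
  -- Once `(m + 2) N ≤ L`, each of the `N` rows may use a factor `s^{-(m+1)}`, which absorbs `β`.
  obtain ⟨m, hm⟩ := pow_unbounded_of_one_lt (β * s) hs
  have hev : ∀ᶠ k in atTop, (m + 2) * N k ≤ (L k : ℕ) := by
    have hpos : (0 : ℝ) < ((m + 2 : ℕ) : ℝ)⁻¹ := by positivity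
    filter_upwards [hNL.eventually_lt_const hpos] with k hk
    have hL : (0 : ℝ) < ((L k : ℕ) : ℝ) := by exact_mod_cast (L k).pos
    rw [div_lt_iff₀ hL, inv_mul_eq_div, lt_div_iff₀ (by positivity), mul_comm] at hk
    exact_mod_cast hk.le
  have hfin : Tendsto (fun k => A * ((N k : ℝ) ^ 2 * s⁻¹ ^ N k)) atTop (𝓝 0) := by
    have := ((tendsto_pow_const_mul_const_pow_of_lt_one 2 hr0 hr1).comp hN).const_mul A
    rwa [mul_zero] at this
  refine squeeze_zero_norm' ?_ hfin
  filter_upwards [hev] with k hk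
  set n := N k with hn
  have hexp : (m + 1) * n ≤ (L k : ℕ) - n := by
    have : (m + 2) * n = (m + 1) * n + n := by ring
    omega
  have hpow : s⁻¹ ^ ((L k : ℕ) - n) ≤ (s⁻¹ ^ (m + 1)) ^ n := by
    rw [← pow_mul]; exact pow_le_pow_of_le_one hr0 hr1.le hexp
  have hpow1 : s⁻¹ ^ ((L k : ℕ) - n) ≤ s⁻¹ ^ n :=
    pow_le_pow_of_le_one hr0 hr1.le (le_trans (Nat.le_mul_of_pos_left n (Nat.succ_pos m)) hexp)
  have hNL' : n ≤ (L k : ℕ) := le_trans (Nat.le_mul_of_pos_left n (Nat.succ_pos _)) hk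
  have hbase : 1 + toepBound s a c + n * (A * s⁻¹ ^ ((L k : ℕ) - n)) ≤ β := by
    have h1 : (n : ℝ) * (A * s⁻¹ ^ ((L k : ℕ) - n)) ≤ A * M := by
      calc (n : ℝ) * (A * s⁻¹ ^ ((L k : ℕ) - n)) ≤ n * (A * s⁻¹ ^ n) := by gcongr
        _ = A * (n * s⁻¹ ^ n) := by ring
        _ ≤ A * M := mul_le_mul_of_nonneg_left (hM' n) hA0
    linarith
  have hsm : s⁻¹ ^ (m + 1) * β ≤ s⁻¹ := by
    have h1 : s⁻¹ ^ m * (β * s) ≤ 1 := by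
      rw [inv_pow, inv_mul_le_iff₀ (by positivity), mul_one]; exact hm.le
    calc s⁻¹ ^ (m + 1) * β = s⁻¹ ^ m * (β * s) * s⁻¹ * s⁻¹ := by
          rw [pow_succ]; field_simp
      _ ≤ 1 * s⁻¹ * s⁻¹ := by gcongr
      _ ≤ s⁻¹ := by rw [one_mul]; exact mul_le_of_le_one_left hr0 hr1.le
  refine (norm_det_chainMat_sub_le hs.le ha hc hσ hphase (L k : ℕ) hNL').trans ?_
  calc (n : ℝ) * (n * (A * s⁻¹ ^ ((L k : ℕ) - n))) *
        (1 + toepBound s a c + n * (A * s⁻¹ ^ ((L k : ℕ) - n))) ^ n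
      ≤ n * (n * (A * (s⁻¹ ^ (m + 1)) ^ n)) * β ^ n := by
        have h1 : 0 ≤ 1 + toepBound s a c + n * (A * s⁻¹ ^ ((L k : ℕ) - n)) := by positivity
        gcongr
    _ = A * ((n : ℝ) ^ 2 * (s⁻¹ ^ (m + 1) * β) ^ n) := by rw [mul_pow]; ring
    _ ≤ A * ((n : ℝ) ^ 2 * s⁻¹ ^ n) := by gcongr

end FiniteChain

section Main

/-! ### The order parameter -/

/-- In the mixed factor both orders of the arguments occur, hence the square. -/
theorem crossProd_quotient_eq (t : ℤ →₀ ℝ) :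
    crossProd (invZerosOut t) (invZerosOut t) * crossProd (zerosIn t) (zerosIn t) /
        (crossProd (invZerosOut t) (zerosIn t) * crossProd (zerosIn t) (invZerosOut t)) =
      ((zerosIn t ×ˢ zerosIn t).map fun p => 1 - p.1 * p.2).prod *
        ((zerosOut t ×ˢ zerosOut t).map fun p => 1 - 1 / (p.1 * p.2)).prod /
        ((zerosIn t ×ˢ zerosOut t).map fun p => (1 - p.1 / p.2) ^ 2).prod := by
  have h1 : crossProd (invZerosOut t) (invZerosOut t) =
      ((zerosOut t ×ˢ zerosOut t).map fun p => 1 - 1 / (p.1 * p.2)).prod := by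
    simp only [crossProd, Multiset.prod_map_product_eq_prod_prod, invZerosOut, Multiset.map_map,
      Function.comp_def, one_div, mul_inv]
  have h2 : crossProd (zerosIn t) (invZerosOut t) =
      ((zerosIn t ×ˢ zerosOut t).map fun p => 1 - p.1 / p.2).prod := by
    simp only [crossProd, Multiset.prod_map_product_eq_prod_prod, invZerosOut, Multiset.map_map,
      Function.comp_def, div_eq_mul_inv]
  have h3 : crossProd (invZerosOut t) (zerosIn t) = crossProd (zerosIn t) (invZerosOut t) := by
    simp only [crossProd, Multiset.prod_map_product_eq_prod_prod]
    rw [Multiset.prod_map_prod_map]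
    simp only [mul_comm]
  rw [h3, h1, h2, ← sq, Multiset.prod_map_pow, crossProd, mul_comm]

end Main
end BDI

theorem mainTheorem1 (t : ℤ →₀ ℝ) (ht : t ≠ 0) (hc : BDI.centralCharge t = 0)
    (ω : ℤ) (hω : BDI.windingNumber t = ω) :
    ∃ R : ℝ, 0 < R ∧
      (R : ℂ) =
        ((BDI.zerosIn t ×ˢ BDI.zerosIn t).map fun p => 1 - p.1 * p.2).prod *
          ((BDI.zerosOut t ×ˢ BDI.zerosOut t).map fun p => 1 - 1 / (p.1 * p.2)).prod /
          ((BDI.zerosIn t ×ˢ BDI.zerosOut t).map fun p => (1 - p.1 / p.2) ^ 2).prod ∧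
      ∀ ψ : (L : ℕ+) → Finset (ZMod (L : ℕ)) → ℂ,
        (∀ L : ℕ+, BDI.IsGroundState (BDI.hamiltonian (L : ℕ) t) (ψ L)) →
        (∃ G : ℕ → ℂ,
          (∀ N : ℕ, Tendsto (fun L : ℕ+ => BDI.stringCorr (ψ L) ω N) atTop (𝓝 (G N))) ∧
          Tendsto (fun N : ℕ => ‖G N‖) atTop (𝓝 (R ^ (1 / 4 : ℝ)))) ∧
        (∀ (N : ℕ → ℕ) (L : ℕ → ℕ+), Tendsto N atTop atTop → Tendsto L atTop atTop →
          Tendsto (fun k : ℕ => (N k : ℝ) / ((L k : ℕ) : ℝ)) atTop (𝓝 0) →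
          Tendsto (fun k : ℕ => ‖BDI.stringCorr (ψ (L k)) ω (N k)‖) atTop
            (𝓝 (R ^ (1 / 4 : ℝ)))) := by
  obtain ⟨s, hs, hS, hT, g, hg, hgg, σ, hσσ, hphase⟩ := BDI.exists_phase_factorization ht hc
  rw [hω] at hphase
  have hf : ∀ z : ℂ, ‖z‖ = 1 → BDI.symbol t z ≠ 0 := fun z hz => BDI.symbol_ne_zero ht hc hz
  have hσ : ‖σ‖ = 1 := by
    have h := congrArg norm hσσ
    rw [norm_mul, norm_one] at h
    nlinarith [norm_nonneg σ]
  have hσpow : ∀ N : ℕ, ‖σ ^ N‖ = 1 := fun N => by rw [norm_pow, hσ, one_pow]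
  set D : ℕ → ℂ := fun N => (BDI.toepMat N g g⁻¹).det with hD
  have hlim : Tendsto (fun N => D N ^ 4) atTop
      (𝓝 (BDI.crossProd (BDI.invZerosOut t) (BDI.invZerosOut t) *
        BDI.crossProd (BDI.zerosIn t) (BDI.zerosIn t) /
          (BDI.crossProd (BDI.invZerosOut t) (BDI.zerosIn t) *
            BDI.crossProd (BDI.zerosIn t) (BDI.invZerosOut t)))) := by
    refine BDI.HasDetLimit.of_mul_self hs hg hg.inv ?_
    have h := BDI.hasDetLimit_quotient hs hS hT
    rwa [← hgg, PowerSeries.mul_inv_rev] at h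
  set e := BDI.crossProd (BDI.invZerosOut t) (BDI.invZerosOut t) *
        BDI.crossProd (BDI.zerosIn t) (BDI.zerosIn t) /
          (BDI.crossProd (BDI.invZerosOut t) (BDI.zerosIn t) *
            BDI.crossProd (BDI.zerosIn t) (BDI.invZerosOut t)) with he
  have he0 : e ≠ 0 :=
    div_ne_zero (mul_ne_zero (BDI.crossProd_ne_zero hs.le hS hS) (BDI.crossProd_ne_zero hs.le hT hT))
      (mul_ne_zero (BDI.crossProd_ne_zero hs.le hS hT) (BDI.crossProd_ne_zero hs.le hT hS))
  -- The determinants are real up to sign, so their fourth powers are nonnegative reals.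
  have hreal : ∀ N, D N ^ 4 = ((‖D N‖ ^ 4 : ℝ) : ℂ) := by
    intro N
    have h1 := BDI.tendsto_det_chainMat hs hg hg.inv hσ hphase N
    have h2 : (starRingEnd ℂ) (σ ^ N * D N) = σ ^ N * D N :=
      tendsto_nhds_unique ((Complex.continuous_conj.tendsto _).comp h1)
        (h1.congr fun L => (BDI.conj_det_chainMat t ω N (L : ℕ)).symm)
    obtain ⟨r, hr⟩ := Complex.conj_eq_iff_real.1 h2
    have h3 : (σ ^ N) ^ 4 = 1 := by
      rw [← pow_mul, show N * 4 = 2 * (2 * N) by ring, pow_mul, sq, hσσ, one_pow]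
    have h4 : ‖D N‖ = |r| := by
      rw [← Real.norm_eq_abs, ← Complex.norm_real, ← hr, norm_mul, hσpow, one_mul]
    rw [h4, ← one_mul (D N ^ 4), ← h3, ← mul_pow, hr]
    have : |r| ^ 4 = r ^ 4 := by
      rw [show 4 = 2 * 2 from rfl, pow_mul, pow_mul, sq_abs]
    rw [this]; push_cast; rfl
  have hlimR : Tendsto (fun N => ‖D N‖ ^ 4) atTop (𝓝 e.re) := by
    refine ((Complex.continuous_re.tendsto e).comp hlim).congr fun N => ?_
    rw [Function.comp_apply, hreal N, Complex.ofReal_re]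
  have heR : ((e.re : ℝ) : ℂ) = e := by
    refine tendsto_nhds_unique ((Complex.continuous_ofReal.tendsto _).comp hlimR) ?_
    exact hlim.congr fun N => hreal N
  have hpos : 0 < e.re := by
    refine lt_of_le_of_ne (ge_of_tendsto' hlimR fun N => by positivity) fun h => he0 ?_
    rw [← heR, ← h, Complex.ofReal_zero]
  have hnorm : Tendsto (fun N => ‖D N‖) atTop (𝓝 (e.re ^ (1 / 4 : ℝ))) := by
    refine (hlimR.rpow_const (p := (1 / 4 : ℝ)) (Or.inr (by norm_num))).congr fun N => ?_
    rw [← Real.rpow_natCast, ← Real.rpow_mul (norm_nonneg _)]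
    norm_num
  refine ⟨e.re, hpos, by rw [heR, he, BDI.crossProd_quotient_eq], fun ψ hψ => ⟨?_, ?_⟩⟩
  · choose κ hκ hcorr using fun N => BDI.stringCorr_eq_det ω N
    refine ⟨fun N => κ N * (σ ^ N * D N), fun N => ?_, ?_⟩
    · refine ((BDI.tendsto_det_chainMat hs hg hg.inv hσ hphase N).const_mul (κ N)).congr' ?_
      filter_upwards [eventually_ge_atTop (⟨max ω.natAbs N + 1, Nat.succ_pos _⟩ : ℕ+)] with L hL
      have hL' : max ω.natAbs N + 1 ≤ (L : ℕ) := hL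
      exact (hcorr N L t (ψ L) (hψ L) hf (by omega) (by omega)).symm
    · refine hnorm.congr fun N => ?_
      rw [norm_mul, norm_mul, hκ, hσpow, one_mul, one_mul]
  · intro N L hN hL hNL
    have h1 := (BDI.tendsto_det_chainMat_sub hs hg hg.inv hσ hphase hN hNL).norm
    have h2 : Tendsto (fun k => ‖(BDI.chainMat t ω (N k) (L k : ℕ)).det‖ -
        ‖σ ^ N k * D (N k)‖) atTop (𝓝 0) := by
      refine squeeze_zero_norm (fun k => abs_norm_sub_norm_le _ _) ?_
      simpa using h1
    have h3 := h2.add (hnorm.comp hN)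
    rw [zero_add] at h3
    refine h3.congr' ?_
    have hev1 : ∀ᶠ k in atTop, N k ≤ (L k : ℕ) := by
      filter_upwards [hNL.eventually_lt_const zero_lt_one] with k hk
      have : (0 : ℝ) < ((L k : ℕ) : ℝ) := by exact_mod_cast (L k).pos
      rw [div_lt_one this] at hk
      exact_mod_cast hk.le
    filter_upwards [hev1, hL.eventually_ge_atTop (⟨ω.natAbs + 1, Nat.succ_pos _⟩ : ℕ+)] with k hk hk2
    have hk3 : ω.natAbs + 1 ≤ (L k : ℕ) := hk2
    obtain ⟨κ, hκ, hcorr⟩ := BDI.stringCorr_eq_det ω (N k)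
    have hk4 := hcorr (L k) t (ψ (L k)) (hψ (L k)) hf (by omega) hk
    rw [hk4, norm_mul κ, hκ, one_mul, norm_mul (σ ^ N k), hσpow, one_mul]
    simp [BDI.chainMat]
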